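/- **Setting.** Let $q,t,p\in\mathbb C^\times$ with $|q|,|t|,|p|<1$, put $p^*=pq/t$ and assume $|p^*|<1$; assume $q/t$ is not a root of unity and $p^k\neq q^at^b$ for all integers $k\ge1$, $a,b\ge0$. Fix a fourth root $(t/q)^{1/4}$ and let $\gamma=(t/q)^{1/2}$ be its square. Put $\kappa_m=(1-q^m)(1-t^{-m})(1-(t/q)^m)$. On the Fock space $\mathbb C[\alpha_{-m}\,(m>0)]$ let $\alpha_{-m}$ act by multiplication and $\alpha_m=-\frac{\kappa_m}{m}(1-(q/t)^m)\frac{1-p^m}{1-p^{*m}}\partial_{\alpha_{-m}}$ for $m>0$; put $\alpha'_m=\frac{1-p^{*m}}{1-p^m}\gamma^m\alpha_m$. For $N\in\mathbb Z$, $u\in\mathbb C^\times$ the level $(1,N)$ module $\mathcal F^{(1,N)}_u$ is this space with the elliptic currents $$x^+(z)=uz^{-N}(t/q)^{3N/4}e^{-\sum_{n>0}\frac{(t/q)^{n/4}}{1-(t/q)^n}\alpha_{-n}z^n}e^{\sum_{n>0}\frac{(t/q)^{3n/4}}{1-(t/q)^n}\alpha_nz^{-n}},$$ $$x^-(z)=u^{-1}z^{N}(t/q)^{-3N/4}\,\widetilde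 x^-(z),\quad \widetilde x^-(z)=e^{\sum_{n>0}\frac{(t/q)^{n/4}}{1-(t/q)^n}\alpha'_{-n}z^n}e^{-\sum_{n>0}\frac{(t/q)^{3n/4}}{1-(t/q)^n}\alpha'_nz^{-n}}.$$ For a partition $\lambda$ with arm and leg lengths $a,\ell$ let $n(\lambda)=\sum_i(i-1)\lambda_i$, let $\lambda'$ be the conjugate, and let $$c_\lambda=\prod_{\Box\in\lambda}(1-q^{a}t^{\ell+1}),\quad c'_\lambda=\prod_{\Box\in\lambda}(1-q^{a+1}t^{\ell}),\quad f_\lambda=(-1)^{|\lambda|}q^{n(\lambda')}t^{-n(\lambda)}\gamma^{-|\lambda|},$$ $$N_\lambda=\prod_{\Box\in\lambda}\frac{(pq^{a+1}t^{\ell};p)_\infty}{(pq^{a}t^{\ell+1};p)_\infty},\quad N'_\lambda=\prod_{\Box\in\lambda}\frac{(pq^{-a}t^{-\ell-1};p)_\infty}{(pq^{-a-1}t^{-\ell};p)_\infty},$$ $t(\lambda,u,v,N)=(-uv)^{|\lambda|}(-v)^{-(N+1)|\lambda|}f_\lambda^{-N-1}$, $t^*(\lambda,u,v,N)=(q^{-1}v)^{-|\lambda|}(-u)^{N|\lambda|}f_\lambda^N$.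 The type I vertex operator and its shifted inverse have the components $$\Phi_\lambda(u)=\frac{q^{n(\lambda')}N_\lambda t^*(\lambda,u,v,N)}{c_\lambda}\widetilde\Phi_\lambda(u):\mathcal F^{(1,N+1)}_{-uv}\to\mathcal F^{(1,N)}_v,\qquad \Phi^*_\lambda(u)=\frac{q^{n(\lambda')}N'_\lambda t(\lambda,v,up^{-1},N)}{c'_\lambda}:\widetilde\Phi_\lambda(p^{-1}u)^{-1}:\ ,$$ $$\widetilde\Phi_\lambda(u)=\;:e^{\sum_{m>0}\frac1{\kappa_m}\left(\alpha'_m(\gamma u)^{-m}-\alpha'_{-m}(\gamma u)^m\right)}\prod_{(i,j)\in\lambda}\widetilde x^-((t/q)^{1/4}q^{j-1}t^{-i+1}u):$$ (values in the completed Fock space). Products such as $:\widetilde\Phi_\lambda(w)^{-1}:\widetilde\Phi_\lambda(u)$ are taken matrix element by matrix element in the region $|u/w|\ll1$ where the sum over intermediate states converges, and then continued meromorphically in $u/w$ to $w=p^{-1}u$; similarly for the opposite order, from $|w/u|\ll 1$. Put $T(u)=\Phi^*(u)\Phi(u)=\sum_\lambda\Phi^*_\lambda(u)\Phi_\lambda(u)$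 on $\mathcal F^{(1,N+1)}_{-uv}$ (a formal sum over partitions). Let $Y(u)=:\exp\{\sum_{m\ne0}y_mu^{-m}\}:$ with $y_m=\frac{1-p^m}{\kappa_m}\gamma^{-m}\alpha'_m$; let $A(\lambda)$, $R(\lambda)$ be the addable and removable boxes, $q^\Box=t^{i-1}q^{-j+1}$ for $\Box=(i,j)$, and $$\mathcal Z_\lambda=\mathcal Z^{\widehat A_0}_\lambda(t,q^{-1},p)=\prod_{\Box\in\lambda}\frac{(1-pq^{a+1}t^{\ell})(1-pq^{-a}t^{-\ell-1})}{(1-q^{a+1}t^{\ell})(1-q^{-a}t^{-\ell-1})},$$ $$\mathfrak q=p^*p^{N-1}(t/q)^{1/2},\qquad \mathcal C=\frac{(pt;q,t,p)_\infty}{(p^2q;q,t,p)_\infty},\qquad \text{where }(z;q,t,p)_\infty=\prod_{a,b,c\ge0}(1-zq^at^bp^c).$$ **Theorem.** For all $N\in\mathbb Z$ and $u,v\in\mathbb C^\times$ the following hold. 1. $T(u)=\mathcal C\sum_\lambda\mathfrak q^{|\lambda|}\mathcal Z_\lambda:\prod_{\Box\in A(\lambda)}Y(u/q^\Box)\prod_{\blacksquare\in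 R(\lambda)}Y((q/t)u/q^\blacksquare)^{-1}:$. The identity holds term by term in $\lambda$; moreover, for any fixed pair of monomial basis vectors, the sums over $\lambda$ of the matrix elements of both sides converge absolutely, to the same value, for all sufficiently large $N$. For the opposite order of composition, $\Phi_\lambda(u)\Phi^*_\lambda(u)$, the same term by term identity holds with $\mathfrak q=p^{*-1}p^{N-1}(t/q)^{1/2}$ and $\mathcal C=(p^{-1}t;q,t,p)_\infty/(q;q,t,p)_\infty$. 2. Up to the constant $\mathcal C$, $T(u)$ is the Kimura–Pestun generating function of the affine quiver $W$-algebra of the Jordan quiver $\widehat A_0$ with parameters $q_1=p$, $q_2=p^{*-1}$ (so $q_1q_2=t/q$), mass $\mu=q^{-1}$ and coupling $\mathfrak q$: with box weights $w(i,j)=(\mu^{-1}q_1q_2)^{i-1}\mu^{j-1}$ and $\mathcal Z_\lambda=\prod_{\Box}\frac{(1-q_1(\mu^{-1}q_1q_2)^{\ell}\mu^{-a-1})(1-q_1(\mu^{-1}q_1q_2)^{-\ell-1}\mu^{a})}{(1-(\mu^{-1}q_1q_2)^{\ell}\mu^{-a-1})(1-(\mu^{-1}q_1q_2)^{-\ell-1}\mu^{a})}$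 its terms are $\mathfrak q^{|\lambda|}\mathcal Z_\lambda:\prod_{A(\lambda)}Y(u/w(\Box))\prod_{R(\lambda)}Y(u/(q_1q_2w(\blacksquare)))^{-1}:$, and $[y_m,y_n]=-\frac1m\frac{(1-q_1^m)(1-q_2^m)}{c^{[-m]}}\delta_{m+n,0}$, where $c^{[n]}=1+(q_1q_2)^{-n}-\mu^{-n}-\mu^n(q_1q_2)^{-n}$. 3. The vacuum expectation value is $\langle0|T(u)|0\rangle=\mathcal C\sum_\lambda\mathfrak q^{|\lambda|}\mathcal Z_\lambda$ (term by term, and as absolutely convergent sums for all sufficiently large $N$). For every $n$, $$\sum_{|\lambda|=n}\mathcal Z_\lambda=\sum_{|\lambda|=n}\frac{N_{\lambda\lambda}(pq/t)}{N_{\lambda\lambda}(q/t)}=\chi_{y}(\mathrm{Hilb}_n(\mathbb C^2))\big|_{y=p},$$ so it is $\mathcal C$ times the 5d $\mathcal N=2^*$ $U(1)$ instanton partition function, i.e. the generating function in $\mathfrak q$ of the $\chi_y$-genera. Here $N_{\lambda\mu}(x)=\prod_{\Box\in\lambda}(1-xq^{-a_\mu(\Box)-1}t^{-\ell_\lambda(\Box)})\prod_{\blacksquare\in\mu}(1-xq^{a_\lambda(\blacksquare)}t^{\ell_\mu(\blacksquare)+1})$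 is the Nekrasov function and $\chi_y$ is the equivariant genus $\sum_i(-y)^i\chi(\Omega^i)$ at the torus element $(t_1,t_2)=(t,q^{-1})$, defined by localization: the sum over the torus invariant ideals $I\subset\mathbb C[x,y]$ of colength $n$ of $\prod_w\frac{1-yw^{-1}}{1-w^{-1}}$, with $w$ the torus weights of $\mathrm{Hom}(I,\mathbb C[x,y]/I)$. 4. The level $(1,N)$ currents are the two screening currents. With $s^+_m=\frac{(t/q)^{m/2}}{1-(t/q)^m}\alpha_m$ and $s^-_m=\frac{(t/q)^{m/2}}{1-(t/q)^m}\alpha'_m$, $$x^\pm((t/q)^{1/4}z)=\left((t/q)^{N/2}u/z^N\right)^{\pm1}:\exp\Big\{\pm\sum_{m\neq0}s^\pm_mz^{-m}\Big\}:,$$ $$[s^+_m,s^+_n]=-\tfrac1m\tfrac{1-p^m}{1-p^{*m}}(1-q^m)(1-t^{-m})\delta_{m+n,0},\qquad [s^-_m,s^-_n]=-\tfrac1m\tfrac{1-p^{*-m}}{1-p^{-m}}(1-q^m)(1-t^{-m})\delta_{m+n,0}.$$ Up to a shift of the argument these are the oscillator parts of the Kimura–Pestun screening currents: $s_m=\gamma^{-m}s^+_m$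 with $(q_1,q_2)=(p,p^{*-1})$, and $s_m=-p^{*m}s^-_m$ with $(q_1,q_2)=(p^{*-1},p)$, both with $\mu=q^{-1}$, satisfy $[s_m,s_n]=-\frac1m\frac{1-q_1^m}{1-q_2^{-m}}c^{[m]}\delta_{m+n,0}$ and $[y_m,s_n]=-\frac1m(1-q_1^m)\delta_{m+n,0}$, together with the $[y_m,y_n]$ relation of item 2. -/

import Mathlib

open scoped Topology
open Filter

noncomputable section

namespace EllipticToroidal

/-! ## Parameters -/

/-- Generic complex parameters `q, t, p` of the level `(1,N)` representations, together with a
choice `g = (t/q)^{1/4}` of the value of the central element `γ^{1/2}`. -/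
structure Params where
  q : ℂ
  t : ℂ
  p : ℂ
  g : ℂ
  q_ne : q ≠ 0
  t_ne : t ≠ 0
  p_ne : p ≠ 0
  norm_q : ‖q‖ < 1
  norm_t : ‖t‖ < 1
  norm_p : ‖p‖ < 1
  /-- `p^* = p q / t` satisfies `|p^*| < 1` -/
  norm_ps : ‖p * q / t‖ < 1
  /-- `q / t` is not a root of unity -/
  not_root : ∀ m : ℕ, 0 < m → (t / q) ^ m ≠ 1
  /-- `p` is generic with respect to `q, t` -/
  generic : ∀ k a b : ℕ, 0 < k → p ^ k ≠ q ^ a * t ^ b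
  g_pow : g ^ 4 = t / q

namespace Params

variable (P : Params)

/-- `γ = (t/q)^{1/2}` -/
def γ : ℂ := P.g ^ 2

/-- `p^* = p γ^{-2} = p q / t` -/
def ps : ℂ := P.p * P.q / P.t

/-- `κ_m = (1 - q^m)(1 - t^{-m})(1 - (t/q)^m)` -/
def kappa (m : ℤ) : ℂ := (1 - P.q ^ m) * (1 - P.t ^ (-m)) * (1 - (P.t / P.q) ^ m)

end Params

/-! ## The Fock space and normal ordered exponentials -/

/-- The vector space `ℂ[α_{-m} (m > 0)]` underlying every Fock module `F^{(1,N)}_u`;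
the variable `X m` is `α_{-m}` and `1` is the vacuum vector. -/
abbrev Fock : Type := MvPolynomial ℕ+ ℂ

/-- The completion of the Fock space in which infinite sums of monomials are allowed. -/
abbrev FockHat : Type := MvPowerSeries ℕ+ ℂ

/-- The scalar by which the annihilation operator `α_m` (`m > 0`) acts, as a multiple of
`∂/∂α_{-m}`. -/
def heis (P : Params) (m : ℤ) : ℂ :=
  -(P.kappa m / m) * (1 - (P.q / P.t) ^ m) * ((1 - P.p ^ m) / (1 - P.ps ^ m))

/-- The Heisenberg generators `α_m` on the Fock space (the index `0` does not occur). -/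
def alpha (P : Params) : ℤ → Module.End ℂ Fock
  | Int.ofNat 0 => 0
  | Int.ofNat (k + 1) => heis P (k + 1) • (MvPolynomial.pderiv (R := ℂ) k.succPNat).toLinearMap
  | Int.negSucc k => LinearMap.mulLeft ℂ (MvPolynomial.X k.succPNat)

/-- `α'_m = rho m • α_m`, where `rho m = γ^m (1 - p^{*m}) / (1 - p^m)`. -/
def rho (P : Params) (m : ℤ) : ℂ := (1 - P.ps ^ m) / (1 - P.p ^ m) * P.γ ^ m

/-- The generators `α'_m`. -/
def alphaPrime (P : Params) (m : ℤ) : Module.End ℂ Fock := rho P m • alpha P m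

/-- `exp (∑_{m>0} b_m ∂_m)` on polynomials, i.e. the translation `X_m ↦ X_m + b_m`
(see `annExp_eq_exp`). -/
def annExp (b : ℕ+ → ℂ) : Fock →ₐ[ℂ] Fock :=
  MvPolynomial.aeval fun m => MvPolynomial.X m + MvPolynomial.C (b m)

/-- The translation `annExp b` is the exponential series of `D = ∑_m b_m ∂_m`
(the derivation with `D X_m = b_m`), which terminates on every polynomial. -/
theorem annExp_eq_exp (b : ℕ+ → ℂ) (f : Fock) :
    ∀ᶠ n in atTop, ∑ k ∈ Finset.range n, ((k.factorial : ℂ)⁻¹) •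
      ((MvPolynomial.mkDerivation ℂ fun m => MvPolynomial.C (b m) :
        Derivation ℂ Fock Fock).toLinearMap ^ k) f = annExp b f := by
  set D : Derivation ℂ Fock Fock := MvPolynomial.mkDerivation ℂ fun m => MvPolynomial.C (b m)
  have hpow : ∀ (k : ℕ) (h : Fock) (m : ℕ+), (D.toLinearMap ^ (k + 1)) (h * MvPolynomial.X m) =
      (D.toLinearMap ^ (k + 1)) h * MvPolynomial.X m +
        ((k + 1 : ℕ) : ℂ) • b m • (D.toLinearMap ^ k) h := by
    intro k
    induction k with
    | zero =>
      intro h m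
      simp [D, MvPolynomial.smul_eq_C_mul]
      ring
    | succ k ih =>
      intro h m
      rw [pow_succ', Module.End.mul_apply, ih, Module.End.mul_apply]
      simp only [map_add, map_smul, Derivation.coeFn_coe,
        Derivation.leibniz]
      rw [show D (MvPolynomial.X m) = MvPolynomial.C (b m) by simp [D]]
      rw [show D (((D : Fock →ₗ[ℂ] Fock) ^ k) h) = ((D : Fock →ₗ[ℂ] Fock) ^ (k + 1)) h by
        rw [pow_succ', Module.End.mul_apply]; rfl]
      simp only [smul_eq_mul, MvPolynomial.smul_eq_C_mul, Nat.cast_add, Nat.cast_one, map_add,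
        map_one]
      ring
  induction f using MvPolynomial.induction_on with
  | C a =>
    filter_upwards [eventually_ge_atTop 1] with n hn
    obtain ⟨n, rfl⟩ := Nat.exists_eq_add_of_le' hn
    rw [Finset.sum_range_succ']
    have h0 : ∀ k : ℕ, (D.toLinearMap ^ (k + 1)) (MvPolynomial.C a) = 0 := by
      intro k
      rw [pow_succ, Module.End.mul_apply]
      simp [D]
    simp [h0, annExp]
  | add f h hf hh =>
    filter_upwards [hf, hh] with n hn1 hn2
    simp only [map_add, smul_add, Finset.sum_add_distrib, hn1, hn2]
  | mul_X h m hh =>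
    have hh' := (tendsto_add_atTop_nat 1).eventually hh
    filter_upwards [(tendsto_sub_atTop_nat 1).eventually hh,
      (tendsto_sub_atTop_nat 1).eventually hh', eventually_ge_atTop 1] with n h1 h2 hn
    obtain ⟨n, rfl⟩ := Nat.exists_eq_add_of_le' hn
    simp only [Nat.add_sub_cancel] at h1 h2
    rw [map_mul, Finset.sum_range_succ']
    have : ∀ k : ℕ, (((k + 1).factorial : ℂ)⁻¹) • (D.toLinearMap ^ (k + 1)) (h * MvPolynomial.X m) =
        ((((k + 1).factorial : ℂ)⁻¹) • (D.toLinearMap ^ (k + 1)) h) * MvPolynomial.X m +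
          b m • (((k.factorial : ℂ)⁻¹) • (D.toLinearMap ^ k) h) := by
      intro k
      rw [hpow, smul_add, smul_mul_assoc, smul_smul, smul_smul, smul_smul, Nat.factorial_succ]
      congr 2
      have : ((k : ℂ) + 1) ≠ 0 := by exact_mod_cast Nat.succ_ne_zero k
      have : ((k.factorial : ℕ) : ℂ) ≠ 0 := by exact_mod_cast Nat.factorial_ne_zero k
      push_cast
      field_simp
    rw [Finset.sum_congr rfl fun k _ => this k, Finset.sum_add_distrib, ← Finset.smul_sum, h1,
      ← Finset.sum_mul]
    rw [Finset.sum_range_succ'] at h2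
    have h3 := congrArg (· * (MvPolynomial.X m : Fock)) h2
    simp only [add_mul] at h3
    simp only [annExp, MvPolynomial.aeval_X, mul_add, MvPolynomial.smul_eq_C_mul] at h3 ⊢
    rw [← h3]
    simp only [pow_zero, Module.End.one_apply, Nat.factorial_zero, Nat.cast_one, inv_one, map_one,
      one_mul]
    ring

/-- `exp (∑_{m>0} b_m X_m)` as a formal power series. -/
def creExp (b : ℕ+ → ℂ) : FockHat :=
  fun e => e.prod fun m k => b m ^ k / (k.factorial : ℂ)

/-- The normal ordered exponential
`:exp (∑_{m ≠ 0} d_m α_m): = exp (∑_{m>0} d_{-m} α_{-m}) exp (∑_{m>0} d_m α_m)`,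
as a map from the Fock space to its completion. -/
def nexp (P : Params) (d : ℤ → ℂ) : Fock →ₗ[ℂ] FockHat :=
  LinearMap.mulLeft ℂ (creExp fun m => d (-(m : ℤ))) ∘ₗ
    (MvPolynomial.coeToMvPowerSeries.algHom ℂ).toLinearMap ∘ₗ
      (annExp fun m => d m * heis P m).toLinearMap

/-- The normal ordered exponential `:exp (∑_{m ≠ 0} c_m α'_m):`. -/
def nexp' (P : Params) (c : ℤ → ℂ) : Fock →ₗ[ℂ] FockHat :=
  nexp P fun m => c m * rho P m

/-- The monomial basis of the Fock space. -/
def basisVec (x : ℕ+ →₀ ℕ) : Fock := MvPolynomial.monomial x 1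

/-- Matrix elements in the monomial basis. The entry `(0, 0)` is the vacuum expectation value. -/
def entry (A : Fock →ₗ[ℂ] FockHat) (y x : ℕ+ →₀ ℕ) : ℂ := MvPowerSeries.coeff y (A (basisVec x))

/-- `c` is the matrix element `(y, x)` of the product `A(r₀) B(r₀)`, in the usual sense of operator
products of vertex operators: for small `r ≠ 0` the sum over intermediate states converges, and
`c` is the value at `r₀` of its (unique) meromorphic continuation to `ℂ`. -/
def IsProductEntry (A B : ℂ → Fock →ₗ[ℂ] FockHat) (r₀ : ℂ) (y x : ℕ+ →₀ ℕ) (c : ℂ) : Prop :=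
  ∃ f : ℂ → ℂ, Meromorphic f ∧ AnalyticAt ℂ f r₀ ∧ f r₀ = c ∧
    ∀ᶠ r in 𝓝[≠] (0 : ℂ), HasSum (fun e => entry (A r) y e * entry (B r) e x) (f r)

/-- The matrix elements of products are uniquely determined. -/
theorem IsProductEntry.unique {A B : ℂ → Fock →ₗ[ℂ] FockHat} {r₀ : ℂ} {y x : ℕ+ →₀ ℕ} {c c' : ℂ}
    (h : IsProductEntry A B r₀ y x c) (h' : IsProductEntry A B r₀ y x c') : c = c' := by
  obtain ⟨f, hf, haf, rfl, hsf⟩ := h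
  obtain ⟨f', hf', haf', rfl, hsf'⟩ := h'
  have hmer : MeromorphicOn (f - f') Set.univ := fun z _ => (hf z).sub (hf' z)
  have h0 : meromorphicOrderAt (f - f') 0 = ⊤ := by
    rw [meromorphicOrderAt_eq_top_iff]
    filter_upwards [hsf, hsf'] with r h1 h2
    simp [h1.unique h2]
  have h1 : meromorphicOrderAt (f - f') r₀ = ⊤ := by
    by_contra hne
    exact hmer.meromorphicOrderAt_ne_top_of_isPreconnected isPreconnected_univ
      (Set.mem_univ r₀) (Set.mem_univ 0) hne h0
  rw [meromorphicOrderAt_eq_top_iff] at h1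
  have hc : ContinuousAt (f - f') r₀ := haf.continuousAt.sub haf'.continuousAt
  have hl : Tendsto (f - f') (𝓝[≠] r₀) (𝓝 0) :=
    tendsto_const_nhds.congr' (h1.mono fun z hz => hz.symm)
  have := tendsto_nhds_unique (hc.tendsto.mono_left nhdsWithin_le_nhds) hl
  exact sub_eq_zero.mp this

/-- The operator `T` is the product `A(r₀) B(r₀)`. -/
def IsProduct (A B : ℂ → Fock →ₗ[ℂ] FockHat) (r₀ : ℂ) (T : Fock →ₗ[ℂ] FockHat) : Prop :=
  ∀ y x, IsProductEntry A B r₀ y x (entry T y x)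

/-! ## The elliptic currents of level `(1,N)` -/

/-- Coefficients, with respect to `α_m`, of the exponent of `x̃^+(z)`. -/
def xPlusCoeff (P : Params) (z : ℂ) (m : ℤ) : ℂ :=
  if 0 < m then P.g ^ (3 * m) / (1 - (P.t / P.q) ^ m) * z ^ (-m)
  else -(P.g ^ (-m) / (1 - (P.t / P.q) ^ (-m))) * z ^ (-m)

/-- Coefficients, with respect to `α'_m`, of the exponent of `x̃^-(z)`. -/
def xMinusCoeff (P : Params) (z : ℂ) (m : ℤ) : ℂ :=
  if 0 < m then -(P.g ^ (3 * m) / (1 - (P.t / P.q) ^ m)) * z ^ (-m)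
  else P.g ^ (-m) / (1 - (P.t / P.q) ^ (-m)) * z ^ (-m)

/-- The elliptic current `x^+(z)` on `F^{(1,N)}_u`. -/
def xPlus (P : Params) (N : ℤ) (u z : ℂ) : Fock →ₗ[ℂ] FockHat :=
  (u * z ^ (-N) * P.g ^ (3 * N)) • nexp P (xPlusCoeff P z)

/-- The elliptic current `x^-(z)` on `F^{(1,N)}_u`. -/
def xMinus (P : Params) (N : ℤ) (u z : ℂ) : Fock →ₗ[ℂ] FockHat :=
  (u⁻¹ * z ^ N * P.g ^ (-(3 * N))) • nexp' P (xMinusCoeff P z)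

/-! ## Partitions

A partition `λ` is a Young diagram; its boxes `(i, j)` are numbered from `0`, so that `(i, j)` here
is the box `(i + 1, j + 1)` in the usual numbering. -/

/-- arm length of the box `c` relative to `lam`, `a_lam(i, j) = lam_i - j` -/
def arm (lam : YoungDiagram) (c : ℕ × ℕ) : ℤ := (lam.rowLen c.1 : ℤ) - c.2 - 1

/-- leg length of the box `c` relative to `lam`, `ℓ_lam(i, j) = lam'_j - i` -/
def leg (lam : YoungDiagram) (c : ℕ × ℕ) : ℤ := (lam.colLen c.2 : ℤ) - c.1 - 1

/-- `n(λ) = ∑ (i - 1) λ_i` -/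
def nPart (lam : YoungDiagram) : ℕ := ∑ i ∈ Finset.range (lam.colLen 0), i * lam.rowLen i

/-- `n(λ') = ∑ (i - 1) λ'_i` -/
def nPart' (lam : YoungDiagram) : ℕ := nPart lam.transpose

open Classical in
/-- `R(λ)`: the removable boxes -/
def removable (lam : YoungDiagram) : Finset (ℕ × ℕ) :=
  lam.cells.filter fun c => IsLowerSet ((lam.cells.erase c : Finset (ℕ × ℕ)) : Set (ℕ × ℕ))

open Classical in
/-- `A(λ)`: the addable boxes -/
def addable (lam : YoungDiagram) : Finset (ℕ × ℕ) :=
  (Finset.range (lam.colLen 0 + 1) ×ˢ Finset.range (lam.rowLen 0 + 1)).filter fun c =>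
    c ∉ lam.cells ∧ IsLowerSet ((insert c lam.cells : Finset (ℕ × ℕ)) : Set (ℕ × ℕ))

theorem mem_addable (lam : YoungDiagram) (c : ℕ × ℕ) : c ∈ addable lam ↔
    c ∉ lam.cells ∧ IsLowerSet ((insert c lam.cells : Finset (ℕ × ℕ)) : Set (ℕ × ℕ)) := by
  classical
  unfold addable
  rw [Finset.mem_filter, and_iff_right_iff_imp]
  rintro ⟨hc, hl⟩
  have key : ∀ d : ℕ × ℕ, d ≤ c → d ≠ c → d ∈ lam := by
    intro d hd hne
    have := hl hd (by simp)
    simpa [hne] using this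
  rw [Finset.mem_product, Finset.mem_range, Finset.mem_range, Nat.lt_succ_iff, Nat.lt_succ_iff]
  obtain ⟨i, j⟩ := c
  constructor
  · rcases i with _ | i
    · exact Nat.zero_le _
    · have := key (i, 0) (Prod.mk_le_mk.mpr ⟨Nat.le_succ i, Nat.zero_le j⟩) (by simp)
      exact YoungDiagram.mem_iff_lt_colLen.mp this
  · rcases j with _ | j
    · exact Nat.zero_le _
    · have := key (0, j) (Prod.mk_le_mk.mpr ⟨Nat.zero_le i, Nat.le_succ j⟩) (by simp)
      exact YoungDiagram.mem_iff_lt_rowLen.mp this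

/-- `(z; p)_∞` -/
def poch (z p : ℂ) : ℂ := ∏' n : ℕ, (1 - z * p ^ n)

/-- `(z; q, t, p)_∞` -/
def poch3 (z q t p : ℂ) : ℂ := ∏' n : ℕ × ℕ × ℕ, (1 - z * q ^ n.1 * t ^ n.2.1 * p ^ n.2.2)

/-- `c_λ` -/
def cFac (P : Params) (lam : YoungDiagram) : ℂ :=
  ∏ c ∈ lam.cells, (1 - P.q ^ arm lam c * P.t ^ (leg lam c + 1))

/-- `c'_λ` -/
def cFac' (P : Params) (lam : YoungDiagram) : ℂ :=
  ∏ c ∈ lam.cells, (1 - P.q ^ (arm lam c + 1) * P.t ^ leg lam c)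

/-- `N_λ(p)` -/
def nFac (P : Params) (lam : YoungDiagram) : ℂ :=
  ∏ c ∈ lam.cells, poch (P.p * P.q ^ (arm lam c + 1) * P.t ^ leg lam c) P.p /
    poch (P.p * P.q ^ arm lam c * P.t ^ (leg lam c + 1)) P.p

/-- `N'_λ(p)` -/
def nFac' (P : Params) (lam : YoungDiagram) : ℂ :=
  ∏ c ∈ lam.cells, poch (P.p * P.q ^ (-arm lam c) * P.t ^ (-leg lam c - 1)) P.p /
    poch (P.p * P.q ^ (-arm lam c - 1) * P.t ^ (-leg lam c)) P.p

/-- The framing factor `f_λ(q,t) = (-1)^{|λ|} q^{n(λ') + |λ|/2} t^{-n(λ) - |λ|/2}`,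
where `(q/t)^{1/2} = γ^{-1}`. -/
def framing (P : Params) (lam : YoungDiagram) : ℂ :=
  (-1) ^ lam.card * P.q ^ nPart' lam * P.t ^ (-(nPart lam : ℤ)) * P.γ ^ (-(lam.card : ℤ))

/-- `t(λ,u,v,N) = (-uv)^{|λ|} (-v)^{-(N+1)|λ|} f_λ(q,t)^{-N-1}` -/
def tFac (P : Params) (lam : YoungDiagram) (u v : ℂ) (N : ℤ) : ℂ :=
  (-(u * v)) ^ lam.card * (-v) ^ (-((N + 1) * lam.card)) * framing P lam ^ (-N - 1)

/-- `t^*(λ,u,v,N) = (q^{-1}v)^{-|λ|} (-u)^{N|λ|} f_λ(q,t)^N` -/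
def tStarFac (P : Params) (lam : YoungDiagram) (u v : ℂ) (N : ℤ) : ℂ :=
  (P.q⁻¹ * v) ^ (-(lam.card : ℤ)) * (-u) ^ (N * lam.card) * framing P lam ^ N

/-! ## The vertex operators -/

/-- Coefficients, with respect to `α'_m`, of the exponent of the normal ordered operator
`Φ̃_λ(w) = :Φ_∅(w) ∏_{(i,j) ∈ λ} x̃^-((t/q)^{1/4} q^{j-1} t^{-i+1} w):`. -/
def phiCoeff (P : Params) (lam : YoungDiagram) (w : ℂ) (m : ℤ) : ℂ :=
  (if 0 < m then (P.kappa m)⁻¹ * (P.γ * w) ^ (-m) else -(P.kappa (-m))⁻¹ * (P.γ * w) ^ (-m)) +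
    ∑ c ∈ lam.cells, xMinusCoeff P (P.g * P.q ^ c.2 * (P.t ^ c.1)⁻¹ * w) m

/-- The component `Φ_λ(u) : F^{(1,N+1)}_{-uv} → F^{(1,N)}_v` of the type I vertex operator. -/
def Phi (P : Params) (N : ℤ) (u v : ℂ) (lam : YoungDiagram) : Fock →ₗ[ℂ] FockHat :=
  (P.q ^ nPart' lam * nFac P lam * tStarFac P lam u v N / cFac P lam) •
    nexp' P (phiCoeff P lam u)

/-- The scalar factor of `Φ^*_λ(u)` times the normal ordered inverse `:Φ̃_λ(w)^{-1}:`. -/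
def PhiStarAt (P : Params) (N : ℤ) (u v : ℂ) (lam : YoungDiagram) (w : ℂ) : Fock →ₗ[ℂ] FockHat :=
  (P.q ^ nPart' lam * nFac' P lam * tFac P lam v (u * P.p⁻¹) N / cFac' P lam) •
    nexp' P fun m => -phiCoeff P lam w m

/-- The component `Φ^*_λ(u) : F^{(1,N)}_v → F^{(1,N+1)}_{-uv}` of the shifted inverse of `Φ(u)`. -/
def PhiStar (P : Params) (N : ℤ) (u v : ℂ) (lam : YoungDiagram) : Fock →ₗ[ℂ] FockHat :=
  PhiStarAt P N u v lam (P.p⁻¹ * u)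

/-- `c` is the matrix element `(y, x)` of the composition `Φ^*_λ(u) Φ_λ(u)`. The operator product
`:Φ̃_λ(w)^{-1}: Φ̃_λ(u)` with `u = r w` is computed for small `r` and continued to `r = p`, that is
to `w = p^{-1} u`. -/
def IsPhiStarPhiEntry (P : Params) (N : ℤ) (u v : ℂ) (lam : YoungDiagram) (y x : ℕ+ →₀ ℕ)
    (c : ℂ) : Prop :=
  IsProductEntry (fun r => PhiStarAt P N u v lam (r⁻¹ * u)) (fun _ => Phi P N u v lam) P.p y x c

/-- `T` is the operator `Φ^*_λ(u) Φ_λ(u)`. -/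
def IsPhiStarPhi (P : Params) (N : ℤ) (u v : ℂ) (lam : YoungDiagram)
    (T : Fock →ₗ[ℂ] FockHat) : Prop :=
  ∀ y x, IsPhiStarPhiEntry P N u v lam y x (entry T y x)

/-- `T` is the operator `Φ_λ(u) Φ^*_λ(u)` (opposite order): `Φ̃_λ(u) :Φ̃_λ(w)^{-1}:` with `w = r u` is
computed for small `r` and continued to `r = p^{-1}`. -/
def IsPhiPhiStar (P : Params) (N : ℤ) (u v : ℂ) (lam : YoungDiagram)
    (T : Fock →ₗ[ℂ] FockHat) : Prop :=
  IsProduct (fun _ => Phi P N u v lam) (fun r => PhiStarAt P N u v lam (r * u)) P.p⁻¹ T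

/-- `τ` is the matrix element `(y, x)` of `T(u) = ∑_λ Φ^*_λ(u) Φ_λ(u)`, the sum over all partitions
being absolutely convergent. -/
def IsTEntry (P : Params) (N : ℤ) (u v : ℂ) (y x : ℕ+ →₀ ℕ) (τ : ℂ) : Prop :=
  ∃ c : YoungDiagram → ℂ, (∀ lam, IsPhiStarPhiEntry P N u v lam y x (c lam)) ∧ HasSum c τ

/-! ## The right hand side -/

/-- `y_m = yCoeff m • α'_m` with `yCoeff m = (1 - p^m) / κ_m (t/q)^{-m/2}` -/
def yCoeff (P : Params) (m : ℤ) : ℂ := (1 - P.p ^ m) / P.kappa m * P.γ ^ (-m)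

/-- The oscillators `y_m` of `Y(u) = :exp (∑_{m ≠ 0} y_m u^{-m}):`. -/
def yOsc (P : Params) (m : ℤ) : Module.End ℂ Fock := yCoeff P m • alphaPrime P m

/-- `q^□ = t^{i-1} q^{-j+1}` -/
def qBox (P : Params) (c : ℕ × ℕ) : ℂ := P.t ^ c.1 * (P.q ^ c.2)⁻¹

/-- `:∏_{□ ∈ A(λ)} Y(u/q^□) ∏_{■ ∈ R(λ)} Y((q/t)u/q^■)^{-1}:` -/
def YY (P : Params) (lam : YoungDiagram) (u : ℂ) : Fock →ₗ[ℂ] FockHat :=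
  nexp' P fun m => yCoeff P m *
    (∑ c ∈ addable lam, (u / qBox P c) ^ (-m) -
      ∑ c ∈ removable lam, (P.q / P.t * u / qBox P c) ^ (-m))

/-- `Z^{Â_0}_λ(t, q^{-1}, p)` -/
def Z (P : Params) (lam : YoungDiagram) : ℂ :=
  ∏ c ∈ lam.cells,
    ((1 - P.p * P.q ^ (arm lam c + 1) * P.t ^ leg lam c) *
      (1 - P.p * P.q ^ (-arm lam c) * P.t ^ (-leg lam c - 1))) /
    ((1 - P.q ^ (arm lam c + 1) * P.t ^ leg lam c) *
      (1 - P.q ^ (-arm lam c) * P.t ^ (-leg lam c - 1)))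

/-- `𝔮 = p^* p^{N-1} (t/q)^{1/2}` -/
def frakq (P : Params) (N : ℤ) : ℂ := P.ps * P.p ^ (N - 1) * P.γ

/-- `C = (p t; q, t, p)_∞ / (p^2 q; q, t, p)_∞` -/
def constC (P : Params) : ℂ :=
  poch3 (P.p * P.t) P.q P.t P.p / poch3 (P.p ^ 2 * P.q) P.q P.t P.p

/-- `𝔮` for the opposite order of composition: `p^{*-1} p^{N-1} (t/q)^{1/2}` -/
def frakqOpp (P : Params) (N : ℤ) : ℂ := P.ps⁻¹ * P.p ^ (N - 1) * P.γ

/-- `C` for the opposite order of composition: `(p^{-1} t; q, t, p)_∞ / (q; q, t, p)_∞` -/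
def constCOpp (P : Params) : ℂ :=
  poch3 (P.p⁻¹ * P.t) P.q P.t P.p / poch3 P.q P.q P.t P.p

/-! ## The affine quiver W-algebra of type `Â_0` -/

/-- The `n`-th power of the mass deformed Cartan matrix of the Jordan quiver,
`c^{[n]} = 1 + (q₁q₂)^{-n} - μ^{-n} - μ^n (q₁q₂)^{-n}`. -/
def kpCartan (q₁ q₂ mu : ℂ) (n : ℤ) : ℂ :=
  1 + (q₁ * q₂) ^ (-n) - mu ^ (-n) - mu ^ n * (q₁ * q₂) ^ (-n)

/-- The Heisenberg relations among the oscillators `y_m` of the `Y`-operator and the oscillators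
`s_m` of the screening current `S(x) ∼ :exp (∑_{m≠0} s_m x^{-m}):` in Kimura and Pestun's
W-algebra of the Jordan quiver with parameters `q₁, q₂` and mass `μ`. -/
def IsKPHeisenberg (q₁ q₂ mu : ℂ) (y s : ℤ → Module.End ℂ Fock) : Prop :=
  ∀ m n : ℤ, m ≠ 0 → n ≠ 0 →
    ⁅y m, y n⁆ = (if m + n = 0 then
      -(1 / (m : ℂ)) * ((1 - q₁ ^ m) * (1 - q₂ ^ m) / kpCartan q₁ q₂ mu (-m)) else 0) • 1 ∧
    ⁅y m, s n⁆ = (if m + n = 0 then -(1 / (m : ℂ)) * (1 - q₁ ^ m) else 0) • 1 ∧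
    ⁅s m, s n⁆ = (if m + n = 0 then
      -(1 / (m : ℂ)) * ((1 - q₁ ^ m) / (1 - q₂ ^ (-m)) * kpCartan q₁ q₂ mu m) else 0) • 1

/-- The box weights `(μ^{-1} q₁ q₂)^{i-1} μ^{j-1}`. -/
def kpBox (q₁ q₂ mu : ℂ) (c : ℕ × ℕ) : ℂ := (mu⁻¹ * q₁ * q₂) ^ c.1 * mu ^ c.2

/-- The coefficients of the Kimura-Pestun generating function for `Â_0`, with
`a₁ = μ^{-1}q₁q₂`, `a₂ = μ`:
`∏ (1 - q₁ a₁^ℓ a₂^{-a-1})(1 - q₁ a₁^{-ℓ-1} a₂^a) / ((1 - a₁^ℓ a₂^{-a-1})(1 - a₁^{-ℓ-1} a₂^a))`. -/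
def kpZ (q₁ q₂ mu : ℂ) (lam : YoungDiagram) : ℂ :=
  ∏ c ∈ lam.cells,
    ((1 - q₁ * (mu⁻¹ * q₁ * q₂) ^ leg lam c * mu ^ (-arm lam c - 1)) *
      (1 - q₁ * (mu⁻¹ * q₁ * q₂) ^ (-leg lam c - 1) * mu ^ arm lam c)) /
    ((1 - (mu⁻¹ * q₁ * q₂) ^ leg lam c * mu ^ (-arm lam c - 1)) *
      (1 - (mu⁻¹ * q₁ * q₂) ^ (-leg lam c - 1) * mu ^ arm lam c))

/-- The `λ`-term of the Kimura-Pestun generating function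
`∑_λ κ^{|λ|} Z_λ :∏_{□ ∈ A(λ)} Y(x/□) ∏_{■ ∈ R(λ)} Y(x/(q₁q₂■))^{-1}:` with gauge coupling `κ`,
where `Y(x) = :exp (∑_{m≠0} y_m x^{-m}):` and `y_m = b_m α'_m`. -/
def kpTerm (P : Params) (b : ℤ → ℂ) (q₁ q₂ mu coupling : ℂ) (x : ℂ) (lam : YoungDiagram) :
    Fock →ₗ[ℂ] FockHat :=
  (coupling ^ lam.card * kpZ q₁ q₂ mu lam) • nexp' P fun m => b m *
    (∑ c ∈ addable lam, (x / kpBox q₁ q₂ mu c) ^ (-m) -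
      ∑ c ∈ removable lam, (x / (q₁ * q₂ * kpBox q₁ q₂ mu c)) ^ (-m))

/-- `s^+_m = (t/q)^{m/2} / (1 - (t/q)^m) α_m`, `s^-_m` is the same with `α'_m`. -/
def sCoeff (P : Params) (m : ℤ) : ℂ := P.γ ^ m / (1 - (P.t / P.q) ^ m)

def sPlus (P : Params) (m : ℤ) : Module.End ℂ Fock := sCoeff P m • alpha P m

def sMinus (P : Params) (m : ℤ) : Module.End ℂ Fock := sCoeff P m • alphaPrime P m

/-! ## Instanton partition function and χ_y-genus -/

/-- The 5d Nekrasov function `N_{λμ}(x)`. -/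
def nekrasov (P : Params) (lam nu : YoungDiagram) (x : ℂ) : ℂ :=
  (∏ c ∈ lam.cells, (1 - x * P.q ^ (-arm nu c - 1) * P.t ^ (-leg lam c))) *
    ∏ c ∈ nu.cells, (1 - x * P.q ^ arm lam c * P.t ^ (leg nu c + 1))

/-- The `n`-instanton coefficient of the 5d `N = 2^*` `U(1)` instanton partition function. -/
def instantonCoeff (P : Params) (n : ℕ) : ℂ :=
  ∑ᶠ (lam : YoungDiagram) (_ : lam.card = n),
    nekrasov P lam lam (P.p * P.q / P.t) / nekrasov P lam lam (P.q / P.t)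

/-- The coordinate ring `ℂ[x, y]` of `ℂ²`. -/
abbrev Poly2 : Type := MvPolynomial (Fin 2) ℂ

/-- The pull back of functions along `(x, y) ↦ (s₀ x, s₁ y)`. -/
def torusScale (s : Fin 2 → ℂˣ) : Poly2 →ₐ[ℂ] Poly2 :=
  MvPolynomial.aeval fun i => MvPolynomial.C (s i : ℂ) * MvPolynomial.X i

/-- The points of `Hilb_n(ℂ²)` fixed by the torus `(ℂ^×)²`: the torus invariant ideals of
colength `n` in `ℂ[x, y]`. -/
def hilbFixed (n : ℕ) : Set (Ideal Poly2) :=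
  {I | Module.Finite ℂ (Poly2 ⧸ I) ∧ Module.finrank ℂ (Poly2 ⧸ I) = n ∧
    ∀ s : Fin 2 → ℂˣ, I.map (torusScale s) = I}

/-- The weight space of degree `w ∈ ℤ²` in the tangent space `T_I Hilb_n(ℂ²) = Hom(I, ℂ[x,y]/I)` at
a fixed point `I`: the homomorphisms `φ` with `s^*(φ f) = s₀^{w₀} s₁^{w₁} φ(s^* f)`, i.e. which raise
the degree in `(x, y)` by `w`. If the torus acts on `ℂ²` by `(x, y) ↦ (t₁ x, t₂ y)`, then these are
tangent vectors of weight `t₁^{-w₀} t₂^{-w₁}`. -/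
def tangentWeight (I : Ideal Poly2) (w : ℤ × ℤ) : Submodule ℂ (I →ₗ[Poly2] Poly2 ⧸ I) where
  carrier := {φ | ∀ (s : Fin 2 → ℂˣ) (f f' : I), (f' : Poly2) = torusScale s f →
    ∃ g : Poly2, φ f = Ideal.Quotient.mk I g ∧
      Ideal.Quotient.mk I (torusScale s g) = ((s 0 : ℂ) ^ w.1 * (s 1 : ℂ) ^ w.2) • φ f'}
  zero_mem' := fun _ _ _ _ => ⟨0, by simp, by simp⟩
  add_mem' := by
    intro φ ψ hφ hψ s f f' h
    obtain ⟨g, h1, h2⟩ := hφ s f f' h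
    obtain ⟨k, h3, h4⟩ := hψ s f f' h
    exact ⟨g + k, by simp [h1, h3], by simp [h2, h4]⟩
  smul_mem' := by
    intro a φ hφ s f f' h
    obtain ⟨g, h1, h2⟩ := hφ s f f' h
    refine ⟨a • g, ?_, ?_⟩
    · rw [LinearMap.smul_apply, h1]; rfl
    · rw [map_smul, LinearMap.smul_apply, smul_comm, ← h2]; rfl

/-- The equivariant `χ_y`-genus `∑_i (-y)^i χ(Hilb_n(ℂ²), Ω^i)` at the torus element `(t₁, t₂)`,
given by the localization formula
`∑_{fixed points} ∏_{tangent weights w} (1 - y w^{-1}) / (1 - w^{-1})`. -/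
def chiY (n : ℕ) (t₁ t₂ y : ℂ) : ℂ :=
  ∑ᶠ (I : Ideal Poly2) (_ : I ∈ hilbFixed n), ∏ᶠ w : ℤ × ℤ,
    ((1 - y * (t₁ ^ w.1 * t₂ ^ w.2)) / (1 - t₁ ^ w.1 * t₂ ^ w.2)) ^
      Module.finrank ℂ (tangentWeight I w)

end EllipticToroidal

end

noncomputable section

namespace EllipticToroidal

/-! ## Sums over finitely supported exponents -/

/-! All operators are normal ordered exponentials in one Heisenberg algebra, and a product of two of
them is again such an exponential. Its exponent is the sum of the two exponents. Its scalar factor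
is the exponential of the contraction of the annihilation part on the left with the creation part on
the right (`hasSum_entry_vop_mul`). So each term of `T(u)` reduces to one exponent and one scalar.

The exponent: the coefficient of `α'_m` in `Φ̃_λ(u)` is `κ_m⁻¹ (γu)^{-m}` times `1 - (1 - q^{-m})(1
- t^m) ∑ t^{m(i-1)} q^{-m(j-1)}` (`phiCoeff_eq`). This bracket is the generating function of the
corners of `λ` (`sum_addable_sub_sum_removable`). Subtracting the copy at `w = p⁻¹u` multiplies the
coefficient by `1 - p^m`, which gives the `Y`-operators at addable and removable boxes
(`yyCoeff_eq`).

The scalar: the product of the brackets for `m` and `-m` is, up to elementary factors, a vacuum term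
plus the character `∑ (q^{-a-1} t^{-ℓ} + q^a t^{ℓ+1})` of the tangent space of the Hilbert scheme at
`λ` (`sum_arm_leg`, `contractionCoeff_eq`). Exponentiating gives a quotient of infinite products
that is meromorphic in `r`, the ratio of the arguments. Matrix elements are polynomials in finitely
many powers of `r`, hence the continuation exists. At `r = p` or `r = p⁻¹` the infinite products
telescope against `N_λ N'_λ / (c_λ c'_λ)` and leave `𝒵_λ` and a monomial (`contraction_p`,
`contraction_p_inv`). The monomial and the framing factors combine to `𝔮^{|λ|}` (`scalar_eq`).

Convergence: `𝒵_λ`, the matrix elements and the number of partitions all grow at most exponentially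
in `|λ|`, while `𝔮` contains `p^{N-1}` and becomes small as `N` grows.

The genus: torus invariant ideals of finite colength are the monomial ideals, hence partitions
(`bijOn_monomialIdeal`). A homogeneous homomorphism `I → ℂ[x,y]/I` is a function on boxes that is
constant along chains of neighbours. Counting the chains gives one weight pair for each box
(`finrank_shiftSpace`), so localization produces `𝒵_λ`. The screening currents need only the scalar
commutators of the rescaled `α_m`. -/

theorem prod_sum_finsupp {ι R : Type*} [CommSemiring R] (s : Finset ι) (t : ι → Finset ℕ)
    (F : ι → ℕ → R) :
    ∏ i ∈ s, ∑ k ∈ t i, F i k = ∑ e ∈ s.finsupp t, ∏ i ∈ s, F i (e i) := by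
  classical
  rw [Finset.prod_sum, Finset.finsupp, Finset.sum_map]
  refine Finset.sum_congr rfl fun e _ => ?_
  rw [← Finset.prod_attach s]
  refine Finset.prod_congr rfl fun i _ => ?_
  simp [Finsupp.indicator_apply]

theorem mem_finsupp_box_iff_le {ι : Type*} (e j : ι →₀ ℕ) :
    j ∈ e.support.finsupp (fun m => Finset.range (e m + 1)) ↔ j ≤ e := by
  classical
  rw [Finset.mem_finsupp_iff]
  constructor
  · rintro ⟨h2, h3⟩ m
    by_cases hm : m ∈ e.support
    · exact Nat.lt_succ_iff.mp (Finset.mem_range.mp (h3 m hm))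
    · have : j m = 0 := by
        by_contra h
        exact hm (h2 (Finsupp.mem_support_iff.mpr h))
      exact this ▸ Nat.zero_le _
  · exact fun h => ⟨Finsupp.support_mono h, fun m _ => Finset.mem_range.mpr (Nat.lt_succ_of_le (h m))⟩

/-- Boxes, given by a finite set of variables and a degree bound, are cofinal among finite sets of
exponents. Sums over a box factor over the variables, so a sum over all exponents becomes a limit of
finite products. -/
theorem tendsto_finsupp_box {ι : Type*} :
    Tendsto (fun z : Finset ι × ℕ => z.1.finsupp fun _ => Finset.range (z.2 + 1)) atTop atTop := by
  classical
  refine tendsto_atTop_finset_of_monotone ?_ ?_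
  · rintro ⟨s, m⟩ ⟨s', m'⟩ ⟨hs, hm⟩ e he
    simp only [Finset.mem_finsupp_iff, Finset.mem_range, Nat.lt_succ_iff] at he ⊢
    refine ⟨he.1.trans hs, fun i _ => ?_⟩
    by_cases hi : i ∈ s
    · exact (he.2 i hi).trans hm
    · have h0 : e i = 0 := by
        by_contra h
        exact hi (he.1 (Finsupp.mem_support_iff.mpr h))
      exact h0 ▸ Nat.zero_le _
  · intro e
    refine ⟨⟨e.support, e.support.sup e⟩, ?_⟩
    simp only [Finset.mem_finsupp_iff, Finset.mem_range]
    exact ⟨subset_rfl, fun i hi => Nat.lt_succ_of_le (Finset.le_sup hi)⟩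

/-- The coefficient of the monomial `e` in `exp (∑ f_m X_m)`. -/
def expCoeff {ι : Type*} (f : ι → ℂ) (e : ι →₀ ℕ) : ℂ := e.prod fun m k => f m ^ k / (k.factorial : ℂ)

theorem expCoeff_eq_prod {ι : Type*} (f : ι → ℂ) {e : ι →₀ ℕ} {s : Finset ι}
    (h : e.support ⊆ s) : expCoeff f e = ∏ m ∈ s, f m ^ e m / ((e m).factorial : ℂ) :=
  Finsupp.prod_of_support_subset e h _ (by simp)

theorem sum_box_expCoeff {ι : Type*} (f : ι → ℂ) (s : Finset ι) (n : ℕ) :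
    ∑ e ∈ s.finsupp (fun _ => Finset.range (n + 1)), expCoeff f e =
      ∏ m ∈ s, ∑ k ∈ Finset.range (n + 1), f m ^ k / (k.factorial : ℂ) := by
  rw [prod_sum_finsupp]
  refine Finset.sum_congr rfl fun e he => expCoeff_eq_prod f ?_
  classical
  exact (Finset.mem_finsupp_iff.mp he).1

theorem norm_expCoeff {ι : Type*} (f : ι → ℂ) (e : ι →₀ ℕ) :
    (‖expCoeff f e‖ : ℂ) = expCoeff (fun m => (‖f m‖ : ℂ)) e := by
  simp [expCoeff, Finsupp.prod, norm_prod]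

/-- Each finite set of exponents lies in a box, where the sum of norms is a product of truncated
exponential series and so is at most `exp (∑ ‖f m‖)`. -/
theorem summable_norm_expCoeff {ι : Type*} {f : ι → ℂ} (hf : Summable fun m => ‖f m‖) :
    Summable fun e => ‖expCoeff f e‖ := by
  refine summable_of_sum_le (c := Real.exp (∑' m, ‖f m‖)) (fun _ => norm_nonneg _) fun u => ?_
  classical
  obtain ⟨⟨s, n⟩, hs⟩ := (tendsto_atTop.mp (tendsto_finsupp_box (ι := ι)) u).exists
  calc ∑ e ∈ u, ‖expCoeff f e‖
      ≤ ∑ e ∈ s.finsupp (fun _ => Finset.range (n + 1)), ‖expCoeff f e‖ :=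
        Finset.sum_le_sum_of_subset_of_nonneg hs fun _ _ _ => norm_nonneg _
    _ = ∏ m ∈ s, ∑ k ∈ Finset.range (n + 1), ‖f m‖ ^ k / (k.factorial : ℝ) := by
        have := sum_box_expCoeff (fun m => (‖f m‖ : ℂ)) s n
        simp only [← norm_expCoeff] at this
        exact_mod_cast this
    _ ≤ ∏ m ∈ s, Real.exp ‖f m‖ :=
        Finset.prod_le_prod (fun _ _ => Finset.sum_nonneg fun _ _ => by positivity)
          fun m _ => Real.sum_le_exp_of_nonneg (norm_nonneg _) _
    _ = Real.exp (∑ m ∈ s, ‖f m‖) := (Real.exp_sum s _).symm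
    _ ≤ _ := Real.exp_le_exp.mpr (hf.sum_le_tsum s fun _ _ => norm_nonneg _)

theorem hasSum_expCoeff {ι : Type*} {f : ι → ℂ} (hf : Summable fun m => ‖f m‖) :
    HasSum (expCoeff f) (Complex.exp (∑' m, f m)) := by
  have hS := (summable_norm_expCoeff hf).of_norm.hasSum
  have h1 := hS.comp tendsto_finsupp_box
  have h2 : ∀ s : Finset ι, Tendsto (fun n : ℕ => ∑ e ∈ s.finsupp
      (fun _ => Finset.range (n + 1)), expCoeff f e) atTop (𝓝 (Complex.exp (∑ m ∈ s, f m))) := by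
    intro s
    simp only [sum_box_expCoeff, Complex.exp_sum]
    refine tendsto_finsetProd _ fun m _ => ?_
    have h3 := (NormedSpace.expSeries_div_hasSum_exp (f m)).tendsto_sum_nat
    rw [← Complex.exp_eq_exp_ℂ] at h3
    exact h3.comp (tendsto_add_atTop_nat 1)
  have h3 : Tendsto (fun s : Finset ι => Complex.exp (∑ m ∈ s, f m)) atTop
      (𝓝 (Complex.exp (∑' m, f m))) :=
    (Complex.continuous_exp.tendsto _).comp hf.of_norm.hasSum
  -- The joint limit over (variables, degree) is turned into an iterated one: for a fixed set of
  -- variables the degree limit is known, and closed neighbourhoods pass to that limit.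
  rw [← prod_atTop_atTop_eq] at h1
  have h4 : Tendsto (fun s : Finset ι => Complex.exp (∑ m ∈ s, f m)) atTop
      (𝓝 (∑' e, expCoeff f e)) := by
    rw [tendsto_nhds]
    intro U hU hmem
    obtain ⟨V, hV, hVc, hVU⟩ := exists_mem_nhds_isClosed_subset (hU.mem_nhds hmem)
    have h5 := (h1.eventually hV).curry
    filter_upwards [h5] with s hs
    exact hVU (hVc.mem_of_tendsto (h2 s) hs)
  rw [tendsto_nhds_unique h3 h4]
  exact hS

/-! ## Products of normal ordered exponentials -/

/-- The coefficient of `X ^ j` in `∏ (X_m + b_m) ^ e_m`. -/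
def shiftCoeff {ι : Type*} (b : ι → ℂ) (e j : ι →₀ ℕ) : ℂ :=
  e.prod fun m k => (k.choose (j m) : ℂ) * b m ^ (k - j m)

theorem coeff_annExp_monomial (b : ℕ+ → ℂ) (e j : ℕ+ →₀ ℕ) [Decidable (j ≤ e)] :
    (annExp b (MvPolynomial.monomial e 1)).coeff j = if j ≤ e then shiftCoeff b e j else 0 := by
  classical
  have h1 : annExp b (MvPolynomial.monomial e 1) =
      ∑ j ∈ e.support.finsupp (fun m => Finset.range (e m + 1)),
        MvPolynomial.monomial j (shiftCoeff b e j) := by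
    rw [annExp, MvPolynomial.aeval_monomial, map_one, one_mul, Finsupp.prod]
    simp_rw [add_pow]
    rw [prod_sum_finsupp]
    refine Finset.sum_congr rfl fun j hj => ?_
    rw [MvPolynomial.monomial_eq, Finsupp.prod_of_support_subset j
      (Finset.mem_finsupp_iff.mp hj).1 _ (by simp), shiftCoeff, Finsupp.prod, map_prod,
      ← Finset.prod_mul_distrib]
    refine Finset.prod_congr rfl fun m _ => ?_
    simp only [map_mul, map_pow, map_natCast]
    ring
  rw [h1, MvPolynomial.coeff_sum]
  simp only [MvPolynomial.coeff_monomial]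
  rw [Finset.sum_ite_eq']
  exact if_congr (mem_finsupp_box_iff_le e j) rfl rfl

/-- In each variable this is `c^{j+e}/(j+e)! · C(j+e, j) b^e = c^j/j! · (cb)^e/e!`. The second
factor no longer involves `j`, so summing over `e` splits off the exponential of the contraction. -/
theorem expCoeff_mul_shiftCoeff {ι : Type*} (b c : ι → ℂ) (e j : ι →₀ ℕ) :
    expCoeff c (j + e) * shiftCoeff b (j + e) j =
      expCoeff c j * expCoeff (fun m => c m * b m) e := by
  have hj : j.support ⊆ (j + e).support := Finsupp.support_mono le_self_add
  have he : e.support ⊆ (j + e).support := Finsupp.support_mono le_add_self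
  rw [expCoeff_eq_prod c subset_rfl, expCoeff_eq_prod c hj, expCoeff_eq_prod _ he, shiftCoeff,
    Finsupp.prod, ← Finset.prod_mul_distrib, ← Finset.prod_mul_distrib]
  refine Finset.prod_congr rfl fun m _ => ?_
  simp only [Finsupp.add_apply, add_tsub_cancel_left]
  rw [Nat.choose_eq_factorial_div_factorial le_self_add, add_tsub_cancel_left,
    Nat.cast_div (Nat.factorial_mul_factorial_dvd_factorial_add _ _)
    (by exact_mod_cast mul_ne_zero (Nat.factorial_ne_zero _) (Nat.factorial_ne_zero _))]
  have h1 : ((j m).factorial : ℂ) ≠ 0 := by exact_mod_cast Nat.factorial_ne_zero _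
  have h2 : ((e m).factorial : ℂ) ≠ 0 := by exact_mod_cast Nat.factorial_ne_zero _
  have h3 : ((j m + e m).factorial : ℂ) ≠ 0 := by exact_mod_cast Nat.factorial_ne_zero _
  push_cast
  field_simp
  ring

/-- The operator `exp (∑ c_m X_m) exp (∑ b_m ∂_m)`. -/
def vop (c b : ℕ+ → ℂ) : Fock →ₗ[ℂ] FockHat :=
  LinearMap.mulLeft ℂ (creExp c) ∘ₗ (MvPolynomial.coeToMvPowerSeries.algHom ℂ).toLinearMap ∘ₗ
    (annExp b).toLinearMap

theorem vop_apply (c b : ℕ+ → ℂ) (f : Fock) : vop c b f = creExp c * (annExp b f : Fock) := by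
  simp [vop, MvPolynomial.coeToMvPowerSeries.algHom_apply]

theorem nexp_eq_vop (P : Params) (d : ℤ → ℂ) :
    nexp P d = vop (fun m => d (-(m : ℤ))) fun m => d m * heis P m := rfl

theorem coeff_creExp (c : ℕ+ → ℂ) (e : ℕ+ →₀ ℕ) : MvPowerSeries.coeff e (creExp c) = expCoeff c e :=
  rfl

theorem entry_vop (c b : ℕ+ → ℂ) (y x : ℕ+ →₀ ℕ) :
    entry (vop c b) y x = ∑ z ∈ Finset.HasAntidiagonal.antidiagonal y,
      expCoeff c z.1 * (annExp b (MvPolynomial.monomial x 1)).coeff z.2 := by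
  classical
  rw [entry, basisVec, vop_apply, MvPowerSeries.coeff_mul]
  simp only [coeff_creExp, MvPolynomial.coeff_coe]

theorem creExp_mul (c c' : ℕ+ → ℂ) : creExp c * creExp c' = creExp (c + c') := by
  classical
  ext e
  rw [MvPowerSeries.coeff_mul]
  simp only [coeff_creExp]
  have h1 : expCoeff (c + c') e = ∏ m ∈ e.support, ∑ k ∈ Finset.range (e m + 1),
      c m ^ k / (k.factorial : ℂ) * (c' m ^ (e m - k) / ((e m - k).factorial : ℂ)) := by
    rw [expCoeff, Finsupp.prod]
    refine Finset.prod_congr rfl fun m _ => ?_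
    rw [Pi.add_apply, add_pow, Finset.sum_div]
    refine Finset.sum_congr rfl fun k hk => ?_
    have hk' : k ≤ e m := Nat.lt_succ_iff.mp (Finset.mem_range.mp hk)
    rw [Nat.choose_eq_factorial_div_factorial hk', Nat.cast_div
      (Nat.factorial_mul_factorial_dvd_factorial hk')
      (by exact_mod_cast mul_ne_zero (Nat.factorial_ne_zero _) (Nat.factorial_ne_zero _))]
    have h1 : ((k).factorial : ℂ) ≠ 0 := by exact_mod_cast Nat.factorial_ne_zero _
    have h2 : ((e m - k).factorial : ℂ) ≠ 0 := by exact_mod_cast Nat.factorial_ne_zero _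
    have h3 : ((e m).factorial : ℂ) ≠ 0 := by exact_mod_cast Nat.factorial_ne_zero _
    push_cast
    field_simp
  rw [h1, prod_sum_finsupp]
  refine Finset.sum_nbij' (fun z => z.1) (fun j => (j, e - j)) ?_ ?_ ?_ ?_ ?_
  · rintro ⟨i, j⟩ h
    rw [Finset.HasAntidiagonal.mem_antidiagonal] at h
    exact (mem_finsupp_box_iff_le e i).mpr (h ▸ le_self_add)
  · intro j hj
    rw [Finset.HasAntidiagonal.mem_antidiagonal]
    exact add_tsub_cancel_of_le ((mem_finsupp_box_iff_le e j).mp hj)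
  · rintro ⟨i, j⟩ h
    rw [Finset.HasAntidiagonal.mem_antidiagonal] at h
    simp [← h]
  · intro j _
    rfl
  · rintro ⟨i, j⟩ h
    rw [Finset.HasAntidiagonal.mem_antidiagonal] at h
    subst h
    rw [expCoeff_eq_prod c (Finsupp.support_mono (le_self_add : i ≤ i + j)),
      expCoeff_eq_prod c' (Finsupp.support_mono (le_add_self : j ≤ i + j)),
      ← Finset.prod_mul_distrib]
    simp

theorem annExp_annExp (b b' : ℕ+ → ℂ) (f : Fock) :
    annExp b (annExp b' f) = annExp (b + b') f := by
  have : (annExp b).comp (annExp b') = annExp (b + b') := by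
    refine MvPolynomial.algHom_ext fun m => ?_
    simp [annExp, add_assoc]
  exact DFunLike.congr_fun this f

theorem hasSum_expCoeff_mul_coeff_annExp {b c : ℕ+ → ℂ} (h : Summable fun m => ‖c m * b m‖)
    (j : ℕ+ →₀ ℕ) :
    HasSum (fun e => (annExp b (MvPolynomial.monomial e 1)).coeff j * expCoeff c e)
      (Complex.exp (∑' m, c m * b m) * expCoeff c j) := by
  classical
  have h1 := (hasSum_expCoeff h).mul_left (expCoeff c j)
  rw [mul_comm]
  rw [← (add_right_injective j).hasSum_iff]
  · refine h1.congr_fun fun e => ?_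
    rw [Function.comp_apply, coeff_annExp_monomial, if_pos le_self_add, mul_comm,
      expCoeff_mul_shiftCoeff]
  · intro e he
    rw [coeff_annExp_monomial, if_neg, zero_mul]
    exact fun hle => he ⟨e - j, add_tsub_cancel_of_le hle⟩

theorem hasSum_coeff_mul_annExp {b c : ℕ+ → ℂ} (h : Summable fun m => ‖c m * b m‖)
    (ψ : FockHat) (y : ℕ+ →₀ ℕ) :
    HasSum (fun e => MvPowerSeries.coeff y (ψ * (((annExp b (MvPolynomial.monomial e 1) : Fock) : FockHat) : FockHat)) *
      expCoeff c e)
      (Complex.exp (∑' m, c m * b m) * MvPowerSeries.coeff y (ψ * creExp c)) := by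
  classical
  simp only [MvPowerSeries.coeff_mul, coeff_creExp, MvPolynomial.coeff_coe, Finset.mul_sum,
    Finset.sum_mul]
  refine hasSum_sum fun z _ => ?_
  have h1 := (hasSum_expCoeff_mul_coeff_annExp h z.2).mul_left (MvPowerSeries.coeff z.1 ψ)
  rw [mul_left_comm]
  exact h1.congr_fun fun e => by ring

/-- By linearity `F` may be a monomial `X^k`. Multiplication by it shifts the intermediate exponent
by `k`, and since a translation is multiplicative the factor `annExp b (X^k)` can be absorbed into
`ψ`. This reduces to the case `F = 1`. -/
theorem hasSum_coeff_mul_coeff {b c : ℕ+ → ℂ} (h : Summable fun m => ‖c m * b m‖)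
    (ψ : FockHat) (y : ℕ+ →₀ ℕ) (F : Fock) :
    HasSum (fun e => MvPowerSeries.coeff y (ψ * (((annExp b (MvPolynomial.monomial e 1) : Fock) : FockHat) : FockHat)) *
      MvPowerSeries.coeff e (creExp c * ((F : Fock) : FockHat)))
      (Complex.exp (∑' m, c m * b m) *
        MvPowerSeries.coeff y (ψ * creExp c * ((annExp b F : Fock) : FockHat))) := by
  classical
  induction F using MvPolynomial.induction_on' with
  | monomial k a =>
    rw [← (add_right_injective k).hasSum_iff]
    · have h1 := (hasSum_coeff_mul_annExp h (ψ * (((annExp b (MvPolynomial.monomial k a) : Fock) : FockHat) : FockHat))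
        y)
      convert h1 using 1
      · ext e
        have h2 : annExp b (MvPolynomial.monomial (k + e) 1) =
            annExp b (MvPolynomial.monomial k 1) * annExp b (MvPolynomial.monomial e 1) := by
          rw [← map_mul, MvPolynomial.monomial_mul, mul_one]
        have h3 : annExp b (MvPolynomial.monomial k a) =
            MvPolynomial.C a * annExp b (MvPolynomial.monomial k 1) := by
          rw [← mul_one a, ← MvPolynomial.C_mul_monomial, map_mul, mul_one]
          simp [annExp]
        rw [Function.comp_apply, h2, h3, MvPolynomial.coe_monomial,
          MvPowerSeries.coeff_mul_monomial, if_pos le_self_add, add_tsub_cancel_left,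
          coeff_creExp, MvPolynomial.coe_mul, MvPolynomial.coe_mul, MvPolynomial.coe_C]
        rw [show ψ * (MvPowerSeries.C a * ((annExp b (MvPolynomial.monomial k 1) : Fock) : FockHat)) *
          ((annExp b (MvPolynomial.monomial e 1) : Fock) : FockHat) = MvPowerSeries.C a *
          (ψ * (((annExp b (MvPolynomial.monomial k 1) : Fock) : FockHat) *
            ((annExp b (MvPolynomial.monomial e 1) : Fock) : FockHat))) by ring,
          MvPowerSeries.coeff_C_mul]
        ring
      · rw [mul_right_comm ψ]
    · intro e he
      rw [MvPolynomial.coe_monomial, MvPowerSeries.coeff_mul_monomial, if_neg, mul_zero]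
      exact fun hle => he ⟨e - k, add_tsub_cancel_of_le hle⟩
  | add p q hp hq =>
    simp only [map_add, MvPolynomial.coe_add, mul_add]
    exact hp.add hq

/-- The product of two normal ordered exponentials. -/
theorem hasSum_entry_vop_mul {b c b' c' : ℕ+ → ℂ} (h : Summable fun m => ‖c' m * b m‖)
    (y x : ℕ+ →₀ ℕ) :
    HasSum (fun e => entry (vop c b) y e * entry (vop c' b') e x)
      (Complex.exp (∑' m, c' m * b m) * entry (vop (c + c') (b + b')) y x) := by
  have h1 := hasSum_coeff_mul_coeff h (creExp c) y (annExp b' (basisVec x))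
  rw [annExp_annExp, creExp_mul] at h1
  simpa only [entry, vop_apply, basisVec] using h1

/-- A single matrix element is a polynomial in finitely many coefficients of the exponents. The
lemma is used twice: for the algebra of functions analytic off `0`, to continue in the ratio of
arguments, and for the algebra of functions of exponential growth in `|λ|`, to sum over partitions.
-/
theorem entry_vop_mem {Ω : Type*} (S : Subalgebra ℂ (Ω → ℂ)) {c b : Ω → ℕ+ → ℂ}
    (hc : ∀ m, (fun ω => c ω m) ∈ S) (hb : ∀ m, (fun ω => b ω m) ∈ S) (y x : ℕ+ →₀ ℕ) :
    (fun ω => entry (vop (c ω) (b ω)) y x) ∈ S := by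
  classical
  have h1 : (fun ω => entry (vop (c ω) (b ω)) y x) = ∑ z ∈ Finset.HasAntidiagonal.antidiagonal y,
      (fun ω => expCoeff (c ω) z.1) * (fun ω => if z.2 ≤ x then shiftCoeff (b ω) x z.2 else 0) := by
    ext ω
    simp only [entry_vop, coeff_annExp_monomial, Finset.sum_apply, Pi.mul_apply]
  rw [h1]
  refine S.sum_mem fun z _ => S.mul_mem ?_ ?_
  · have h2 : (fun ω => expCoeff (c ω) z.1) = ∏ m ∈ z.1.support,
        ((((z.1 m).factorial : ℂ)⁻¹) • (fun ω => c ω m) ^ z.1 m) := by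
      ext ω
      simp [expCoeff, Finsupp.prod, Finset.prod_apply, div_eq_inv_mul]
    rw [h2]
    exact S.prod_mem fun m _ => S.smul_mem (S.pow_mem (hc m) _) _
  · split_ifs
    · have h2 : (fun ω => shiftCoeff (b ω) x z.2) = ∏ m ∈ x.support,
          (((x m).choose (z.2 m) : ℂ) • (fun ω => b ω m) ^ (x m - z.2 m)) := by
        ext ω
        simp [shiftCoeff, Finsupp.prod, Finset.prod_apply]
      rw [h2]
      exact S.prod_mem fun m _ => S.smul_mem (S.pow_mem (hb m) _) _
    · exact S.zero_mem

/-- The algebra of functions which are meromorphic on `ℂ` and analytic away from `0`. -/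
def puncturedAlgebra : Subalgebra ℂ (ℂ → ℂ) where
  carrier := {f | Meromorphic f ∧ ∀ z ≠ 0, AnalyticAt ℂ f z}
  mul_mem' h h' := ⟨fun z => (h.1 z).mul (h'.1 z), fun z hz => (h.2 z hz).mul (h'.2 z hz)⟩
  add_mem' h h' := ⟨fun z => (h.1 z).add (h'.1 z), fun z hz => (h.2 z hz).add (h'.2 z hz)⟩
  algebraMap_mem' a := ⟨fun z => MeromorphicAt.const a z, fun _ _ => analyticAt_const⟩

theorem zpow_mem_puncturedAlgebra (m : ℤ) : (fun r : ℂ => r ^ m) ∈ puncturedAlgebra :=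
  ⟨fun z => (MeromorphicAt.id z).zpow m, fun _ hz => analyticAt_id.zpow hz⟩

/-! ## Infinite products -/

section InfiniteProduct

variable {ι : Type*} {a : ι → ℂ}

theorem differentiable_tprod_one_sub_mul (ha : Summable fun i => ‖a i‖) :
    Differentiable ℂ fun z => ∏' i, (1 - z * a i) := by
  intro z
  have h1 := Summable.hasProdLocallyUniformlyOn_one_add (f := fun i z => -(z * a i))
    (K := Metric.ball (0 : ℂ) (‖z‖ + 1)) Metric.isOpen_ball (ha.mul_left (‖z‖ + 1))
    (Eventually.of_forall fun i x hx => by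
      rw [norm_neg, norm_mul]
      exact mul_le_mul_of_nonneg_right (by simpa using (mem_ball_zero_iff.mp hx).le)
        (norm_nonneg _)) (fun i => by fun_prop)
  simp only [← sub_eq_add_neg] at h1
  have h2 : DifferentiableOn ℂ (fun z => ∏' i, (1 - z * a i)) (Metric.ball (0 : ℂ) (‖z‖ + 1)) :=
    TendstoLocallyUniformlyOn.differentiableOn h1 (.of_forall fun _ => by
      simpa [Finset.prod_fn] using DifferentiableOn.finsetProd (fun _ _ => by fun_prop))
      Metric.isOpen_ball
  exact h2.differentiableAt (Metric.isOpen_ball.mem_nhds (by simp))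

theorem tprod_one_sub_mul_ne_zero (ha : Summable fun i => ‖a i‖) {z : ℂ} (hz : ∀ i, z * a i ≠ 1) :
    ∏' i, (1 - z * a i) ≠ 0 := by
  simp only [sub_eq_add_neg]
  refine tprod_one_add_ne_zero_of_summable (fun i => ?_) ?_
  · rw [← sub_eq_add_neg]
    exact sub_ne_zero.mpr (hz i).symm
  · simpa using ha.mul_left ‖z‖

theorem hasSum_pnat_neg_log {z : ℂ} (hz : ‖z‖ < 1) :
    HasSum (fun m : ℕ+ => -(z ^ (m : ℕ) / (m : ℂ))) (Complex.log (1 - z)) := by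
  have h1 := (Complex.hasSum_taylorSeries_neg_log hz).neg
  rw [neg_neg] at h1
  refine (PNat.coe_injective.hasSum_iff ?_).mpr h1
  intro n hn
  have : n = 0 := by
    by_contra h
    exact hn ⟨⟨n, Nat.pos_of_ne_zero h⟩, rfl⟩
  simp [this]

theorem summable_pnat_pow {z : ℂ} (hz : ‖z‖ < 1) : Summable fun m : ℕ+ => ‖z‖ ^ (m : ℕ) :=
  (summable_geometric_of_lt_one (norm_nonneg _) hz).comp_injective PNat.coe_injective

/-- The logarithm of `∏ (1 - z a_i)` as a power series in `z`. -/
theorem exists_hasSum_log_tprod (ha : Summable fun i => ‖a i‖) (ha1 : ∀ i, ‖a i‖ ≤ 1) {z : ℂ}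
    (hz : ‖z‖ < 1) {S : ℕ+ → ℂ} (hS : ∀ m : ℕ+, HasSum (fun i => a i ^ (m : ℕ)) (S m)) :
    ∃ L, HasSum (fun m : ℕ+ => -(z ^ (m : ℕ) / (m : ℂ)) * S m) L ∧
      Complex.exp L = ∏' i, (1 - z * a i) := by
  have hza : ∀ i, ‖z * a i‖ < 1 := fun i => by
    rw [norm_mul]
    exact (mul_le_of_le_one_right (norm_nonneg _) (ha1 i)).trans_lt hz
  -- Absolute summability of the double series `(z a_i)^m / m` allows summation in either order:
  -- first over `i` it gives the power series in `z`, first over `m` the logarithms of the factors.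
  have hsum : Summable fun w : ℕ+ × ι => -((z * a w.2) ^ (w.1 : ℕ) / (w.1 : ℂ)) := by
    refine Summable.of_norm_bounded ((summable_pnat_pow hz).mul_of_nonneg ha
      (fun _ => by positivity) (fun _ => norm_nonneg _)) fun w => ?_
    have h1 : ‖a w.2‖ ^ (w.1 : ℕ) ≤ ‖a w.2‖ :=
      pow_le_of_le_one (norm_nonneg _) (ha1 _) w.1.ne_zero
    have h2 : (1 : ℝ) ≤ (w.1 : ℕ) := by exact_mod_cast w.1.pos
    rw [norm_neg, norm_div, norm_pow, norm_mul, mul_pow, RCLike.norm_natCast]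
    refine (div_le_self (by positivity) h2).trans ?_
    exact mul_le_mul_of_nonneg_left h1 (by positivity)
  obtain ⟨L, hL⟩ := hsum
  have h1 : HasSum (fun m : ℕ+ => -(z ^ (m : ℕ) / (m : ℂ)) * S m) L := by
    refine HasSum.prod_fiberwise (f := fun w : ℕ+ × ι => -((z * a w.2) ^ (w.1 : ℕ) / (w.1 : ℂ)))
      hL fun m => ?_
    have h3 := (hS m).mul_left (-(z ^ (m : ℕ) / (m : ℂ)))
    have h4 : (fun i => -((z * a i) ^ (m : ℕ) / (m : ℂ))) =
        fun i => -(z ^ (m : ℕ) / (m : ℂ)) * a i ^ (m : ℕ) := by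
      ext i
      rw [mul_pow]
      ring
    rw [h4]
    exact h3
  have h2 : HasSum (fun i => Complex.log (1 - z * a i)) L := by
    have h3 : HasSum (fun w : ι × ℕ+ => -((z * a w.1) ^ (w.2 : ℕ) / (w.2 : ℂ))) L :=
      by simpa only [Function.comp_def, Equiv.prodComm_apply, Prod.fst_swap, Prod.snd_swap] using
        (Equiv.prodComm ι ℕ+).hasSum_iff.mpr hL
    refine HasSum.prod_fiberwise (f := fun w : ι × ℕ+ => -((z * a w.1) ^ (w.2 : ℕ) / (w.2 : ℂ)))
      h3 fun i => ?_
    dsimp only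
    exact hasSum_pnat_neg_log (hza i)
  refine ⟨L, h1, ?_⟩
  refine (Complex.hasProd_of_hasSum_log (fun i h => ?_) h2).tprod_eq.symm
  have := hza i
  rw [← sub_eq_zero.mp h] at this
  simp at this

end InfiniteProduct

/-! ### The infinite products `(z; p)_∞` and `(z; q, t, p)_∞`. -/

section Pochhammer

variable {q t p : ℂ}

theorem summable_norm_pow (hp : ‖p‖ < 1) : Summable fun n : ℕ => ‖p ^ n‖ := by
  simpa using summable_geometric_of_lt_one (norm_nonneg _) hp

theorem summable_norm_pow3 (hq : ‖q‖ < 1) (ht : ‖t‖ < 1) (hp : ‖p‖ < 1) :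
    Summable fun n : ℕ × ℕ × ℕ => ‖q ^ n.1 * t ^ n.2.1 * p ^ n.2.2‖ := by
  have h1 := (summable_norm_pow hq).mul_of_nonneg ((summable_norm_pow ht).mul_of_nonneg
    (summable_norm_pow hp) (fun _ => norm_nonneg _) (fun _ => norm_nonneg _))
    (fun _ => norm_nonneg _) (fun _ => by positivity)
  simpa only [norm_mul, mul_assoc] using h1

theorem norm_pow_lt_one {z : ℂ} (hz : ‖z‖ < 1) (m : ℕ+) : ‖z ^ (m : ℕ)‖ < 1 := by
  rw [norm_pow]
  exact pow_lt_one₀ (norm_nonneg _) hz m.ne_zero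

theorem differentiable_poch (hp : ‖p‖ < 1) : Differentiable ℂ fun z => poch z p :=
  differentiable_tprod_one_sub_mul (summable_norm_pow hp)

theorem poch_ne_zero (hp : ‖p‖ < 1) {z : ℂ} (hz : ∀ n : ℕ, z * p ^ n ≠ 1) : poch z p ≠ 0 :=
  tprod_one_sub_mul_ne_zero (summable_norm_pow hp) hz

theorem poch_eq_mul (hp : ‖p‖ < 1) (z : ℂ) : poch z p = (1 - z) * poch (p * z) p := by
  have h1 : Multipliable fun n : ℕ => 1 - z * p ^ (n + 1) := by
    simp only [sub_eq_add_neg]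
    refine multipliable_one_add_of_summable ?_
    simpa using ((summable_nat_add_iff 1).mpr (summable_norm_pow hp)).mul_left ‖z‖
  rw [poch, tprod_eq_zero_mul' (f := fun n : ℕ => 1 - z * p ^ n) h1, poch]
  simp only [pow_zero, mul_one, pow_succ]
  congr 1
  refine tprod_congr fun n => ?_
  ring

theorem exists_hasSum_log_poch (hp : ‖p‖ < 1) {z : ℂ} (hz : ‖z‖ < 1) :
    ∃ L, HasSum (fun m : ℕ+ => -(z ^ (m : ℕ) / (m : ℂ)) * (1 - p ^ (m : ℕ))⁻¹) L ∧
      Complex.exp L = poch z p := by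
  refine exists_hasSum_log_tprod (summable_norm_pow hp) (fun i => ?_) hz fun m => ?_
  · rw [norm_pow]
    exact pow_le_one₀ (norm_nonneg _) hp.le
  · simp only [← pow_mul, mul_comm _ (m : ℕ)]
    simp only [pow_mul]
    exact hasSum_geometric_of_norm_lt_one (norm_pow_lt_one hp m)

theorem differentiable_poch3 (hq : ‖q‖ < 1) (ht : ‖t‖ < 1) (hp : ‖p‖ < 1) :
    Differentiable ℂ fun z => poch3 z q t p := by
  simpa only [poch3, mul_assoc] using
    differentiable_tprod_one_sub_mul (summable_norm_pow3 hq ht hp)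

theorem poch3_ne_zero (hq : ‖q‖ < 1) (ht : ‖t‖ < 1) (hp : ‖p‖ < 1) {z : ℂ}
    (hz : ∀ a b c : ℕ, z * q ^ a * t ^ b * p ^ c ≠ 1) : poch3 z q t p ≠ 0 := by
  have := tprod_one_sub_mul_ne_zero (summable_norm_pow3 hq ht hp) (z := z)
    fun n => by simpa only [mul_assoc] using hz n.1 n.2.1 n.2.2
  simpa only [poch3, mul_assoc] using this

theorem exists_hasSum_log_poch3 (hq : ‖q‖ < 1) (ht : ‖t‖ < 1) (hp : ‖p‖ < 1) {z : ℂ}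
    (hz : ‖z‖ < 1) :
    ∃ L, HasSum (fun m : ℕ+ => -(z ^ (m : ℕ) / (m : ℂ)) *
      ((1 - q ^ (m : ℕ))⁻¹ * ((1 - t ^ (m : ℕ))⁻¹ * (1 - p ^ (m : ℕ))⁻¹))) L ∧
      Complex.exp L = poch3 z q t p := by
  have h := exists_hasSum_log_tprod (summable_norm_pow3 hq ht hp) (fun i => ?_) hz
    (S := fun m => (1 - q ^ (m : ℕ))⁻¹ * ((1 - t ^ (m : ℕ))⁻¹ * (1 - p ^ (m : ℕ))⁻¹)) fun m => ?_
  · simpa only [poch3, mul_assoc] using h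
  · simp only [norm_mul, norm_pow]
    exact mul_le_one₀ (mul_le_one₀ (pow_le_one₀ (norm_nonneg _) hq.le) (by positivity)
      (pow_le_one₀ (norm_nonneg _) ht.le)) (by positivity) (pow_le_one₀ (norm_nonneg _) hp.le)
  · have hg : ∀ {z : ℂ}, ‖z‖ < 1 → HasSum (fun n : ℕ => (z ^ (m : ℕ)) ^ n) (1 - z ^ (m : ℕ))⁻¹ :=
      fun hz => hasSum_geometric_of_norm_lt_one (norm_pow_lt_one hz m)
    have hn : ∀ {z : ℂ}, ‖z‖ < 1 → Summable fun n : ℕ => ‖(z ^ (m : ℕ)) ^ n‖ :=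
      fun hz => summable_norm_pow (norm_pow_lt_one hz m)
    have h1 : Summable fun n : ℕ × ℕ => (t ^ (m : ℕ)) ^ n.1 * (p ^ (m : ℕ)) ^ n.2 :=
      summable_mul_of_summable_norm (f := fun n : ℕ => (t ^ (m : ℕ)) ^ n)
        (g := fun n : ℕ => (p ^ (m : ℕ)) ^ n) (hn ht) (hn hp)
    have h2 := HasSum.mul (f := fun n : ℕ => (t ^ (m : ℕ)) ^ n)
        (g := fun n : ℕ => (p ^ (m : ℕ)) ^ n) (hg ht) (hg hp) h1
    have h3 := HasSum.mul (f := fun n : ℕ => (q ^ (m : ℕ)) ^ n)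
      (g := fun n : ℕ × ℕ => (t ^ (m : ℕ)) ^ n.1 * (p ^ (m : ℕ)) ^ n.2) (hg hq) h2
      (summable_mul_of_summable_norm (f := fun n : ℕ => (q ^ (m : ℕ)) ^ n)
        (g := fun n : ℕ × ℕ => (t ^ (m : ℕ)) ^ n.1 * (p ^ (m : ℕ)) ^ n.2) (hn hq) h1.norm)
    have h4 : (fun n : ℕ × ℕ × ℕ => (q ^ n.1 * t ^ n.2.1 * p ^ n.2.2) ^ (m : ℕ)) =
        fun n : ℕ × ℕ × ℕ =>
          (q ^ (m : ℕ)) ^ n.1 * ((t ^ (m : ℕ)) ^ n.2.1 * (p ^ (m : ℕ)) ^ n.2.2) := by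
      ext n
      ring
    rw [h4]
    exact h3

end Pochhammer

/-! ## Combinatorics of Young diagrams -/

section Young

variable {lam : YoungDiagram}

theorem lt_colLen_zero_iff {i : ℕ} : i < lam.colLen 0 ↔ 0 < lam.rowLen i := by
  rw [← YoungDiagram.mem_iff_lt_colLen, YoungDiagram.mem_iff_lt_rowLen]

theorem rowLen_colLen_zero : lam.rowLen (lam.colLen 0) = 0 := by
  by_contra h
  exact lt_irrefl _ (lt_colLen_zero_iff.mpr (Nat.pos_of_ne_zero h))

theorem lt_colLen_iff {i j : ℕ} : i < lam.colLen j ↔ j < lam.rowLen i := by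
  rw [← YoungDiagram.mem_iff_lt_colLen, YoungDiagram.mem_iff_lt_rowLen]

theorem sum_cells {M : Type*} [AddCommMonoid M] (lam : YoungDiagram) (F : ℕ × ℕ → M) :
    ∑ c ∈ lam.cells, F c =
      ∑ i ∈ Finset.range (lam.colLen 0), ∑ j ∈ Finset.range (lam.rowLen i), F (i, j) := by
  refine Finset.sum_finset_product _ _ _ fun c => ?_
  have h1 : c ∈ lam ↔ c.2 < lam.rowLen c.1 := YoungDiagram.mem_iff_lt_rowLen
  rw [YoungDiagram.mem_cells, Finset.mem_range, Finset.mem_range, lt_colLen_zero_iff, h1]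
  exact ⟨fun h => ⟨(Nat.zero_le _).trans_lt h, h⟩, fun h => h.2⟩

theorem sum_cells_transpose {M : Type*} [AddCommMonoid M] (lam : YoungDiagram) (F : ℕ × ℕ → M) :
    ∑ c ∈ lam.transpose.cells, F c = ∑ c ∈ lam.cells, F c.swap := by
  refine Finset.sum_nbij' Prod.swap Prod.swap ?_ ?_ ?_ ?_ ?_ <;>
    simp [YoungDiagram.mem_transpose]

theorem arm_transpose (lam : YoungDiagram) (c : ℕ × ℕ) : arm lam.transpose c = leg lam c.swap := by
  simp [arm, leg, YoungDiagram.rowLen_transpose]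

theorem leg_transpose (lam : YoungDiagram) (c : ℕ × ℕ) : leg lam.transpose c = arm lam c.swap := by
  simp [arm, leg, YoungDiagram.colLen_transpose]

theorem nPart_eq_sum (lam : YoungDiagram) : nPart lam = ∑ c ∈ lam.cells, c.1 := by
  rw [sum_cells, nPart]
  simp [mul_comm]

theorem nPart'_eq_sum (lam : YoungDiagram) : nPart' lam = ∑ c ∈ lam.cells, c.2 := by
  rw [nPart', nPart_eq_sum, sum_cells_transpose]
  rfl

/-- Along a row the arm lengths are the column indices in reverse order. -/
theorem sum_arm (lam : YoungDiagram) : ∑ c ∈ lam.cells, arm lam c = nPart' lam := by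
  rw [nPart'_eq_sum, sum_cells, sum_cells]
  push_cast
  refine Finset.sum_congr rfl fun i _ => ?_
  rw [← Finset.sum_range_reflect (fun j => (j : ℤ))]
  refine Finset.sum_congr rfl fun j hj => ?_
  have := Finset.mem_range.mp hj
  simp only [arm]
  omega

theorem sum_leg (lam : YoungDiagram) : ∑ c ∈ lam.cells, leg lam c = nPart lam := by
  have h1 := sum_arm lam.transpose
  rw [sum_cells_transpose] at h1
  simp only [arm_transpose, Prod.swap_swap, nPart', YoungDiagram.transpose_transpose] at h1
  exact h1

theorem mem_cells_iff {c : ℕ × ℕ} : c ∈ lam.cells ↔ c.2 < lam.rowLen c.1 := by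
  rw [YoungDiagram.mem_cells, ← YoungDiagram.mem_iff_lt_rowLen]

theorem arm_nonneg {c : ℕ × ℕ} (hc : c ∈ lam.cells) : 0 ≤ arm lam c := by
  have := mem_cells_iff.mp hc
  simp only [arm]
  omega

theorem leg_nonneg {c : ℕ × ℕ} (hc : c ∈ lam.cells) : 0 ≤ leg lam c := by
  have := lt_colLen_iff.mpr (mem_cells_iff.mp hc)
  simp only [leg]
  omega

theorem mem_addable_iff {c : ℕ × ℕ} : c ∈ addable lam ↔
    c.2 = lam.rowLen c.1 ∧ (c.1 = 0 ∨ lam.rowLen c.1 < lam.rowLen (c.1 - 1)) := by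
  rw [mem_addable]
  obtain ⟨i, j⟩ := c
  constructor
  · rintro ⟨hc, hl⟩
    have key : ∀ d : ℕ × ℕ, d ≤ (i, j) → d ≠ (i, j) → d.2 < lam.rowLen d.1 := by
      intro d hd hne
      have := hl hd (by simp)
      exact mem_cells_iff.mp (by simpa [hne] using this)
    rw [mem_cells_iff, not_lt] at hc
    have h1 : j = lam.rowLen i := by
      by_contra hne
      have := key (i, lam.rowLen i) (Prod.mk_le_mk.mpr ⟨le_rfl, hc⟩) (by simpa using Ne.symm hne)
      exact lt_irrefl _ this
    refine ⟨h1, ?_⟩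
    rcases i with _ | i
    · exact Or.inl rfl
    · right
      have := key (i, j) (Prod.mk_le_mk.mpr ⟨Nat.le_succ _, le_rfl⟩) (by simp)
      simpa [← h1] using this
  · rintro ⟨h1, h2⟩
    dsimp only at h1 h2
    refine ⟨by rw [mem_cells_iff]; exact (h1.symm ▸ lt_irrefl _), ?_⟩
    rintro e d hde he
    simp only [Finset.coe_insert, Set.mem_insert_iff, Finset.mem_coe] at he ⊢
    rcases he with rfl | he
    · obtain ⟨k, l⟩ := d
      obtain ⟨hk, hl⟩ := Prod.mk_le_mk.mp hde
      rw [mem_cells_iff]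
      by_cases hki : k = i
      · subst hki
        rcases hl.eq_or_lt with rfl | hl
        · exact Or.inl rfl
        · exact Or.inr (h1 ▸ hl)
      · right
        have h3 := lam.rowLen_anti k (i - 1) (by omega)
        dsimp only
        omega
    · exact Or.inr (lam.isLowerSet hde he)

theorem mem_removable_iff {c : ℕ × ℕ} : c ∈ removable lam ↔
    c.2 + 1 = lam.rowLen c.1 ∧ lam.rowLen (c.1 + 1) < lam.rowLen c.1 := by
  classical
  unfold removable
  rw [Finset.mem_filter]
  obtain ⟨i, j⟩ := c
  constructor
  · rintro ⟨hc, hl⟩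
    have key : ∀ d : ℕ × ℕ, (i, j) ≤ d → d ≠ (i, j) → lam.rowLen d.1 ≤ d.2 := by
      intro d hd hne
      by_contra hlt
      have h1 : d ∈ lam.cells := mem_cells_iff.mpr (not_le.mp hlt)
      have := hl hd (by simpa [hne] using h1)
      simp at this
    rw [mem_cells_iff] at hc
    dsimp only at hc
    have h1 := key (i, j + 1) (Prod.mk_le_mk.mpr ⟨le_rfl, Nat.le_succ _⟩) (by simp)
    have h2 := key (i + 1, j) (Prod.mk_le_mk.mpr ⟨Nat.le_succ _, le_rfl⟩) (by simp)
    dsimp only at h1 h2 ⊢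
    omega
  · rintro ⟨h1, h2⟩
    dsimp only at h1 h2
    refine ⟨mem_cells_iff.mpr (by dsimp only; omega), ?_⟩
    rintro e d hde he
    simp only [Finset.coe_erase, Set.mem_sdiff, Finset.mem_coe, Set.mem_singleton_iff] at he ⊢
    refine ⟨lam.isLowerSet hde he.1, ?_⟩
    rintro rfl
    refine he.2 ?_
    obtain ⟨k, l⟩ := e
    obtain ⟨hk, hl⟩ := Prod.mk_le_mk.mp hde
    have h3 := mem_cells_iff.mp he.1
    dsimp only at h3
    have h4 : k = i := by
      by_contra hne
      have := lam.rowLen_anti (i + 1) k (by omega)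
      omega
    subst h4
    exact Prod.ext rfl (by dsimp only; omega)

theorem sum_addable {M : Type*} [AddCommMonoid M] (lam : YoungDiagram) (F : ℕ × ℕ → M) :
    ∑ c ∈ addable lam, F c = F (0, lam.rowLen 0) + ∑ i ∈ Finset.range (lam.colLen 0),
      if lam.rowLen (i + 1) < lam.rowLen i then F (i + 1, lam.rowLen (i + 1)) else 0 := by
  classical
  have h1 : addable lam = ((Finset.range (lam.colLen 0 + 1)).filter
      fun i => i = 0 ∨ lam.rowLen i < lam.rowLen (i - 1)).image fun i => (i, lam.rowLen i) := by
    ext ⟨i, j⟩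
    rw [mem_addable_iff, Finset.mem_image]
    simp only [Finset.mem_filter, Finset.mem_range, Prod.mk.injEq]
    constructor
    · rintro ⟨h1, h2⟩
      refine ⟨i, ⟨?_, h2⟩, rfl, h1.symm⟩
      rcases h2 with rfl | h2
      · exact Nat.succ_pos _
      · have := lt_colLen_zero_iff.mpr ((Nat.zero_le _).trans_lt h2)
        omega
    · rintro ⟨k, ⟨_, h2⟩, rfl, rfl⟩
      exact ⟨rfl, h2⟩
  rw [h1, Finset.sum_image (fun i _ j _ h => (Prod.mk.injEq _ _ _ _ ▸ h).1), Finset.sum_filter,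
    Finset.sum_range_succ', add_comm]
  simp

theorem sum_removable {M : Type*} [AddCommMonoid M] (lam : YoungDiagram) (F : ℕ × ℕ → M) :
    ∑ c ∈ removable lam, F c = ∑ i ∈ Finset.range (lam.colLen 0),
      if lam.rowLen (i + 1) < lam.rowLen i then F (i, lam.rowLen i - 1) else 0 := by
  classical
  have h1 : removable lam = ((Finset.range (lam.colLen 0)).filter
      fun i => lam.rowLen (i + 1) < lam.rowLen i).image fun i => (i, lam.rowLen i - 1) := by
    ext ⟨i, j⟩
    rw [mem_removable_iff, Finset.mem_image]
    simp only [Finset.mem_filter, Finset.mem_range, Prod.mk.injEq]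
    constructor
    · rintro ⟨h1, h2⟩
      exact ⟨i, ⟨lt_colLen_zero_iff.mpr (by omega), h2⟩, rfl, by omega⟩
    · rintro ⟨k, ⟨_, h2⟩, rfl, rfl⟩
      exact ⟨by omega, h2⟩
  rw [h1, Finset.sum_image (fun i _ j _ h => (Prod.mk.injEq _ _ _ _ ▸ h).1), Finset.sum_filter]

/-- The generating function of the corners of a Young diagram. -/
theorem sum_addable_sub_sum_removable {R : Type*} [CommRing R] (lam : YoungDiagram) (x y : R) :
    ∑ c ∈ addable lam, y ^ c.1 * x ^ c.2 - x * y * ∑ c ∈ removable lam, y ^ c.1 * x ^ c.2 =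
      1 - (1 - x) * (1 - y) * ∑ c ∈ lam.cells, y ^ c.1 * x ^ c.2 := by
  rw [sum_addable, sum_removable, sum_cells]
  have h1 : (1 - x) * ∑ i ∈ Finset.range (lam.colLen 0), ∑ j ∈ Finset.range (lam.rowLen i),
      y ^ i * x ^ j = ∑ i ∈ Finset.range (lam.colLen 0), y ^ i * (1 - x ^ lam.rowLen i) := by
    rw [Finset.mul_sum]
    refine Finset.sum_congr rfl fun i _ => ?_
    rw [← Finset.mul_sum, mul_left_comm, mul_neg_geom_sum]
  -- The addable box of row `i + 1` is paired with the removable box of row `i`: both exist exactly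
  -- when the row length drops, and otherwise the right-hand side vanishes too. Only the addable box
  -- of row `0` is left over.
  have h2 : ∀ i, (if lam.rowLen (i + 1) < lam.rowLen i then y ^ (i + 1) * x ^ lam.rowLen (i + 1)
      else 0) - x * y * (if lam.rowLen (i + 1) < lam.rowLen i then y ^ i * x ^ (lam.rowLen i - 1)
      else 0) = y ^ (i + 1) * (x ^ lam.rowLen (i + 1) - x ^ lam.rowLen i) := by
    intro i
    split_ifs with h
    · have : x ^ lam.rowLen i = x * x ^ (lam.rowLen i - 1) := by
        rw [← pow_succ', Nat.sub_add_cancel (by omega)]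
      rw [this]
      ring
    · rw [le_antisymm (lam.rowLen_anti i (i + 1) (Nat.le_succ i)) (not_lt.mp h)]
      ring
  have h3 : ∀ n, x ^ lam.rowLen 0 + ∑ i ∈ Finset.range n,
      y ^ (i + 1) * (x ^ lam.rowLen (i + 1) - x ^ lam.rowLen i) =
      1 - (1 - y) * ∑ i ∈ Finset.range n, y ^ i * (1 - x ^ lam.rowLen i)
        - y ^ n * (1 - x ^ lam.rowLen n) := by
    intro n
    induction n with
    | zero => simp
    | succ n ih =>
      rw [Finset.sum_range_succ, Finset.sum_range_succ, ← add_assoc, ih]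
      ring
  dsimp only
  rw [mul_comm (1 - x), mul_assoc (1 - y), h1, add_sub_assoc, Finset.mul_sum (a := x * y),
    ← Finset.sum_sub_distrib, Finset.sum_congr rfl fun i _ => h2 i]
  have := h3 (lam.colLen 0)
  rw [rowLen_colLen_zero] at this
  simpa using this

/-- The columns of row `i` are grouped by their height: column `j` has height `k + 1` exactly for
`rowLen (k + 1) ≤ j < rowLen k`. On such a block the leg is constant and sums over the arm are
geometric. -/
theorem sum_row_eq {M : Type*} [AddCommMonoid M] (lam : YoungDiagram) (i : ℕ) (f : ℕ → ℕ → M) :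
    ∑ j ∈ Finset.range (lam.rowLen i), f j (lam.colLen j) =
      ∑ k ∈ Finset.Ico i (lam.colLen 0),
        ∑ j ∈ Finset.Ico (lam.rowLen (k + 1)) (lam.rowLen k), f j (k + 1) := by
  have hcol : ∀ j k, lam.colLen j = k + 1 ↔ lam.rowLen (k + 1) ≤ j ∧ j < lam.rowLen k := by
    intro j k
    rw [← lt_colLen_iff, ← not_lt, ← lt_colLen_iff]
    omega
  rw [← Finset.sum_fiberwise_of_maps_to (t := Finset.Ico i (lam.colLen 0))
    (g := fun j => lam.colLen j - 1)]
  · refine Finset.sum_congr rfl fun k hk => ?_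
    have hk' := Finset.mem_Ico.mp hk
    refine Finset.sum_congr ?_ fun j hj => ?_
    · ext j
      have h1 := hcol j k
      have h2 := lt_colLen_iff (lam := lam) (i := i) (j := j)
      simp only [Finset.mem_filter, Finset.mem_range, Finset.mem_Ico]
      omega
    · rw [(hcol j k).mpr (Finset.mem_Ico.mp hj)]
  · intro j hj
    have h1 := lt_colLen_iff.mpr (Finset.mem_range.mp hj)
    have h2 := lam.colLen_anti 0 j (Nat.zero_le _)
    rw [Finset.mem_Ico]
    omega

/-- Used with `V i = y^{-i}`, `a i = x^{λ_i}` and `b i = x^{-λ_i}`. The last two terms on the left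
are boundary terms that make an induction on `n` possible; they vanish once `a n = b n = 1`, that
is, past the last row. -/
theorem tangent_sum_identity {R : Type*} [CommRing R] (y : R) (V a b : ℕ → R) (hV0 : V 0 = 1)
    (hV : ∀ n, V (n + 1) * y = V n) (n : ℕ) :
    (∑ i ∈ Finset.range n, V i * (1 - a i)) - y * (∑ i ∈ Finset.range n, y ^ i * (1 - b i)) -
      (1 - y) * (∑ i ∈ Finset.range n, V i * (1 - a i)) *
        (∑ i ∈ Finset.range n, y ^ i * (1 - b i)) +
      (y * V n * (a n - 1) * (∑ i ∈ Finset.range n, y ^ i * b i) +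
        y ^ n * (1 - b n) * (∑ i ∈ Finset.range n, V i * a i)) =
    ∑ k ∈ Finset.range n,
      ((a (k + 1) - a k) * V k * (∑ i ∈ Finset.range (k + 1), y ^ i * b i) +
        y * y ^ k * (b k - b (k + 1)) * (∑ i ∈ Finset.range (k + 1), V i * a i)) := by
  have hH : ∀ n, (1 - y) * ∑ i ∈ Finset.range n, y ^ i = 1 - y ^ n := fun n => mul_neg_geom_sum y n
  have hG : ∀ n, (1 - y) * ∑ i ∈ Finset.range n, V i = y * V n - y := by
    intro n
    induction n with
    | zero => simp [hV0]
    | succ n ih =>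
      rw [Finset.sum_range_succ, mul_add, ih]
      linear_combination -(hV n)
  induction n with
  | zero => simp
  | succ n ih =>
    conv_rhs => rw [Finset.sum_range_succ, ← ih]
    simp only [mul_sub, mul_one, Finset.sum_sub_distrib, Finset.sum_range_succ]
    linear_combination (a (n + 1) - 1) * (∑ i ∈ Finset.range n, y ^ i * b i + y ^ n * b n) * hV n -
      y ^ n * (1 - b n) * hG n - V n * (1 - a n) * hH n

theorem mul_sum_Ico_pow (x : ℂ) {m n : ℕ} (h : m ≤ n) :
    (1 - x) * ∑ j ∈ Finset.Ico m n, x ^ j = x ^ m - x ^ n := by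
  induction n, h using Nat.le_induction with
  | base => simp
  | succ n hn ih =>
    rw [Finset.sum_Ico_succ_top hn, mul_add, ih]
    ring

theorem mul_sum_Ico_inv_pow {x : ℂ} (hx : x ≠ 0) {m n : ℕ} (h : m ≤ n) :
    (1 - x) * ∑ j ∈ Finset.Ico m n, x⁻¹ ^ (j + 1) = x⁻¹ ^ n - x⁻¹ ^ m := by
  induction n, h using Nat.le_induction with
  | base => simp
  | succ n hn ih =>
    rw [Finset.sum_Ico_succ_top hn, mul_add, ih, pow_succ]
    field_simp
    ring

/-- The character of the tangent space in terms of arm and leg lengths. -/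
theorem sum_arm_leg (lam : YoungDiagram) {x y : ℂ} (hx : x ≠ 0) (hx1 : x ≠ 1) (hy : y ≠ 0) :
    ∑ c ∈ lam.cells, (x ^ (-arm lam c - 1) * y ^ (-leg lam c) +
        x ^ arm lam c * y ^ (leg lam c + 1)) =
      ∑ c ∈ lam.cells, y⁻¹ ^ c.1 * x ^ c.2 + y / x * ∑ c ∈ lam.cells, y ^ c.1 * x⁻¹ ^ c.2 -
        (1 - x⁻¹) * (1 - y) * (∑ c ∈ lam.cells, y⁻¹ ^ c.1 * x ^ c.2) *
          ∑ c ∈ lam.cells, y ^ c.1 * x⁻¹ ^ c.2 := by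
  set L := lam.colLen 0 with hL
  have hx1' : 1 - x ≠ 0 := sub_ne_zero.mpr hx1.symm
  -- Multiplying by `1 - x` collapses every geometric row sum to `1 - x^{λ_i}` or `1 - x^{-λ_i}`.
  refine mul_left_cancel₀ hx1' ?_
  set r := lam.rowLen with hr
  have hA : (1 - x) * ∑ c ∈ lam.cells, y⁻¹ ^ c.1 * x ^ c.2 =
      ∑ i ∈ Finset.range L, y⁻¹ ^ i * (1 - x ^ r i) := by
    rw [sum_cells, Finset.mul_sum]
    refine Finset.sum_congr rfl fun i _ => ?_
    dsimp only
    rw [← Finset.mul_sum, mul_left_comm, mul_neg_geom_sum]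
  have hB : (1 - x⁻¹) * ∑ c ∈ lam.cells, y ^ c.1 * x⁻¹ ^ c.2 =
      ∑ i ∈ Finset.range L, y ^ i * (1 - x⁻¹ ^ r i) := by
    rw [sum_cells, Finset.mul_sum]
    refine Finset.sum_congr rfl fun i _ => ?_
    dsimp only
    rw [← Finset.mul_sum, mul_left_comm, mul_neg_geom_sum]
  have hx2 : (1 - x) = -(x * (1 - x⁻¹)) := by field_simp; ring
  have key := tangent_sum_identity y (fun n => y⁻¹ ^ n) (fun i => x ^ r i) (fun i => x⁻¹ ^ r i)
    (pow_zero _) (fun n => by rw [pow_succ]; field_simp) L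
  simp only [hr, hL, rowLen_colLen_zero, pow_zero, sub_self, mul_zero, zero_mul, add_zero] at key
  rw [← hL, ← hr] at key
  have hLHS : (1 - x) * (∑ c ∈ lam.cells, y⁻¹ ^ c.1 * x ^ c.2 +
      y / x * ∑ c ∈ lam.cells, y ^ c.1 * x⁻¹ ^ c.2 -
        (1 - x⁻¹) * (1 - y) * (∑ c ∈ lam.cells, y⁻¹ ^ c.1 * x ^ c.2) *
          ∑ c ∈ lam.cells, y ^ c.1 * x⁻¹ ^ c.2) =
      (∑ i ∈ Finset.range L, y⁻¹ ^ i * (1 - x ^ r i)) -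
        y * (∑ i ∈ Finset.range L, y ^ i * (1 - x⁻¹ ^ r i)) -
        (1 - y) * (∑ i ∈ Finset.range L, y⁻¹ ^ i * (1 - x ^ r i)) *
          (∑ i ∈ Finset.range L, y ^ i * (1 - x⁻¹ ^ r i)) := by
    rw [← hA, ← hB]
    generalize (∑ c ∈ lam.cells, y⁻¹ ^ c.1 * x ^ c.2) = A
    generalize (∑ c ∈ lam.cells, y ^ c.1 * x⁻¹ ^ c.2) = B
    field_simp
    ring
  rw [hLHS, key, sum_cells, Finset.mul_sum]
  have hrow : ∀ i ∈ Finset.range L, (1 - x) * ∑ j ∈ Finset.range (lam.rowLen i),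
      (x ^ (-arm lam (i, j) - 1) * y ^ (-leg lam (i, j)) +
        x ^ arm lam (i, j) * y ^ (leg lam (i, j) + 1)) =
      ∑ k ∈ Finset.Ico i L, ((x ^ r (k + 1) - x ^ r k) * y⁻¹ ^ k * (y ^ i * x⁻¹ ^ r i) +
        y * y ^ k * (x⁻¹ ^ r k - x⁻¹ ^ r (k + 1)) * (y⁻¹ ^ i * x ^ r i)) := by
    intro i _
    have h1 := sum_row_eq lam i fun j l =>
      (x ^ (-((r i : ℤ) - j - 1) - 1) * y ^ (-((l : ℤ) - i - 1)) +
        x ^ ((r i : ℤ) - j - 1) * y ^ ((l : ℤ) - i - 1 + 1))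
    simp only [arm, leg]
    rw [h1, Finset.mul_sum]
    refine Finset.sum_congr rfl fun k hk => ?_
    have hk' := Finset.mem_Ico.mp hk
    have hle := lam.rowLen_anti k (k + 1) (Nat.le_succ k)
    rw [← mul_sum_Ico_pow x hle, ← mul_sum_Ico_inv_pow hx hle, Finset.mul_sum, Finset.mul_sum,
      Finset.mul_sum, Finset.sum_mul, Finset.sum_mul, Finset.mul_sum, Finset.sum_mul,
      ← Finset.sum_add_distrib]
    refine Finset.sum_congr rfl fun j _ => ?_
    have e1 : x ^ (-((r i : ℤ) - j - 1) - 1) = x ^ j * x⁻¹ ^ r i := by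
      rw [show (-((r i : ℤ) - j - 1) - 1) = (j : ℤ) - r i by ring, zpow_sub₀ hx]
      simp [div_eq_mul_inv]
    have e2 : x ^ ((r i : ℤ) - j - 1) = x ^ r i * x⁻¹ ^ (j + 1) := by
      rw [show ((r i : ℤ) - j - 1) = (r i : ℤ) - (j + 1 : ℕ) by push_cast; ring, zpow_sub₀ hx,
        zpow_natCast, zpow_natCast]
      simp [div_eq_mul_inv]
    have e3 : y ^ (-(((k + 1 : ℕ) : ℤ) - i - 1)) = y⁻¹ ^ k * y ^ i := by
      rw [show (-(((k + 1 : ℕ) : ℤ) - i - 1)) = (i : ℤ) - k by push_cast; ring, zpow_sub₀ hy]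
      simp [div_eq_inv_mul]
    have e4 : y ^ (((k + 1 : ℕ) : ℤ) - i - 1 + 1) = y * y ^ k * y⁻¹ ^ i := by
      rw [show (((k + 1 : ℕ) : ℤ) - i - 1 + 1) = ((k + 1 : ℕ) : ℤ) - i by push_cast; ring,
        zpow_sub₀ hy, zpow_natCast, zpow_natCast, pow_succ']
      simp [div_eq_mul_inv]
    rw [e1, e2, e3, e4]
    ring
  rw [Finset.sum_congr rfl hrow]
  simp only [Finset.mul_sum, ← Finset.sum_add_distrib]
  simp only [Finset.range_eq_Ico]
  -- Both sides are now sums over `i ≤ k` of the same terms, one ordered by the row `i` of the box,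
  -- the other by the bottom `k` of its column.
  rw [Finset.sum_Ico_Ico_comm]

/-! ### Counting partitions -/

theorem sum_rowLens (lam : YoungDiagram) : lam.rowLens.sum = lam.card := by
  have h1 := sum_cells lam fun _ => 1
  rw [Finset.sum_const, smul_eq_mul, mul_one] at h1
  rw [YoungDiagram.rowLens]
  simp only [Finset.sum_const, Finset.card_range, smul_eq_mul, mul_one] at h1
  exact h1.symm

/-- The composition of `|λ|` given by the parts of `λ`. -/
def rowComposition {n : ℕ} (lam : {lam : YoungDiagram // lam.card = n}) : Composition n where
  blocks := lam.1.rowLens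
  blocks_pos := fun h => lam.1.pos_of_mem_rowLens _ h
  blocks_sum := (sum_rowLens lam.1).trans lam.2

theorem rowComposition_injective (n : ℕ) : Function.Injective (rowComposition (n := n)) := by
  intro lam nu h
  have h1 : lam.1.rowLens = nu.1.rowLens := congrArg Composition.blocks h
  have h2 := YoungDiagram.equivListRowLens.injective (a₁ := lam.1) (a₂ := nu.1) (Subtype.ext h1)
  exact Subtype.ext h2

instance (n : ℕ) : Finite {lam : YoungDiagram // lam.card = n} :=
  Finite.of_injective _ (rowComposition_injective n)

/-- Partitions of `n` inject into compositions of `n`, of which there are `2^{n-1}` for `n ≥ 1`. The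
crude bound suffices, since only exponential growth matters for convergence. -/
theorem natCard_card_eq_le (n : ℕ) : Nat.card {lam : YoungDiagram // lam.card = n} ≤ 2 ^ n := by
  refine (Nat.card_le_card_of_injective _ (rowComposition_injective n)).trans ?_
  rw [Nat.card_eq_fintype_card, composition_card]
  exact Nat.pow_le_pow_right two_pos (Nat.sub_le _ _)

theorem summable_pow_card {x : ℝ} (hx0 : 0 ≤ x) (hx : x < 1 / 2) :
    Summable fun lam : YoungDiagram => x ^ lam.card := by
  rw [← (Equiv.sigmaFiberEquiv fun lam : YoungDiagram => lam.card).summable_iff]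
  refine (summable_sigma_of_nonneg fun _ => pow_nonneg hx0 _).mpr ⟨fun n => ?_, ?_⟩
  · exact Summable.of_finite
  · have h1 : ∀ n : ℕ, ∑' w : {lam : YoungDiagram // lam.card = n}, x ^ w.1.card =
        Nat.card {lam : YoungDiagram // lam.card = n} * x ^ n := by
      intro n
      rw [tsum_congr fun w => by rw [w.2], tsum_const, nsmul_eq_mul]
    refine Summable.of_nonneg_of_le (fun n => tsum_nonneg fun _ => pow_nonneg hx0 _) (fun n => ?_)
      (summable_geometric_of_lt_one (r := 2 * x) (by positivity) (by linarith))
    refine (h1 n).trans_le ?_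
    rw [mul_pow]
    refine mul_le_mul_of_nonneg_right ?_ (pow_nonneg hx0 _)
    exact_mod_cast natCard_card_eq_le n

end Young

/-! ## Parameters -/

namespace Params

variable (P : Params)

theorem tq_ne : P.t / P.q ≠ 0 := div_ne_zero P.t_ne P.q_ne

theorem g_ne : P.g ≠ 0 := by
  intro h
  have := P.g_pow
  rw [h, zero_pow (by norm_num)] at this
  exact P.tq_ne this.symm

theorem γ_ne : P.γ ≠ 0 := pow_ne_zero 2 P.g_ne

theorem γ_sq : P.γ ^ 2 = P.t / P.q := by
  rw [γ, ← pow_mul, P.g_pow]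

theorem ps_ne : P.ps ≠ 0 := div_ne_zero (mul_ne_zero P.p_ne P.q_ne) P.t_ne

theorem γ_zpow_mul_self (m : ℤ) : P.γ ^ m * P.γ ^ m = P.t ^ m / P.q ^ m := by
  rw [← mul_zpow, ← pow_two, γ_sq, div_zpow]

theorem g_zpow_mul_self (m : ℤ) : P.g ^ m * P.g ^ m = P.γ ^ m := by
  rw [← mul_zpow, ← pow_two, γ]

theorem ps_zpow (m : ℤ) : P.ps ^ m = P.p ^ m * P.q ^ m / P.t ^ m := by
  rw [ps, div_zpow, mul_zpow]

theorem zpow_ne_one_of_norm_lt_one {z : ℂ} (hz : ‖z‖ < 1) {m : ℤ} (hm : m ≠ 0) :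
    z ^ m ≠ 1 := by
  intro h
  have h1 := congrArg norm h
  rw [norm_zpow, norm_one, zpow_eq_one_iff_right₀ (norm_nonneg z) hz.ne] at h1
  exact hm h1

theorem q_zpow_ne_one {m : ℤ} (hm : m ≠ 0) : P.q ^ m ≠ 1 :=
  zpow_ne_one_of_norm_lt_one P.norm_q hm

theorem t_zpow_ne_one {m : ℤ} (hm : m ≠ 0) : P.t ^ m ≠ 1 :=
  zpow_ne_one_of_norm_lt_one P.norm_t hm

theorem p_zpow_ne_one {m : ℤ} (hm : m ≠ 0) : P.p ^ m ≠ 1 :=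
  zpow_ne_one_of_norm_lt_one P.norm_p hm

theorem ps_zpow_ne_one {m : ℤ} (hm : m ≠ 0) : P.ps ^ m ≠ 1 :=
  zpow_ne_one_of_norm_lt_one P.norm_ps hm

theorem tq_zpow_ne_one {m : ℤ} (hm : m ≠ 0) : (P.t / P.q) ^ m ≠ 1 := by
  intro h
  have h1 : (P.t / P.q) ^ m.natAbs = 1 := by
    rcases m.natAbs_eq with h2 | h2
    · rw [h2, zpow_natCast] at h
      exact h
    · rw [h2, zpow_neg, inv_eq_one, zpow_natCast] at h
      exact h
  exact P.not_root _ (Int.natAbs_pos.mpr hm) h1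

theorem one_sub_q {m : ℤ} (hm : m ≠ 0) : 1 - P.q ^ m ≠ 0 := sub_ne_zero.mpr (P.q_zpow_ne_one hm).symm
theorem one_sub_t {m : ℤ} (hm : m ≠ 0) : 1 - P.t ^ m ≠ 0 := sub_ne_zero.mpr (P.t_zpow_ne_one hm).symm
theorem one_sub_p {m : ℤ} (hm : m ≠ 0) : 1 - P.p ^ m ≠ 0 := sub_ne_zero.mpr (P.p_zpow_ne_one hm).symm
theorem one_sub_ps {m : ℤ} (hm : m ≠ 0) : 1 - P.ps ^ m ≠ 0 :=
  sub_ne_zero.mpr (P.ps_zpow_ne_one hm).symm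
theorem one_sub_tq {m : ℤ} (hm : m ≠ 0) : 1 - (P.t / P.q) ^ m ≠ 0 :=
  sub_ne_zero.mpr (P.tq_zpow_ne_one hm).symm

theorem kappa_ne {m : ℤ} (hm : m ≠ 0) : P.kappa m ≠ 0 :=
  mul_ne_zero (mul_ne_zero (P.one_sub_q hm) (P.one_sub_t (neg_ne_zero.mpr hm))) (P.one_sub_tq hm)

theorem kappa_eq (m : ℤ) : P.kappa m =
    (1 - P.q ^ m) * (1 - (P.t ^ m)⁻¹) * (1 - P.t ^ m / P.q ^ m) := by
  rw [kappa, zpow_neg, div_zpow]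

theorem kappa_neg (m : ℤ) : P.kappa (-m) = -P.kappa m := by
  have h1 := zpow_ne_zero m P.q_ne
  have h2 := zpow_ne_zero m P.t_ne
  simp only [kappa_eq, zpow_neg]
  field_simp
  ring

end Params

/-! ## Coefficients of the vertex operators -/

theorem nexp_congr (P : Params) {d d' : ℤ → ℂ} (h : ∀ m, m ≠ 0 → d m = d' m) :
    nexp P d = nexp P d' := by
  rw [nexp_eq_vop, nexp_eq_vop]
  congr 1
  · ext m
    exact h _ (by simp)
  · ext m
    rw [h _ (by simp)]

theorem nexp'_congr (P : Params) {d d' : ℤ → ℂ} (h : ∀ m, m ≠ 0 → d m = d' m) :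
    nexp' P d = nexp' P d' :=
  nexp_congr P fun m hm => by rw [h m hm]

theorem entry_smul (a : ℂ) (A : Fock →ₗ[ℂ] FockHat) (y x : ℕ+ →₀ ℕ) :
    entry (a • A) y x = a * entry A y x := by
  simp [entry]

/-- The creation and annihilation branches are one formula because `g^{4m} = (t/q)^m`. This removes
all sign distinctions in `m` from the later computations. -/
theorem xMinusCoeff_eq (P : Params) (z : ℂ) {m : ℤ} (hm : m ≠ 0) :
    xMinusCoeff P z m = -(P.g ^ (3 * m) / (1 - (P.t / P.q) ^ m)) * z ^ (-m) := by
  rw [xMinusCoeff]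
  split_ifs with h
  · rfl
  · congr 1
    have h1 : P.g ^ (3 * m) = P.g ^ (-m) * (P.t / P.q) ^ m := by
      rw [← P.g_pow, ← zpow_natCast, ← zpow_mul, ← zpow_add₀ P.g_ne]
      congr 1
      push_cast
      ring
    have h2 := P.one_sub_tq hm
    have h3 := P.one_sub_tq (neg_ne_zero.mpr hm)
    have h4 : (P.t / P.q) ^ m ≠ 0 := zpow_ne_zero m P.tq_ne
    rw [h1]
    rw [zpow_neg (P.t / P.q)] at h3 ⊢
    generalize (P.t / P.q) ^ m = s at *
    rw [← neg_div, div_eq_div_iff h3 h2]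
    field_simp
    ring

theorem xPlusCoeff_eq (P : Params) (z : ℂ) {m : ℤ} (hm : m ≠ 0) :
    xPlusCoeff P z m = P.g ^ (3 * m) / (1 - (P.t / P.q) ^ m) * z ^ (-m) := by
  have h1 : xPlusCoeff P z m = -xMinusCoeff P z m := by
    rw [xPlusCoeff, xMinusCoeff]
    split_ifs <;> ring
  rw [h1, xMinusCoeff_eq P z hm]
  ring

/-- `∑_{(i,j) ∈ λ} y^{i-1} x^{j-1}` -/
def boxSum (lam : YoungDiagram) (y x : ℂ) : ℂ := ∑ c ∈ lam.cells, y ^ c.1 * x ^ c.2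

/-- The sign of the vacuum part for `m < 0` is absorbed by `κ_{-m} = -κ_m`. Each box then
contributes a multiple of the same prefactor, since `(t/q)^m / (1 - (t/q)^m) = κ_m⁻¹ (1 - q^{-m})(1
- t^m)`. -/
theorem phiCoeff_eq (P : Params) (lam : YoungDiagram) (w : ℂ) {m : ℤ} (hm : m ≠ 0) :
    phiCoeff P lam w m = (P.kappa m)⁻¹ * (P.γ * w) ^ (-m) *
      (1 - (1 - (P.q ^ m)⁻¹) * (1 - P.t ^ m) * boxSum lam (P.t ^ m) (P.q ^ m)⁻¹) := by
  have h0 : (if 0 < m then (P.kappa m)⁻¹ * (P.γ * w) ^ (-m)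
      else -(P.kappa (-m))⁻¹ * (P.γ * w) ^ (-m)) = (P.kappa m)⁻¹ * (P.γ * w) ^ (-m) := by
    split_ifs
    · rfl
    · rw [P.kappa_neg, inv_neg, neg_neg]
  have hq := zpow_ne_zero m P.q_ne
  have ht := zpow_ne_zero m P.t_ne
  have h1 : ∀ c : ℕ × ℕ, xMinusCoeff P (P.g * P.q ^ c.2 * (P.t ^ c.1)⁻¹ * w) m =
      -((P.kappa m)⁻¹ * (P.γ * w) ^ (-m) * ((1 - (P.q ^ m)⁻¹) * (1 - P.t ^ m))) *
        ((P.t ^ m) ^ c.1 * ((P.q ^ m)⁻¹) ^ c.2) := by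
    intro c
    have h2 : (P.g * P.q ^ c.2 * (P.t ^ c.1)⁻¹ * w) ^ (-m) =
        P.g ^ (-m) * ((P.t ^ m) ^ c.1 * ((P.q ^ m)⁻¹) ^ c.2) * w ^ (-m) := by
      rw [mul_zpow, mul_zpow, mul_zpow, inv_zpow, zpow_neg (P.t ^ c.1), inv_inv, ← zpow_natCast,
        ← zpow_natCast, ← zpow_natCast, ← zpow_natCast, inv_zpow, ← zpow_mul, ← zpow_mul,
        ← zpow_mul, ← zpow_mul, mul_comm m, mul_comm m, mul_neg, zpow_neg P.q]
      ring
    have h3 : P.g ^ (3 * m) * P.g ^ (-m) = P.t ^ m / P.q ^ m * P.γ ^ (-m) := by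
      rw [← P.γ_zpow_mul_self, mul_assoc, ← zpow_add₀ P.γ_ne, ← zpow_add₀ P.g_ne, add_neg_cancel,
        zpow_zero, mul_one, ← P.g_zpow_mul_self, ← zpow_add₀ P.g_ne]
      congr 1
      ring
    have h4 : (P.t ^ m / P.q ^ m) / (1 - (P.t / P.q) ^ m) =
        (P.kappa m)⁻¹ * ((1 - (P.q ^ m)⁻¹) * (1 - P.t ^ m)) := by
      have h5 := P.one_sub_q hm
      have h6 := P.one_sub_t hm
      have h7 := P.one_sub_tq hm
      have h8 := P.kappa_ne hm
      rw [div_eq_iff h7, inv_mul_eq_div, div_mul_eq_mul_div, eq_div_iff h8, P.kappa_eq, div_zpow]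
      field_simp
      ring
    rw [xMinusCoeff_eq P _ hm, h2, mul_zpow P.γ]
    calc -(P.g ^ (3 * m) / (1 - (P.t / P.q) ^ m)) *
          (P.g ^ (-m) * ((P.t ^ m) ^ c.1 * (P.q ^ m)⁻¹ ^ c.2) * w ^ (-m))
        = -((P.g ^ (3 * m) * P.g ^ (-m)) / (1 - (P.t / P.q) ^ m)) *
          (((P.t ^ m) ^ c.1 * (P.q ^ m)⁻¹ ^ c.2) * w ^ (-m)) := by ring
      _ = -((P.t ^ m / P.q ^ m) / (1 - (P.t / P.q) ^ m)) * P.γ ^ (-m) *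
          (((P.t ^ m) ^ c.1 * (P.q ^ m)⁻¹ ^ c.2) * w ^ (-m)) := by rw [h3]; ring
      _ = _ := by rw [h4]; ring
  rw [phiCoeff, h0, Finset.sum_congr rfl fun c _ => h1 c, ← Finset.mul_sum, boxSum]
  ring

theorem phiCoeff_mul (P : Params) (lam : YoungDiagram) (s w : ℂ) {m : ℤ} (hm : m ≠ 0) :
    phiCoeff P lam (s * w) m = s ^ (-m) * phiCoeff P lam w m := by
  rw [phiCoeff_eq P lam _ hm, phiCoeff_eq P lam _ hm, mul_left_comm, mul_zpow s]
  ring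

/-- The exponents of the normal ordered product of the `Y`-operators. -/
def yyCoeff (P : Params) (lam : YoungDiagram) (u : ℂ) (m : ℤ) : ℂ :=
  yCoeff P m * (∑ c ∈ addable lam, (u / qBox P c) ^ (-m) -
    ∑ c ∈ removable lam, (P.q / P.t * u / qBox P c) ^ (-m))

/-- The extra `q/t` in the argument at removable boxes produces the weight `xy` (with `x = q^{-m}`,
`y = t^m`) demanded by the corner identity, which turns corners into the sum over all boxes. The
remaining factor `1 - p^m` is the difference between `Φ̃_λ(u)` and its copy at `p⁻¹u`. -/
theorem yyCoeff_eq (P : Params) (lam : YoungDiagram) (u : ℂ) {m : ℤ} (hm : m ≠ 0) :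
    yyCoeff P lam u m = (1 - P.p ^ m) * phiCoeff P lam u m := by
  have h1 : ∀ (v : ℂ) (c : ℕ × ℕ), (v / qBox P c) ^ (-m) =
      v ^ (-m) * ((P.t ^ m) ^ c.1 * ((P.q ^ m)⁻¹) ^ c.2) := by
    intro v c
    rw [div_zpow, div_eq_mul_inv, zpow_neg (qBox P c), inv_inv, qBox, mul_zpow, inv_zpow,
      ← zpow_natCast, ← zpow_natCast, ← zpow_natCast, ← zpow_natCast, inv_zpow, ← zpow_mul,
      ← zpow_mul, ← zpow_mul, ← zpow_mul, mul_comm m, mul_comm m]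
  have h2 : (P.q / P.t * u) ^ (-m) = (P.q ^ m)⁻¹ * P.t ^ m * u ^ (-m) := by
    rw [mul_zpow, div_zpow, zpow_neg, zpow_neg, div_inv_eq_mul]
  have h3 := sum_addable_sub_sum_removable lam (P.q ^ m)⁻¹ (P.t ^ m)
  rw [yyCoeff, phiCoeff_eq P lam u hm, boxSum, ← h3, mul_zpow P.γ, yCoeff]
  simp only [h1, h2, ← Finset.mul_sum]
  ring

theorem YY_eq (P : Params) (lam : YoungDiagram) (u : ℂ) :
    YY P lam u = nexp' P fun m => (1 - P.p ^ m) * phiCoeff P lam u m :=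
  nexp'_congr P fun _ hm => yyCoeff_eq P lam u hm

theorem rho_mul_rho_mul_heis (P : Params) {m : ℤ} (hm : m ≠ 0) :
    rho P (-m) * (rho P m * heis P m) =
      P.kappa m / m * (1 - (P.t / P.q) ^ m) * ((1 - P.ps ^ m) / (1 - P.p ^ m)) := by
  have h1 := P.one_sub_p hm
  have h2 := P.one_sub_ps hm
  have h3 := P.one_sub_p (neg_ne_zero.mpr hm)
  have hq := zpow_ne_zero m P.q_ne
  have ht := zpow_ne_zero m P.t_ne
  have hp := zpow_ne_zero m P.p_ne
  have hm' : (m : ℂ) ≠ 0 := by exact_mod_cast hm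
  have h4 : P.γ ^ (-m) * P.γ ^ m = 1 := by rw [← zpow_add₀ P.γ_ne, neg_add_cancel, zpow_zero]
  have h5 : rho P (-m) * (rho P m * heis P m) = (P.γ ^ (-m) * P.γ ^ m) *
      ((1 - P.ps ^ (-m)) / (1 - P.p ^ (-m)) * ((1 - P.ps ^ m) / (1 - P.p ^ m)) * heis P m) := by
    rw [rho, rho]
    ring
  have h6 : heis P m = -(P.kappa m / m) * (1 - (P.q / P.t) ^ m) *
    ((1 - P.p ^ m) / (1 - P.ps ^ m)) := rfl
  have h7 : (1 - P.ps ^ (-m)) / (1 - P.p ^ (-m)) * -(1 - (P.q / P.t) ^ m) =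
      (1 - (P.t / P.q) ^ m) * ((1 - P.ps ^ m) / (1 - P.p ^ m)) := by
    simp only [zpow_neg] at h3 ⊢
    rw [div_mul_eq_mul_div, div_eq_iff h3, mul_assoc, div_mul_eq_mul_div, ← mul_div_assoc,
      eq_div_iff h1, P.ps_zpow, div_zpow, div_zpow]
    field_simp
    ring
  rw [h5, h4, h6]
  calc _ = (P.kappa m / m) * ((1 - P.ps ^ (-m)) / (1 - P.p ^ (-m)) * -(1 - (P.q / P.t) ^ m)) *
        (((1 - P.ps ^ m) * (1 - P.ps ^ m)⁻¹) * ((1 - P.p ^ m) * (1 - P.p ^ m)⁻¹)) := by ring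
    _ = _ := by rw [h7, mul_inv_cancel₀ h1, mul_inv_cancel₀ h2]; ring

/-! ## The contraction of two vertex operators -/

/-- The weight `q^{-a-1} t^{-ℓ}`. -/
def wtNeg (P : Params) (lam : YoungDiagram) (c : ℕ × ℕ) : ℂ :=
  P.q ^ (-arm lam c - 1) * P.t ^ (-leg lam c)

/-- The weight `q^a t^{ℓ+1}`. -/
def wtPos (P : Params) (lam : YoungDiagram) (c : ℕ × ℕ) : ℂ :=
  P.q ^ arm lam c * P.t ^ (leg lam c + 1)

/-- The scalar factor of the operator product of `:Φ̃_λ(w)^{-1}:` and `Φ̃_λ(u)`, in either order, as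
a function of the ratio of the arguments. -/
def contraction (P : Params) (lam : YoungDiagram) (r : ℂ) : ℂ :=
  poch3 (r * P.t) P.q P.t P.p / poch3 (r * (P.t * P.ps)) P.q P.t P.p *
    ∏ c ∈ lam.cells, (poch (r * wtNeg P lam c) P.p / poch (r * (wtNeg P lam c * P.ps)) P.p *
      (poch (r * wtPos P lam c) P.p / poch (r * (wtPos P lam c * P.ps)) P.p))

/-- The exponents of the scalar factor. -/
def contractionCoeff (P : Params) (lam : YoungDiagram) (r : ℂ) (m : ℤ) : ℂ :=
  -(r ^ m * (phiCoeff P lam 1 (-m) * rho P (-m) * (phiCoeff P lam 1 m * rho P m * heis P m)))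

/-- The two brackets for `±m` multiply to `1 - (1 - q^m)(1 - t^{-m}) χ`, where `χ` is the tangent
character with `q, t` replaced by their `m`-th powers, as computed by `sum_arm_leg`. The prefactor
is a multiple of `1/((1 - q^m)(1 - t^{-m}))`, so the sum splits into a vacuum term and one term for
each tangent weight. -/
theorem contractionCoeff_eq (P : Params) (lam : YoungDiagram) (r : ℂ) {m : ℤ} (hm : m ≠ 0) :
    contractionCoeff P lam r m = -(r ^ m / m) * ((1 - P.ps ^ m) / (1 - P.p ^ m)) *
      (P.t ^ m / ((1 - P.q ^ m) * (1 - P.t ^ m)) +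
        ∑ c ∈ lam.cells, (wtNeg P lam c ^ m + wtPos P lam c ^ m)) := by
  have hq := zpow_ne_zero m P.q_ne
  have ht := zpow_ne_zero m P.t_ne
  have h1 := P.one_sub_q hm
  have h2 := P.one_sub_t hm
  have h3 := P.kappa_ne hm
  have hm' : (m : ℂ) ≠ 0 := by exact_mod_cast hm
  have h4 : ∑ c ∈ lam.cells, (wtNeg P lam c ^ m + wtPos P lam c ^ m) =
      boxSum lam (P.t ^ m)⁻¹ (P.q ^ m) + P.t ^ m / P.q ^ m * boxSum lam (P.t ^ m) (P.q ^ m)⁻¹ -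
        (1 - (P.q ^ m)⁻¹) * (1 - P.t ^ m) * boxSum lam (P.t ^ m)⁻¹ (P.q ^ m) *
          boxSum lam (P.t ^ m) (P.q ^ m)⁻¹ := by
    simp only [boxSum]
    rw [← sum_arm_leg lam hq (P.q_zpow_ne_one hm) ht]
    refine Finset.sum_congr rfl fun c _ => ?_
    rw [wtNeg, wtPos, mul_zpow, mul_zpow, zpow_comm P.q (-arm lam c - 1),
      zpow_comm P.t (-leg lam c), zpow_comm P.q (arm lam c), zpow_comm P.t (leg lam c + 1)]
  have h5 : P.γ ^ (-(-m)) * P.γ ^ (-m) = 1 := by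
    rw [← zpow_add₀ P.γ_ne, neg_add_cancel, zpow_zero]
  have h6 : contractionCoeff P lam r m = (r ^ m) * (P.γ ^ (-(-m)) * P.γ ^ (-m)) *
      ((P.kappa m)⁻¹ * (P.kappa m)⁻¹ *
        (1 - (1 - P.q ^ m) * (1 - (P.t ^ m)⁻¹) * boxSum lam (P.t ^ m)⁻¹ (P.q ^ m)) *
        (1 - (1 - (P.q ^ m)⁻¹) * (1 - P.t ^ m) * boxSum lam (P.t ^ m) (P.q ^ m)⁻¹)) *
      (rho P (-m) * (rho P m * heis P m)) := by
    rw [contractionCoeff, phiCoeff_eq P lam 1 hm, phiCoeff_eq P lam 1 (neg_ne_zero.mpr hm),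
      P.kappa_neg, mul_one, zpow_neg P.q, zpow_neg P.t, inv_inv, inv_neg]
    ring
  rw [h6, h5, rho_mul_rho_mul_heis P hm, h4]
  have h7 := P.one_sub_p hm
  have h8 : (P.kappa m)⁻¹ * (1 - (P.t / P.q) ^ m) =
      -(P.t ^ m / ((1 - P.q ^ m) * (1 - P.t ^ m))) := by
    have h9 := P.one_sub_tq hm
    have h10 : 1 - (P.t ^ m)⁻¹ = -((1 - P.t ^ m) / P.t ^ m) := by
      field_simp
      ring
    rw [Params.kappa, zpow_neg, mul_inv, mul_assoc, inv_mul_cancel₀ h9, mul_one, h10]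
    field_simp
  generalize boxSum lam (P.t ^ m)⁻¹ (P.q ^ m) = A
  generalize boxSum lam (P.t ^ m) (P.q ^ m)⁻¹ = B
  calc _ = (r ^ m / m) * ((1 - P.ps ^ m) / (1 - P.p ^ m)) * ((P.kappa m)⁻¹ * P.kappa m) *
        ((P.kappa m)⁻¹ * (1 - (P.t / P.q) ^ m)) *
        ((1 - (1 - P.q ^ m) * (1 - (P.t ^ m)⁻¹) * A) *
        (1 - (1 - (P.q ^ m)⁻¹) * (1 - P.t ^ m) * B)) := by ring
    _ = _ := by
      rw [h8, inv_mul_cancel₀ h3, mul_one, neg_mul, neg_mul, ← mul_neg, mul_assoc _ (-_)]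
      congr 1
      field_simp
      ring

/-- The numerator `1 - p^{*m}` makes the series a difference of two logarithms, at arguments `rw`
and `rwp^*`. -/
theorem hasSum_pair_poch (P : Params) {r w : ℂ} (h1 : ‖r * w‖ < 1) (h2 : ‖r * (w * P.ps)‖ < 1) :
    ∃ L, HasSum (fun m : ℕ+ => -(r ^ (m : ℤ) / m) * ((1 - P.ps ^ (m : ℤ)) / (1 - P.p ^ (m : ℤ))) *
      w ^ (m : ℤ)) L ∧ Complex.exp L = poch (r * w) P.p / poch (r * (w * P.ps)) P.p := by
  obtain ⟨L1, hL1, hE1⟩ := exists_hasSum_log_poch P.norm_p h1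
  obtain ⟨L2, hL2, hE2⟩ := exists_hasSum_log_poch P.norm_p h2
  refine ⟨L1 - L2, ?_, by rw [Complex.exp_sub, hE1, hE2]⟩
  refine (hL1.sub hL2).congr_fun fun m => ?_
  simp only [zpow_natCast, mul_pow]
  ring

theorem hasSum_pair_poch3 (P : Params) {r : ℂ} (h1 : ‖r * P.t‖ < 1) (h2 : ‖r * (P.t * P.ps)‖ < 1) :
    ∃ L, HasSum (fun m : ℕ+ => -(r ^ (m : ℤ) / m) * ((1 - P.ps ^ (m : ℤ)) / (1 - P.p ^ (m : ℤ))) *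
      (P.t ^ (m : ℤ) / ((1 - P.q ^ (m : ℤ)) * (1 - P.t ^ (m : ℤ))))) L ∧ Complex.exp L =
        poch3 (r * P.t) P.q P.t P.p / poch3 (r * (P.t * P.ps)) P.q P.t P.p := by
  obtain ⟨L1, hL1, hE1⟩ := exists_hasSum_log_poch3 P.norm_q P.norm_t P.norm_p h1
  obtain ⟨L2, hL2, hE2⟩ := exists_hasSum_log_poch3 P.norm_q P.norm_t P.norm_p h2
  refine ⟨L1 - L2, ?_, by rw [Complex.exp_sub, hE1, hE2]⟩
  refine (hL1.sub hL2).congr_fun fun m => ?_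
  simp only [zpow_natCast, mul_pow, div_eq_mul_inv, mul_inv]
  ring

theorem eventually_norm_mul_lt_one (z : ℂ) : ∀ᶠ r in 𝓝 (0 : ℂ), ‖r * z‖ < 1 := by
  have h1 : Continuous fun r : ℂ => ‖r * z‖ := by fun_prop
  exact h1.tendsto 0 |>.eventually (gt_mem_nhds (by simp))

/-- Only finitely many weights occur, so for small `r` all the logarithmic series converge
simultaneously. This determines the region where the operator product is an honest sum. -/
theorem eventually_hasSum_contractionCoeff (P : Params) (lam : YoungDiagram) :
    ∀ᶠ r in 𝓝 (0 : ℂ), ∃ L, HasSum (fun m : ℕ+ => contractionCoeff P lam r m) L ∧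
      Complex.exp L = contraction P lam r := by
  have h1 : ∀ᶠ r in 𝓝 (0 : ℂ), ∀ c ∈ lam.cells,
      (‖r * wtNeg P lam c‖ < 1 ∧ ‖r * (wtNeg P lam c * P.ps)‖ < 1) ∧
      (‖r * wtPos P lam c‖ < 1 ∧ ‖r * (wtPos P lam c * P.ps)‖ < 1) :=
    (Finset.eventually_all _).mpr fun c _ =>
      ((eventually_norm_mul_lt_one _).and (eventually_norm_mul_lt_one _)).and
        ((eventually_norm_mul_lt_one _).and (eventually_norm_mul_lt_one _))
  filter_upwards [h1, eventually_norm_mul_lt_one P.t, eventually_norm_mul_lt_one (P.t * P.ps)]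
    with r hr h2 h3
  obtain ⟨L0, hL0, hE0⟩ := hasSum_pair_poch3 P h2 h3
  have h4 : ∀ c : ℕ × ℕ, ∃ L, c ∈ lam.cells → HasSum (fun m : ℕ+ =>
      -(r ^ (m : ℤ) / m) * ((1 - P.ps ^ (m : ℤ)) / (1 - P.p ^ (m : ℤ))) *
        (wtNeg P lam c ^ (m : ℤ) + wtPos P lam c ^ (m : ℤ))) L ∧ Complex.exp L =
      poch (r * wtNeg P lam c) P.p / poch (r * (wtNeg P lam c * P.ps)) P.p *
      (poch (r * wtPos P lam c) P.p / poch (r * (wtPos P lam c * P.ps)) P.p) := by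
    intro c
    by_cases hc : c ∈ lam.cells
    · obtain ⟨L1, hL1, hE1⟩ := hasSum_pair_poch P (hr c hc).1.1 (hr c hc).1.2
      obtain ⟨L2, hL2, hE2⟩ := hasSum_pair_poch P (hr c hc).2.1 (hr c hc).2.2
      refine ⟨L1 + L2, fun _ => ⟨?_, by rw [Complex.exp_add, hE1, hE2]⟩⟩
      simpa only [mul_add] using hL1.add hL2
    · exact ⟨0, fun h => absurd h hc⟩
  choose Lc hLc using h4
  refine ⟨L0 + ∑ c ∈ lam.cells, Lc c, ?_, ?_⟩
  · have h5 := hL0.add (hasSum_sum fun c hc => (hLc c hc).1)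
    convert h5 using 1
    ext m
    rw [contractionCoeff_eq P lam r (by simp), mul_add, Finset.mul_sum]
    simp
  · rw [Complex.exp_add, hE0, Complex.exp_sum, contraction,
      Finset.prod_congr rfl fun c hc => (hLc c hc).2]

theorem meromorphic_contraction (P : Params) (lam : YoungDiagram) :
    Meromorphic (contraction P lam) := by
  intro z
  have h3 : ∀ w : ℂ, MeromorphicAt (fun r => poch3 (r * w) P.q P.t P.p) z := fun w =>
    (Differentiable.analyticAt ((differentiable_poch3 P.norm_q P.norm_t P.norm_p).comp
      (differentiable_id.mul_const w)) z).meromorphicAt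
  have h1 : ∀ w : ℂ, MeromorphicAt (fun r => poch (r * w) P.p) z := fun w =>
    (Differentiable.analyticAt ((differentiable_poch P.norm_p).comp
      (differentiable_id.mul_const w)) z).meromorphicAt
  exact ((h3 _).div (h3 _)).mul (MeromorphicAt.fun_prod fun c _ =>
    ((h1 _).div (h1 _)).mul ((h1 _).div (h1 _)))

theorem analyticAt_contraction (P : Params) (lam : YoungDiagram) {z : ℂ}
    (h3 : poch3 (z * (P.t * P.ps)) P.q P.t P.p ≠ 0)
    (h1 : ∀ c ∈ lam.cells, poch (z * (wtNeg P lam c * P.ps)) P.p ≠ 0)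
    (h2 : ∀ c ∈ lam.cells, poch (z * (wtPos P lam c * P.ps)) P.p ≠ 0) :
    AnalyticAt ℂ (contraction P lam) z := by
  have a3 : ∀ w : ℂ, AnalyticAt ℂ (fun r => poch3 (r * w) P.q P.t P.p) z := fun w =>
    Differentiable.analyticAt ((differentiable_poch3 P.norm_q P.norm_t P.norm_p).comp
      (differentiable_id.mul_const w)) z
  have a1 : ∀ w : ℂ, AnalyticAt ℂ (fun r => poch (r * w) P.p) z := fun w =>
    Differentiable.analyticAt ((differentiable_poch P.norm_p).comp
      (differentiable_id.mul_const w)) z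
  exact ((a3 _).div (a3 _) h3).mul (Finset.analyticAt_fun_prod _ fun c hc =>
    ((a1 _).div (a1 _) (h1 c hc)).mul ((a1 _).div (a1 _) (h2 c hc)))

/-! ## The products of the vertex operators -/

theorem exists_pow_of_mem_cells (P : Params) (lam : YoungDiagram) {c : ℕ × ℕ} (hc : c ∈ lam.cells) :
    ∃ a l : ℕ, wtNeg P lam c = (P.q ^ (a + 1) * P.t ^ l)⁻¹ ∧ wtPos P lam c = P.q ^ a * P.t ^ (l + 1) ∧
      arm lam c = a ∧ leg lam c = l := by
  obtain ⟨a, ha⟩ := Int.eq_ofNat_of_zero_le (arm_nonneg hc)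
  obtain ⟨l, hl⟩ := Int.eq_ofNat_of_zero_le (leg_nonneg hc)
  refine ⟨a, l, ?_, ?_, ha, hl⟩
  · rw [wtNeg, ha, hl, mul_inv, ← zpow_natCast, ← zpow_natCast, ← zpow_neg, ← zpow_neg]
    congr 2
    push_cast
    ring
  · rw [wtPos, ha, hl, ← zpow_natCast, ← zpow_natCast]
    congr 2

theorem mul_pow_ne_one {z p : ℂ} (hz : ‖z‖ < 1) (hp : ‖p‖ < 1) (n : ℕ) : z * p ^ n ≠ 1 := by
  intro h
  have h1 := congrArg norm h
  rw [norm_mul, norm_pow, norm_one] at h1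
  have h2 : ‖z‖ * ‖p‖ ^ n ≤ ‖z‖ :=
    mul_le_of_le_one_right (norm_nonneg _) (pow_le_one₀ (norm_nonneg _) hp.le)
  linarith

theorem norm_pow_mul_pow_lt_one (P : Params) (a l : ℕ) (h : a + l ≠ 0) :
    ‖P.q ^ a * P.t ^ l‖ < 1 := by
  rw [norm_mul, norm_pow, norm_pow]
  rcases Nat.eq_zero_or_pos a with rfl | ha
  · have hl : l ≠ 0 := by omega
    rw [pow_zero, one_mul]
    exact pow_lt_one₀ (norm_nonneg _) P.norm_t hl
  · exact mul_lt_one_of_nonneg_of_lt_one_left (by positivity)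
      (pow_lt_one₀ (norm_nonneg _) P.norm_q ha.ne') (pow_le_one₀ (norm_nonneg _) P.norm_t.le)

theorem poch_ne_zero_of_norm_lt_one (P : Params) {z : ℂ} (hz : ‖z‖ < 1) : poch z P.p ≠ 0 :=
  poch_ne_zero P.norm_p fun n => mul_pow_ne_one hz P.norm_p n

/-- A vanishing factor would give `p^{k+1+n} = q^a t^l`, which genericity of `p` excludes. The
weights `(q^a t^l)⁻¹` can be large, so a norm estimate would not do. -/
theorem poch_p_pow_div_ne_zero (P : Params) (k a l : ℕ) :
    poch (P.p ^ (k + 1) * (P.q ^ a * P.t ^ l)⁻¹) P.p ≠ 0 := by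
  refine poch_ne_zero P.norm_p fun n h => P.generic (k + 1 + n) a l (by omega) ?_
  have h1 : P.q ^ a * P.t ^ l ≠ 0 := mul_ne_zero (pow_ne_zero _ P.q_ne) (pow_ne_zero _ P.t_ne)
  rw [pow_add]
  rw [mul_right_comm, mul_inv_eq_one₀ h1] at h
  exact h

theorem poch_inv_ne_zero (P : Params) (a l : ℕ) (h : a + l ≠ 0) :
    poch ((P.q ^ a * P.t ^ l)⁻¹) P.p ≠ 0 := by
  have h1 : P.q ^ a * P.t ^ l ≠ 0 := mul_ne_zero (pow_ne_zero _ P.q_ne) (pow_ne_zero _ P.t_ne)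
  rw [poch_eq_mul P.norm_p]
  refine mul_ne_zero (fun h2 => ?_) ?_
  · have h3 := norm_pow_mul_pow_lt_one P a l h
    rw [inv_eq_one.mp (sub_eq_zero.mp h2).symm, norm_one] at h3
    exact lt_irrefl _ h3
  · simpa using poch_p_pow_div_ne_zero P 0 a l

theorem one_sub_ne_zero_of_norm_lt_one {z : ℂ} (hz : ‖z‖ < 1) : 1 - z ≠ 0 := by
  intro h
  rw [← sub_eq_zero.mp h, norm_one] at hz
  exact lt_irrefl _ hz

/-- The factor of `N_λ N'_λ / (c_λ c'_λ)` belonging to a box with weights `X = q^{a+1} t^ℓ` and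
`Y = q^a t^{ℓ+1}`. -/
def boxFactor (p X Y : ℂ) : ℂ :=
  poch (p * X) p / poch (p * Y) p * (poch (p * Y⁻¹) p / poch (p * X⁻¹) p) / ((1 - Y) * (1 - X))

/-- The factor of `𝒵_λ` belonging to a box with weights `X = q^{a+1} t^ℓ` and `Y = q^a t^{ℓ+1}`. -/
def zFactor (p X Y : ℂ) : ℂ := (1 - p * X) * (1 - p * Y⁻¹) / ((1 - X) * (1 - Y⁻¹))

theorem one_sub_inv_ne_zero {z : ℂ} (h : 1 - z ≠ 0) : 1 - z⁻¹ ≠ 0 := by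
  intro h1
  apply h
  rw [← inv_eq_one.mp (sub_eq_zero.mp h1).symm, sub_self]

/-- Since `p^* = pX/Y`, the denominators become `(p²/Y; p)_∞` and `(p²X; p)_∞`. They differ from
`(p/Y; p)_∞` and `(pX; p)_∞` by one factor each, and these two factors are the numerator of
`zFactor`. The monomial comes from `1 - Y = -Y(1 - Y⁻¹)`. -/
theorem boxFactor_mul (P : Params) {X Y : ℂ} (hY : Y ≠ 0) (hXY : X * P.t = Y * P.q)
    (h1 : poch (P.p * Y) P.p ≠ 0)
    (h2 : poch (P.p * X⁻¹) P.p ≠ 0) (h3 : poch (P.p * (P.p * X)) P.p ≠ 0)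
    (h4 : poch (P.p * (P.p * Y⁻¹)) P.p ≠ 0) (hX1 : 1 - X ≠ 0) (hY1 : 1 - Y ≠ 0) :
    boxFactor P.p X Y * (poch (P.p * X⁻¹) P.p / poch (P.p * (X⁻¹ * P.ps)) P.p *
      (poch (P.p * Y) P.p / poch (P.p * (Y * P.ps)) P.p)) = zFactor P.p X Y * -Y⁻¹ := by
  have hq := P.q_ne
  have ht := P.t_ne
  have hX : X = Y * P.q / P.t := by rw [← hXY, mul_div_cancel_right₀ _ ht]
  have e1 : X⁻¹ * P.ps = P.p * Y⁻¹ := by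
    rw [hX, Params.ps]
    field_simp
  have e2 : Y * P.ps = P.p * X := by
    rw [hX, Params.ps]
    field_simp
  have hY2 := one_sub_inv_ne_zero hY1
  rw [e1, e2, boxFactor, zFactor, poch_eq_mul P.norm_p (P.p * X), poch_eq_mul P.norm_p (P.p * Y⁻¹)]
  have e3 : (1 - Y) = -Y * (1 - Y⁻¹) := by
    field_simp
    ring
  rw [e3]
  generalize 1 - Y⁻¹ = s at *
  generalize 1 - X = s' at *
  generalize poch (P.p * (P.p * X)) P.p = a at *
  generalize poch (P.p * (P.p * Y⁻¹)) P.p = b at *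
  generalize poch (P.p * Y) P.p = c at *
  generalize poch (P.p * X⁻¹) P.p = d at *
  generalize 1 - P.p * X = s1 at *
  generalize 1 - P.p * Y⁻¹ = s2 at *
  field_simp

/-- Here all arguments are moved down by one power of `p` relative to the boundary case, so two
factors of each numerator and one of each denominator are split off. Reflecting `1 - z` into `1 -
z⁻¹` costs monomials; beyond those of the other order they amount to `(Y/(pX))² = p^{*-2}`. -/
theorem boxFactor_mul_opp (P : Params) {X Y : ℂ} (hY : Y ≠ 0) (hXY : X * P.t = Y * P.q)
    (h1 : poch (P.p * Y) P.p ≠ 0)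
    (h2 : poch (P.p * X⁻¹) P.p ≠ 0) (h3 : poch (P.p * X) P.p ≠ 0)
    (h4 : poch (P.p * Y⁻¹) P.p ≠ 0) (hX1 : 1 - X ≠ 0) (hY1 : 1 - Y ≠ 0) :
    boxFactor P.p X Y * (poch (P.p⁻¹ * X⁻¹) P.p / poch (P.p⁻¹ * (X⁻¹ * P.ps)) P.p *
      (poch (P.p⁻¹ * Y) P.p / poch (P.p⁻¹ * (Y * P.ps)) P.p)) =
      zFactor P.p X Y * -Y⁻¹ * (P.ps⁻¹ * P.ps⁻¹) := by
  have hq := P.q_ne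
  have ht := P.t_ne
  have hp := P.p_ne
  have hX : X = Y * P.q / P.t := by rw [← hXY, mul_div_cancel_right₀ _ ht]
  have hX0 : X ≠ 0 := by
    rw [hX]
    positivity
  have e1 : P.p⁻¹ * (X⁻¹ * P.ps) = Y⁻¹ := by
    rw [hX, Params.ps]
    field_simp
  have e2 : P.p⁻¹ * (Y * P.ps) = X := by
    rw [hX, Params.ps]
    field_simp
  have e4 : P.ps⁻¹ = P.p⁻¹ * Y * X⁻¹ := by
    rw [hX, Params.ps]
    field_simp
  have hY2 := one_sub_inv_ne_zero hY1
  have hX2 := one_sub_inv_ne_zero hX1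
  have e5 : P.p * (P.p⁻¹ * Y) = Y := by field_simp
  have e6 : P.p * (P.p⁻¹ * X⁻¹) = X⁻¹ := by field_simp
  rw [e1, e2, e4, boxFactor, zFactor, poch_eq_mul P.norm_p (P.p⁻¹ * X⁻¹),
    poch_eq_mul P.norm_p (P.p⁻¹ * Y), e5, e6, poch_eq_mul P.norm_p Y, poch_eq_mul P.norm_p X⁻¹,
    poch_eq_mul P.norm_p Y⁻¹, poch_eq_mul P.norm_p X]
  have f1 : (1 - P.p⁻¹ * X⁻¹) = -(P.p⁻¹ * X⁻¹) * (1 - P.p * X) := by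
    field_simp
    ring
  have f2 : (1 - P.p⁻¹ * Y) = -(P.p⁻¹ * Y) * (1 - P.p * Y⁻¹) := by
    field_simp
    ring
  have f3 : 1 - X⁻¹ = -X⁻¹ * (1 - X) := by
    field_simp
    ring
  have f4 : 1 - Y = -Y * (1 - Y⁻¹) := by
    field_simp
    ring
  rw [f1, f2, f3, f4]
  generalize 1 - Y⁻¹ = s at *
  generalize 1 - X = s' at *
  generalize poch (P.p * X) P.p = a at *
  generalize poch (P.p * Y⁻¹) P.p = b at *
  generalize poch (P.p * Y) P.p = c at *
  generalize poch (P.p * X⁻¹) P.p = d at *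
  generalize 1 - P.p * X = s1 at *
  generalize 1 - P.p * Y⁻¹ = s2 at *
  field_simp

theorem prod_boxFactor (P : Params) (lam : YoungDiagram) :
    ∏ c ∈ lam.cells, boxFactor P.p (wtNeg P lam c)⁻¹ (wtPos P lam c) =
      nFac P lam * nFac' P lam / (cFac P lam * cFac' P lam) := by
  rw [nFac, nFac', cFac, cFac', ← Finset.prod_mul_distrib, ← Finset.prod_mul_distrib,
    ← Finset.prod_div_distrib]
  refine Finset.prod_congr rfl fun c _ => ?_
  have e1 : (wtNeg P lam c)⁻¹ = P.q ^ (arm lam c + 1) * P.t ^ leg lam c := by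
    rw [wtNeg, mul_inv, ← zpow_neg, ← zpow_neg]
    congr 2 <;> ring
  have e2 : (wtPos P lam c)⁻¹ = P.q ^ (-arm lam c) * P.t ^ (-leg lam c - 1) := by
    rw [wtPos, mul_inv, ← zpow_neg, ← zpow_neg]
    congr 2
    ring
  rw [boxFactor, inv_inv, e1, e2, wtNeg, wtPos]
  simp only [mul_assoc]

theorem Z_eq_prod (P : Params) (lam : YoungDiagram) :
    Z P lam = ∏ c ∈ lam.cells, zFactor P.p (wtNeg P lam c)⁻¹ (wtPos P lam c) := by
  rw [Z]
  refine Finset.prod_congr rfl fun c _ => ?_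
  have e1 : (wtNeg P lam c)⁻¹ = P.q ^ (arm lam c + 1) * P.t ^ leg lam c := by
    rw [wtNeg, mul_inv, ← zpow_neg, ← zpow_neg]
    congr 2 <;> ring
  have e2 : (wtPos P lam c)⁻¹ = P.q ^ (-arm lam c) * P.t ^ (-leg lam c - 1) := by
    rw [wtPos, mul_inv, ← zpow_neg, ← zpow_neg]
    congr 2
    ring
  rw [zFactor, e1, e2]
  simp only [mul_assoc]

theorem prod_neg_inv_wtPos (P : Params) (lam : YoungDiagram) :
    ∏ c ∈ lam.cells, -(wtPos P lam c)⁻¹ =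
      (-1) ^ lam.card * (P.q ^ nPart' lam)⁻¹ * (P.t ^ nPart lam)⁻¹ * (P.t ^ lam.card)⁻¹ := by
  have h1 : ∏ c ∈ lam.cells, wtPos P lam c =
      P.q ^ nPart' lam * (P.t ^ nPart lam * P.t ^ lam.card) := by
    have hz : ∀ (z : ℂ) (hz : z ≠ 0) (f : ℕ × ℕ → ℤ), ∏ c ∈ lam.cells, z ^ f c =
        z ^ ∑ c ∈ lam.cells, f c := by
      intro z hz f
      induction lam.cells using Finset.induction_on with
      | empty => simp
      | insert a s ha ih => rw [Finset.prod_insert ha, Finset.sum_insert ha, zpow_add₀ hz, ih]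
    simp only [wtPos]
    rw [Finset.prod_mul_distrib, hz _ P.q_ne, hz _ P.t_ne, sum_arm, Finset.sum_add_distrib, sum_leg,
      Finset.sum_const, zpow_add₀ P.t_ne, zpow_natCast, zpow_natCast]
    simp
  rw [Finset.prod_congr rfl fun c _ => neg_eq_neg_one_mul _, Finset.prod_mul_distrib,
    Finset.prod_const, Finset.prod_inv_distrib, h1]
  simp only [mul_inv]
  ring

/-- The dependence on `u` and `v` cancels box by box; what survives is the shift `u ↦ up⁻¹`,
contributing `p^N`, and the `q` from `q⁻¹v`. The framing exponents add up to `-1`. -/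
theorem tFac_mul_tStarFac (P : Params) (lam : YoungDiagram) {u v : ℂ} (hu : u ≠ 0) (hv : v ≠ 0)
    (N : ℤ) : tFac P lam v (u * P.p⁻¹) N * tStarFac P lam u v N =
      (framing P lam)⁻¹ * (P.q * P.p ^ N) ^ lam.card := by
  have hp := P.p_ne
  have hq := P.q_ne
  have hf : framing P lam ≠ 0 := by
    simp only [framing]
    exact mul_ne_zero (mul_ne_zero (mul_ne_zero (pow_ne_zero _ (by norm_num)) (pow_ne_zero _ hq))
      (zpow_ne_zero _ P.t_ne)) (zpow_ne_zero _ P.γ_ne)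
  have h1 : framing P lam ^ (-N - 1) * framing P lam ^ N = (framing P lam)⁻¹ := by
    rw [← zpow_add₀ hf, ← zpow_neg_one]
    congr 1
    ring
  have hu' : -u ≠ 0 := neg_ne_zero.mpr hu
  have h2 : -(v * (u * P.p⁻¹)) * (-(u * P.p⁻¹)) ^ (-(N + 1)) * (P.q⁻¹ * v) ^ (-1 : ℤ) * (-u) ^ N =
      P.q * P.p ^ N := by
    have e1 : (-(u * P.p⁻¹)) = (-u) * P.p⁻¹ := by ring
    rw [e1, mul_zpow, zpow_neg (-u), zpow_add₀ hu', zpow_one, inv_zpow, zpow_neg P.p, inv_inv,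
      zpow_add₀ hp, zpow_one, zpow_neg_one]
    have h3 := zpow_ne_zero N hu'
    have h4 := zpow_ne_zero N hp
    generalize (-u) ^ N = a at *
    generalize P.p ^ N = b at *
    field_simp
  rw [tFac, tStarFac, ← h2, mul_pow, mul_pow, mul_pow, ← h1]
  simp only [← zpow_natCast, ← zpow_mul]
  rw [← neg_one_mul, ← neg_one_mul]
  ring_nf

/-- The scalars `N^2 q^{2 n(λ')} t t^* / (c c')` for the two vertex operators. -/
theorem scalar_eq (P : Params) (lam : YoungDiagram) {u v : ℂ} (hu : u ≠ 0) (hv : v ≠ 0) (N : ℤ)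
    {s : ℂ} (F C : ℂ) (hF : (nFac P lam * nFac' P lam / (cFac P lam * cFac' P lam)) * F =
      C * (Z P lam * (∏ c ∈ lam.cells, -(wtPos P lam c)⁻¹) * s ^ lam.card)) :
    (P.q ^ nPart' lam * nFac' P lam * tFac P lam v (u * P.p⁻¹) N / cFac' P lam) *
      (P.q ^ nPart' lam * nFac P lam * tStarFac P lam u v N / cFac P lam) * F =
      C * ((P.ps * P.p ^ (N - 1) * P.γ * s) ^ lam.card * Z P lam) := by
  have hp := P.p_ne
  have hq := P.q_ne
  have ht := P.t_ne
  have h1 : (P.q ^ nPart' lam * nFac' P lam * tFac P lam v (u * P.p⁻¹) N / cFac' P lam) *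
      (P.q ^ nPart' lam * nFac P lam * tStarFac P lam u v N / cFac P lam) * F =
      P.q ^ nPart' lam * P.q ^ nPart' lam * (tFac P lam v (u * P.p⁻¹) N * tStarFac P lam u v N) *
        ((nFac P lam * nFac' P lam / (cFac P lam * cFac' P lam)) * F) := by
    simp only [div_eq_mul_inv, mul_inv]
    ring
  rw [h1, hF, tFac_mul_tStarFac P lam hu hv, prod_neg_inv_wtPos, framing, zpow_neg, zpow_natCast,
    zpow_neg, zpow_natCast]
  have h2 : P.ps * P.p ^ (N - 1) = P.q * P.p ^ N * P.t⁻¹ := by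
    rw [Params.ps, zpow_sub_one₀ hp]
    field_simp
  rw [h2]
  simp only [mul_pow, mul_inv, inv_inv, inv_pow]
  have h3 : ((-1 : ℂ) ^ lam.card)⁻¹ * (-1) ^ lam.card = 1 :=
    inv_mul_cancel₀ (pow_ne_zero _ (by norm_num))
  have h4 := pow_ne_zero (nPart' lam) hq
  have h5 := pow_ne_zero (nPart lam) ht
  generalize (P.p ^ N) ^ lam.card = b1
  generalize P.q ^ lam.card = b2
  generalize P.q ^ nPart' lam = b3 at *
  generalize P.t ^ nPart lam = b4 at *
  -- The signs and the powers `q^{n(λ')}`, `t^{n(λ)}` of the inverse framing factor cancel against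
  -- `q^{2n(λ')}` and the product of the `-1/Y`. Only exponents proportional to `|λ|` remain.
  calc _ = (((-1 : ℂ) ^ lam.card)⁻¹ * (-1) ^ lam.card) * ((b3 * b3⁻¹) * (b3 * b3⁻¹)) *
        (b4 * b4⁻¹) * ((b2 * b1) * (P.t ^ lam.card)⁻¹ * P.γ ^ lam.card * s ^ lam.card * C * Z P lam) := by
        ring
    _ = _ := by rw [h3, mul_inv_cancel₀ h4, mul_inv_cancel₀ h5]; ring

/-- The nonvanishing facts about one box, with `X = wtNeg⁻¹ = q^{a+1} t^ℓ` and `Y = wtPos = q^a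
t^{ℓ+1}`. Those with arguments built from `X` or `Y` follow from `|X|, |Y| < 1`, those built from
the inverses from genericity of `p`, with a norm estimate for the factor without `p`. -/
theorem wt_data (P : Params) (lam : YoungDiagram) {c : ℕ × ℕ} (hc : c ∈ lam.cells) :
    wtPos P lam c ≠ 0 ∧ (wtNeg P lam c)⁻¹ * P.t = wtPos P lam c * P.q ∧
      1 - (wtNeg P lam c)⁻¹ ≠ 0 ∧ 1 - wtPos P lam c ≠ 0 ∧
      poch (P.p * wtPos P lam c) P.p ≠ 0 ∧ poch (P.p * wtNeg P lam c) P.p ≠ 0 ∧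
      poch (P.p * (wtNeg P lam c)⁻¹) P.p ≠ 0 ∧ poch (P.p * (wtPos P lam c)⁻¹) P.p ≠ 0 ∧
      poch (P.p * (P.p * (wtNeg P lam c)⁻¹)) P.p ≠ 0 ∧
      poch (P.p * (P.p * (wtPos P lam c)⁻¹)) P.p ≠ 0 ∧
      poch ((wtNeg P lam c)⁻¹) P.p ≠ 0 ∧ poch ((wtPos P lam c)⁻¹) P.p ≠ 0 := by
  obtain ⟨a, l, h1, h2, -, -⟩ := exists_pow_of_mem_cells P lam hc
  rw [h1, h2, inv_inv]
  have hX := norm_pow_mul_pow_lt_one P (a + 1) l (by omega)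
  have hY := norm_pow_mul_pow_lt_one P a (l + 1) (by omega)
  have hm : ∀ {z : ℂ}, ‖z‖ < 1 → ‖P.p * z‖ < 1 := fun hz => by
    rw [norm_mul]
    exact mul_lt_one_of_nonneg_of_lt_one_left (norm_nonneg _) P.norm_p hz.le
  refine ⟨mul_ne_zero (pow_ne_zero _ P.q_ne) (pow_ne_zero _ P.t_ne), by ring,
    one_sub_ne_zero_of_norm_lt_one hX, one_sub_ne_zero_of_norm_lt_one hY,
    poch_ne_zero_of_norm_lt_one P (hm hY), ?_, poch_ne_zero_of_norm_lt_one P (hm hX), ?_,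
    poch_ne_zero_of_norm_lt_one P (hm (hm hX)), ?_, poch_ne_zero_of_norm_lt_one P hX,
    poch_inv_ne_zero P _ _ (by omega)⟩
  · simpa using poch_p_pow_div_ne_zero P 0 (a + 1) l
  · simpa using poch_p_pow_div_ne_zero P 0 a (l + 1)
  · simpa [pow_succ, mul_assoc] using poch_p_pow_div_ne_zero P 1 a (l + 1)

/-- The two weights of a box have product `t/q`, hence multiplication by `p^* = pq/t` exchanges them
up to inversion and a factor `p`. -/
theorem wt_mul_ps (P : Params) (lam : YoungDiagram) {c : ℕ × ℕ} (hc : c ∈ lam.cells) :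
    wtNeg P lam c * P.ps = P.p * (wtPos P lam c)⁻¹ ∧
      wtPos P lam c * P.ps = P.p * (wtNeg P lam c)⁻¹ := by
  obtain ⟨a, l, h1, h2, -, -⟩ := exists_pow_of_mem_cells P lam hc
  have hq := P.q_ne
  have ht := P.t_ne
  rw [h1, h2, inv_inv, Params.ps]
  constructor
  · field_simp
    ring
  · field_simp
    ring

theorem contraction_p (P : Params) (lam : YoungDiagram) :
    (nFac P lam * nFac' P lam / (cFac P lam * cFac' P lam)) * contraction P lam P.p =
      constC P * (Z P lam * ∏ c ∈ lam.cells, -(wtPos P lam c)⁻¹) := by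
  have h1 : P.p * (P.t * P.ps) = P.p ^ 2 * P.q := by
    have := P.t_ne
    rw [Params.ps]
    field_simp
  rw [← prod_boxFactor, contraction, h1, ← constC, mul_left_comm, ← Finset.prod_mul_distrib,
    Z_eq_prod, ← Finset.prod_mul_distrib]
  congr 1
  refine Finset.prod_congr rfl fun c hc => ?_
  obtain ⟨d1, d2, d3, d4, d5, d6, d7, d8, d9, d10, d11, d12⟩ := wt_data P lam hc
  have := boxFactor_mul P d1 d2 d5 (by rwa [inv_inv]) d9 d10 d3 d4
  rwa [inv_inv] at this

theorem contraction_p_inv (P : Params) (lam : YoungDiagram) :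
    (nFac P lam * nFac' P lam / (cFac P lam * cFac' P lam)) * contraction P lam P.p⁻¹ =
      constCOpp P * (Z P lam * (∏ c ∈ lam.cells, -(wtPos P lam c)⁻¹) *
        (P.ps⁻¹ * P.ps⁻¹) ^ lam.card) := by
  have h1 : P.p⁻¹ * (P.t * P.ps) = P.q := by
    have := P.t_ne
    have := P.p_ne
    rw [Params.ps]
    field_simp
  rw [← prod_boxFactor, contraction, h1, ← constCOpp, mul_left_comm, ← Finset.prod_mul_distrib,
    Z_eq_prod, ← Finset.prod_mul_distrib, YoungDiagram.card, ← Finset.prod_const,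
    ← Finset.prod_mul_distrib]
  congr 1
  refine Finset.prod_congr rfl fun c hc => ?_
  obtain ⟨d1, d2, d3, d4, d5, d6, d7, d8, d9, d10, d11, d12⟩ := wt_data P lam hc
  have := boxFactor_mul_opp P d1 d2 d5 (by rwa [inv_inv]) d7 d8 d3 d4
  rwa [inv_inv] at this

theorem analyticAt_contraction_p (P : Params) (lam : YoungDiagram) :
    AnalyticAt ℂ (contraction P lam) P.p := by
  refine analyticAt_contraction P lam ?_ (fun c hc => ?_) fun c hc => ?_
  · have h1 : P.p * (P.t * P.ps) = P.p * P.q * P.p := by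
      have := P.t_ne
      rw [Params.ps]
      field_simp
    rw [h1]
    refine poch3_ne_zero P.norm_q P.norm_t P.norm_p fun a b c => ?_
    rw [mul_assoc, mul_assoc _ (P.q ^ a), mul_comm (P.p * P.q * P.p), ]
    have h2 : ‖P.q ^ a * (P.t ^ b * P.p ^ c) * (P.p * P.q)‖ < 1 := by
      simp only [norm_mul, norm_pow]
      refine mul_lt_one_of_nonneg_of_lt_one_right (mul_le_one₀ (pow_le_one₀ (norm_nonneg _)
        P.norm_q.le) (by positivity) (mul_le_one₀ (pow_le_one₀ (norm_nonneg _) P.norm_t.le)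
        (by positivity) (pow_le_one₀ (norm_nonneg _) P.norm_p.le))) (by positivity)
        (mul_lt_one_of_nonneg_of_lt_one_left (norm_nonneg _) P.norm_p P.norm_q.le)
    have := mul_pow_ne_one h2 P.norm_p 1
    rwa [pow_one, mul_assoc] at this
  · rw [(wt_mul_ps P lam hc).1]
    obtain ⟨d1, d2, d3, d4, d5, d6, d7, d8, d9, d10, d11, d12⟩ := wt_data P lam hc
    exact d10
  · rw [(wt_mul_ps P lam hc).2]
    obtain ⟨d1, d2, d3, d4, d5, d6, d7, d8, d9, d10, d11, d12⟩ := wt_data P lam hc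
    exact d9

theorem analyticAt_contraction_p_inv (P : Params) (lam : YoungDiagram) :
    AnalyticAt ℂ (contraction P lam) P.p⁻¹ := by
  refine analyticAt_contraction P lam ?_ (fun c hc => ?_) fun c hc => ?_
  · have h1 : P.p⁻¹ * (P.t * P.ps) = P.q := by
      have := P.t_ne
      have := P.p_ne
      rw [Params.ps]
      field_simp
    rw [h1]
    refine poch3_ne_zero P.norm_q P.norm_t P.norm_p fun a b c => ?_
    have h2 : ‖P.q * P.q ^ a * P.t ^ b‖ < 1 := by
      rw [← pow_succ']
      exact norm_pow_mul_pow_lt_one P (a + 1) b (by omega)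
    exact mul_pow_ne_one h2 P.norm_p c
  · rw [(wt_mul_ps P lam hc).1, inv_mul_cancel_left₀ P.p_ne]
    obtain ⟨d1, d2, d3, d4, d5, d6, d7, d8, d9, d10, d11, d12⟩ := wt_data P lam hc
    exact d12
  · rw [(wt_mul_ps P lam hc).2, inv_mul_cancel_left₀ P.p_ne]
    obtain ⟨d1, d2, d3, d4, d5, d6, d7, d8, d9, d10, d11, d12⟩ := wt_data P lam hc
    exact d11

theorem nexp'_eq_vop (P : Params) (d : ℤ → ℂ) :
    nexp' P d = vop (fun m => d (-(m : ℤ)) * rho P (-(m : ℤ))) fun m => d m * rho P m * heis P m :=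
  rfl

theorem hasSum_entry_nexp'_mul (P : Params) (d d' : ℤ → ℂ) {L : ℂ}
    (h : HasSum (fun m : ℕ+ => d' (-(m : ℤ)) * rho P (-(m : ℤ)) * (d m * rho P m * heis P m)) L)
    (y x : ℕ+ →₀ ℕ) :
    HasSum (fun e => entry (nexp' P d) y e * entry (nexp' P d') e x)
      (Complex.exp L * entry (nexp' P (d + d')) y x) := by
  have h1 := hasSum_entry_vop_mul h.summable.norm y x
    (c := fun m => d (-(m : ℤ)) * rho P (-(m : ℤ))) (b' := fun m => d' m * rho P m * heis P m)
  rw [h.tsum_eq] at h1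
  have h2 : nexp' P (d + d') = vop
      ((fun m : ℕ+ => d (-(m : ℤ)) * rho P (-(m : ℤ))) +
        fun m : ℕ+ => d' (-(m : ℤ)) * rho P (-(m : ℤ)))
      ((fun m : ℕ+ => d m * rho P m * heis P m) + fun m : ℕ+ => d' m * rho P m * heis P m) := by
    rw [nexp'_eq_vop]
    congr 1 <;> ext m <;> simp only [Pi.add_apply] <;> ring
  rw [h2]
  exact h1

theorem entry_nexp'_mem {Ω : Type*} (P : Params) (S : Subalgebra ℂ (Ω → ℂ)) {d : Ω → ℤ → ℂ}
    (h : ∀ m, m ≠ 0 → (fun ω => d ω m) ∈ S) (y x : ℕ+ →₀ ℕ) :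
    (fun ω => entry (nexp' P (d ω)) y x) ∈ S := by
  simp only [nexp'_eq_vop]
  refine entry_vop_mem S (fun m => ?_) (fun m => ?_) y x
  · have h1 := S.smul_mem (h (-(m : ℤ)) (by simp)) (rho P (-(m : ℤ)))
    convert h1 using 1
    ext ω
    simp [mul_comm]
  · have h1 := S.smul_mem (h m (by simp)) (rho P m * heis P m)
    convert h1 using 1
    ext ω
    simp only [Pi.smul_apply, smul_eq_mul]
    ring

/-- The common form of the two operator products. -/
theorem isProductEntry_of_contraction (P : Params) (lam : YoungDiagram) (u : ℂ)
    {A B : ℂ → Fock →ₗ[ℂ] FockHat} (k : ℂ) (dA dB : ℂ → ℤ → ℂ) (kA kB : ℂ) (s : ℤ)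
    (hA : ∀ r, A r = kA • nexp' P (dA r)) (hB : ∀ r, B r = kB • nexp' P (dB r))
    (hc : ∀ r ≠ 0, ∀ m : ℕ+, dB r (-(m : ℤ)) * rho P (-(m : ℤ)) * (dA r m * rho P m * heis P m) =
      contractionCoeff P lam r m)
    (hd : ∀ r ≠ 0, ∀ m : ℤ, m ≠ 0 → dA r m + dB r m = (1 - r ^ (s * m)) * phiCoeff P lam u m)
    {r₀ : ℂ} (hr₀ : r₀ ≠ 0) (hr₀p : ∀ m, r₀ ^ (s * m) = P.p ^ m)
    (han : AnalyticAt ℂ (contraction P lam) r₀)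
    (hk : kA * kB * contraction P lam r₀ = k) (y x : ℕ+ →₀ ℕ) :
    IsProductEntry A B r₀ y x (k * entry (YY P lam u) y x) := by
  have hmem : (fun r : ℂ => entry (nexp' P fun m => (1 - r ^ (s * m)) * phiCoeff P lam u m) y x) ∈
      puncturedAlgebra := by
    refine entry_nexp'_mem P puncturedAlgebra (fun m _ => ?_) y x
    have h1 := puncturedAlgebra.smul_mem (puncturedAlgebra.sub_mem puncturedAlgebra.one_mem
      (zpow_mem_puncturedAlgebra (s * m))) (phiCoeff P lam u m)
    convert h1 using 1
    ext r
    simp [mul_comm]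
  -- The continuation: the contraction as a quotient of entire functions, times the matrix element
  -- of the combined exponential. The latter is analytic off `0`, being a polynomial in integer
  -- powers of `r`. At `r₀` the powers `r₀^{sm}` become `p^m`, which gives the `Y`-operators.
  refine ⟨fun r => kA * kB * contraction P lam r *
    entry (nexp' P fun m => (1 - r ^ (s * m)) * phiCoeff P lam u m) y x, ?_, ?_, ?_, ?_⟩
  · intro z
    exact (((MeromorphicAt.const _ z).mul (meromorphic_contraction P lam z))).mul (hmem.1 z)
  · exact ((analyticAt_const.mul han)).mul (hmem.2 r₀ hr₀)
  · simp only [hk, hr₀p, ← YY_eq]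
  · filter_upwards [(eventually_hasSum_contractionCoeff P lam).filter_mono nhdsWithin_le_nhds,
      self_mem_nhdsWithin] with r hr hr0
    obtain ⟨L, hL, hE⟩ := hr
    have h1 := (hasSum_entry_nexp'_mul P (dA r) (dB r) (L := L) (by
      simpa only [hc r hr0] using hL) y x).mul_left (kA * kB)
    have h2 : nexp' P (dA r + dB r) = nexp' P fun m => (1 - r ^ (s * m)) * phiCoeff P lam u m :=
      nexp'_congr P fun m hm => hd r hr0 m hm
    rw [hE, ← mul_assoc, h2] at h1
    refine h1.congr_fun fun e => ?_
    rw [hA, hB, entry_smul, entry_smul]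
    ring

/-- Dilations act by inverse scalars on modes `m` and `-m`, so a contraction depends only on the
ratio of the arguments. -/
theorem phiCoeff_neg_mul (P : Params) (lam : YoungDiagram) {u : ℂ} (hu : u ≠ 0) {m : ℤ}
    (hm : m ≠ 0) : phiCoeff P lam u (-m) * phiCoeff P lam u m =
      phiCoeff P lam 1 (-m) * phiCoeff P lam 1 m := by
  have h1 := phiCoeff_mul P lam u 1 hm
  have h2 := phiCoeff_mul P lam u 1 (neg_ne_zero.mpr hm)
  have h3 : u ^ (-(-m)) * u ^ (-m) = 1 := by rw [← zpow_add₀ hu, neg_add_cancel, zpow_zero]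
  rw [mul_one] at h1 h2
  rw [h1, h2]
  linear_combination (phiCoeff P lam 1 (-m) * phiCoeff P lam 1 m) * h3

/-- Here `r = u/w`, so `w = r⁻¹u` and the combined exponent carries `1 - r^m`; thus `s = 1` and the
evaluation point is `p`. -/
theorem isPhiStarPhi (P : Params) (N : ℤ) {u v : ℂ} (hu : u ≠ 0) (hv : v ≠ 0)
    (lam : YoungDiagram) : IsPhiStarPhi P N u v lam
      ((constC P * (frakq P N ^ lam.card * Z P lam)) • YY P lam u) := by
  intro y x
  rw [entry_smul]
  refine isProductEntry_of_contraction P lam u _ (fun r m => -phiCoeff P lam (r⁻¹ * u) m)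
    (fun _ => phiCoeff P lam u) _ _ 1 (fun r => rfl) (fun r => rfl) ?_ ?_ P.p_ne
    (fun m => by rw [one_mul]) (analyticAt_contraction_p P lam) ?_ y x
  · intro r hr m
    have hm : (m : ℤ) ≠ 0 := by simp
    rw [phiCoeff_mul P lam r⁻¹ u hm, contractionCoeff, inv_zpow, zpow_neg, inv_inv]
    linear_combination (-(r ^ (m : ℤ) * rho P (-(m : ℤ)) * rho P m * heis P m)) *
      phiCoeff_neg_mul P lam hu hm
  · intro r hr m hm
    rw [phiCoeff_mul P lam r⁻¹ u hm, inv_zpow, zpow_neg, inv_inv, one_mul]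
    ring
  · rw [scalar_eq P lam hu hv N (s := 1) (contraction P lam P.p) (constC P)
      (by rw [contraction_p, one_pow, mul_one]), mul_one, frakq]

/-- Now `r = w/u`, so the combined exponent carries `1 - r^{-m}`; thus `s = -1` and the evaluation
point is `p⁻¹`. The contraction function is the same as in the other order, and the additional
`p^{*-2}` for each box changes `𝔮` from `p^* ⋯` to `p^{*-1} ⋯`. -/
theorem isPhiPhiStar (P : Params) (N : ℤ) {u v : ℂ} (hu : u ≠ 0) (hv : v ≠ 0)
    (lam : YoungDiagram) : IsPhiPhiStar P N u v lam
      ((constCOpp P * (frakqOpp P N ^ lam.card * Z P lam)) • YY P lam u) := by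
  intro y x
  rw [entry_smul]
  refine isProductEntry_of_contraction P lam u _ (fun _ => phiCoeff P lam u)
    (fun r m => -phiCoeff P lam (r * u) m) _ _ (-1) (fun r => rfl) (fun r => rfl) ?_ ?_
    (inv_ne_zero P.p_ne) (fun m => by rw [inv_zpow, neg_one_mul, zpow_neg, inv_inv])
    (analyticAt_contraction_p_inv P lam) ?_ y x
  · intro r hr m
    have hm : (m : ℤ) ≠ 0 := by simp
    rw [phiCoeff_mul P lam r u (neg_ne_zero.mpr hm), contractionCoeff, neg_neg]
    linear_combination (-(r ^ (m : ℤ) * rho P (-(m : ℤ)) * rho P m * heis P m)) *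
      phiCoeff_neg_mul P lam hu hm
  · intro r hr m hm
    rw [phiCoeff_mul P lam r u hm, neg_one_mul]
    ring
  · have h1 : P.ps * P.p ^ (N - 1) * P.γ * (P.ps⁻¹ * P.ps⁻¹) = frakqOpp P N := by
      have := P.ps_ne
      rw [frakqOpp]
      field_simp
    rw [mul_comm (_ / cFac P lam), scalar_eq P lam hu hv N _ _ (contraction_p_inv P lam), h1]

/-! ## Convergence of the sums over partitions -/

/-- The families of functions on the set of partitions which grow at most exponentially in `|λ|`, with
a uniform growth rate. -/
def growthAlgebra (A : Type*) : Subalgebra ℂ (A × YoungDiagram → ℂ) where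
  carrier := {f | ∃ K : ℝ, 1 ≤ K ∧ ∀ a, ∃ C : ℝ, 0 ≤ C ∧ ∀ lam, ‖f (a, lam)‖ ≤ C * K ^ lam.card}
  mul_mem' := by
    rintro f f' ⟨K, hK, h⟩ ⟨K', hK', h'⟩
    refine ⟨K * K', one_le_mul_of_one_le_of_one_le hK hK', fun a => ?_⟩
    obtain ⟨C, hC, h⟩ := h a
    obtain ⟨C', hC', h'⟩ := h' a
    refine ⟨C * C', mul_nonneg hC hC', fun lam => ?_⟩
    rw [Pi.mul_apply, norm_mul, mul_pow, mul_mul_mul_comm]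
    exact mul_le_mul (h lam) (h' lam) (norm_nonneg _) ((norm_nonneg _).trans (h lam))
  add_mem' := by
    rintro f f' ⟨K, hK, h⟩ ⟨K', hK', h'⟩
    refine ⟨max K K', hK.trans (le_max_left _ _), fun a => ?_⟩
    obtain ⟨C, hC, h⟩ := h a
    obtain ⟨C', hC', h'⟩ := h' a
    refine ⟨C + C', add_nonneg hC hC', fun lam => ?_⟩
    rw [Pi.add_apply, add_mul]
    refine (norm_add_le _ _).trans (add_le_add ((h lam).trans ?_) ((h' lam).trans ?_))
    · exact mul_le_mul_of_nonneg_left (pow_le_pow_left₀ (by linarith) (le_max_left _ _) _) hC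
    · exact mul_le_mul_of_nonneg_left (pow_le_pow_left₀ (by linarith) (le_max_right _ _) _) hC'
  algebraMap_mem' := fun r => ⟨1, le_rfl, fun _ => ⟨‖r‖, norm_nonneg _, fun lam => by simp⟩⟩

theorem fst_le_card {lam : YoungDiagram} {c : ℕ × ℕ} (hc : c ∈ lam.cells) : c.1 ≤ lam.card := by
  have h1 : c.1 < lam.colLen c.2 := YoungDiagram.mem_iff_lt_colLen.mp hc
  rw [YoungDiagram.colLen_eq_card] at h1
  exact h1.le.trans (Finset.card_le_card (Finset.filter_subset _ _))

theorem snd_le_card {lam : YoungDiagram} {c : ℕ × ℕ} (hc : c ∈ lam.cells) : c.2 ≤ lam.card := by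
  have h1 : c.2 < lam.rowLen c.1 := YoungDiagram.mem_iff_lt_rowLen.mp hc
  rw [YoungDiagram.rowLen_eq_card] at h1
  exact h1.le.trans (Finset.card_le_card (Finset.filter_subset _ _))

/-- There are `|λ| ≤ 2^{|λ|}` terms, and both coordinates of a box are at most `|λ|`. -/
theorem boxSum_mem_growthAlgebra (A : Type*) (y x : ℂ) :
    (fun ω : A × YoungDiagram => boxSum ω.2 y x) ∈ growthAlgebra A := by
  set M := max 1 ‖y‖
  set M' := max 1 ‖x‖
  have hM : 1 ≤ M := le_max_left _ _
  have hM' : 1 ≤ M' := le_max_left _ _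
  refine ⟨2 * M * M', ?_, fun a => ⟨1, zero_le_one, fun lam => ?_⟩⟩
  · exact one_le_mul_of_one_le_of_one_le (by linarith) hM'
  · rw [one_mul, mul_assoc, mul_pow]
    refine (norm_sum_le_of_le (f := fun c : ℕ × ℕ => y ^ c.1 * x ^ c.2) _
      (n := fun _ => (M * M') ^ lam.card) fun c hc => ?_).trans ?_
    · rw [norm_mul, norm_pow, norm_pow, mul_pow]
      refine mul_le_mul ?_ ?_ (by positivity) (by positivity)
      · exact (pow_le_pow_left₀ (norm_nonneg _) (le_max_right _ _) _).trans
          (pow_le_pow_right₀ hM (fst_le_card hc))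
      · exact (pow_le_pow_left₀ (norm_nonneg _) (le_max_right _ _) _).trans
          (pow_le_pow_right₀ hM' (snd_le_card hc))
    · rw [Finset.sum_const, nsmul_eq_mul]
      refine mul_le_mul_of_nonneg_right ?_ (by positivity)
      exact_mod_cast Nat.lt_two_pow_self.le

/-- The parameter set is that of the spectral parameter `u`. It may affect the constant but not the
rate of growth, and this makes the bound on `N` below independent of `u`. -/
theorem entry_YY_mem_growthAlgebra (P : Params) (y x : ℕ+ →₀ ℕ) :
    (fun ω : ℂ × YoungDiagram => entry (YY P ω.2 ω.1) y x) ∈ growthAlgebra ℂ := by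
  simp only [YY_eq]
  refine entry_nexp'_mem P (growthAlgebra ℂ) (fun m hm => ?_) y x
  have h1 : (fun ω : ℂ × YoungDiagram => ω.1 ^ (-m)) ∈ growthAlgebra ℂ :=
    ⟨1, le_rfl, fun a => ⟨‖a ^ (-m)‖, norm_nonneg _, fun lam => by simp⟩⟩
  have h2 := (growthAlgebra ℂ).mul_mem h1 ((growthAlgebra ℂ).sub_mem (growthAlgebra ℂ).one_mem
    ((growthAlgebra ℂ).smul_mem (boxSum_mem_growthAlgebra ℂ (P.t ^ m) (P.q ^ m)⁻¹)
      ((1 - (P.q ^ m)⁻¹) * (1 - P.t ^ m))))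
  have h3 := (growthAlgebra ℂ).smul_mem h2 ((1 - P.p ^ m) * ((P.kappa m)⁻¹ * P.γ ^ (-m)))
  convert h3 using 1
  ext ω
  simp only [phiCoeff_eq P _ _ hm, mul_zpow P.γ, Pi.smul_apply, Pi.mul_apply, Pi.sub_apply,
    Pi.one_apply, smul_eq_mul]
  ring

theorem norm_pow_mul_pow_le (P : Params) (a l : ℕ) (h : a + l ≠ 0) :
    ‖P.q ^ a * P.t ^ l‖ ≤ max ‖P.q‖ ‖P.t‖ := by
  rw [norm_mul, norm_pow, norm_pow]
  rcases Nat.eq_zero_or_pos a with rfl | ha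
  · rw [pow_zero, one_mul]
    exact (pow_le_of_le_one (norm_nonneg _) P.norm_t.le (by omega)).trans (le_max_right _ _)
  · exact (mul_le_of_le_one_right (by positivity) (pow_le_one₀ (norm_nonneg _) P.norm_t.le)).trans
      ((pow_le_of_le_one (norm_nonneg _) P.norm_q.le ha.ne').trans (le_max_left _ _))

/-- Writing `(1 - p/Y)/(1 - 1/Y) = (p - Y)/(1 - Y)` replaces the unbounded `Y⁻¹` by the small
quantity `Y`, so both quotients are at most `2/(1 - r)`. -/
theorem norm_zFactor_le {p X Y : ℂ} {r : ℝ} (hp : ‖p‖ ≤ 1) (hr : r < 1) (hX : ‖X‖ ≤ r)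
    (hY : ‖Y‖ ≤ r) (hY0 : Y ≠ 0) : ‖zFactor p X Y‖ ≤ 2 / (1 - r) * (2 / (1 - r)) := by
  have hX1 : 1 - X ≠ 0 := one_sub_ne_zero_of_norm_lt_one (hX.trans_lt hr)
  have hY1 : 1 - Y ≠ 0 := one_sub_ne_zero_of_norm_lt_one (hY.trans_lt hr)
  have h1 : zFactor p X Y = (1 - p * X) / (1 - X) * ((p - Y) / (1 - Y)) := by
    rw [zFactor, mul_div_mul_comm]
    congr 1
    rw [div_eq_div_iff (one_sub_inv_ne_zero hY1) hY1]
    field_simp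
    ring
  have h2 : ∀ {z : ℂ}, ‖z‖ ≤ r → 1 - r ≤ ‖1 - z‖ := fun {z} hz => by
    have := norm_sub_norm_le (1 : ℂ) z
    rw [norm_one] at this
    linarith
  have h3 : 0 < 1 - r := by linarith
  rw [h1, norm_mul, norm_div, norm_div]
  refine mul_le_mul (div_le_div₀ (by norm_num) ?_ h3 (h2 hX))
    (div_le_div₀ (by norm_num) ?_ h3 (h2 hY)) (by positivity) (by positivity)
  · refine (norm_sub_le _ _).trans ?_
    rw [norm_one, norm_mul]
    have := mul_le_one₀ hp (norm_nonneg X) (hX.trans hr.le)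
    linarith
  · refine (norm_sub_le _ _).trans ?_
    linarith

theorem exists_norm_Z_le (P : Params) :
    ∃ K : ℝ, 0 ≤ K ∧ ∀ lam, ‖Z P lam‖ ≤ K ^ lam.card := by
  set r := max ‖P.q‖ ‖P.t‖
  have hr : r < 1 := max_lt P.norm_q P.norm_t
  have hr0 : 0 < 1 - r := by linarith
  refine ⟨2 / (1 - r) * (2 / (1 - r)), by positivity, fun lam => ?_⟩
  rw [Z_eq_prod, norm_prod, YoungDiagram.card, ← Finset.prod_const]
  refine Finset.prod_le_prod (fun _ _ => norm_nonneg _) fun c hc => ?_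
  obtain ⟨a, l, h1, h2, -, -⟩ := exists_pow_of_mem_cells P lam hc
  rw [h1, h2, inv_inv]
  exact norm_zFactor_le P.norm_p.le hr (norm_pow_mul_pow_le P _ _ (by omega))
    (norm_pow_mul_pow_le P _ _ (by omega))
    (mul_ne_zero (pow_ne_zero _ P.q_ne) (pow_ne_zero _ P.t_ne))

theorem exists_norm_frakq_mul_lt (P : Params) (K : ℝ) (hK : 0 ≤ K) :
    ∃ N₀ : ℤ, ∀ N, N₀ ≤ N → ‖frakq P N‖ * K < 1 / 2 := by
  have h1 : Tendsto (fun n : ℕ => ‖P.p‖ ^ n * (‖P.ps‖ * ‖P.γ‖ * K)) atTop (𝓝 0) := by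
    have := (tendsto_pow_atTop_nhds_zero_of_lt_one (norm_nonneg _) P.norm_p).mul_const
      (‖P.ps‖ * ‖P.γ‖ * K)
    rwa [zero_mul] at this
  obtain ⟨n, hn⟩ := (h1.eventually_lt_const (by norm_num : (0 : ℝ) < 1 / 2)).exists
  refine ⟨n + 1, fun N hN => lt_of_le_of_lt ?_ hn⟩
  rw [frakq, norm_mul, norm_mul, norm_zpow]
  have h2 : ‖P.p‖ ^ (N - 1) ≤ ‖P.p‖ ^ n := by
    rw [← zpow_natCast]
    exact zpow_le_zpow_right_of_le_one₀ (norm_pos_iff.mpr P.p_ne) P.norm_p.le (by linarith)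
  calc _ = ‖P.p‖ ^ (N - 1) * (‖P.ps‖ * ‖P.γ‖ * K) := by ring
    _ ≤ _ := mul_le_mul_of_nonneg_right h2 (by positivity)

/-- `N` is taken so large that `|𝔮|` times both growth rates is below `1/2`; the number of
partitions is then beaten by a geometric series. -/
theorem exists_summable_entry_YY (P : Params) (y x : ℕ+ →₀ ℕ) :
    ∃ N₀ : ℤ, ∀ N, N₀ ≤ N → ∀ u : ℂ,
      Summable fun lam => frakq P N ^ lam.card * Z P lam * entry (YY P lam u) y x := by
  obtain ⟨K, hK, h⟩ := entry_YY_mem_growthAlgebra P y x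
  obtain ⟨K', hK', h'⟩ := exists_norm_Z_le P
  obtain ⟨N₀, hN₀⟩ := exists_norm_frakq_mul_lt P (K' * K) (by positivity)
  refine ⟨N₀, fun N hN u => ?_⟩
  obtain ⟨C, hC, h⟩ := h u
  refine Summable.of_norm_bounded ((summable_pow_card (by positivity) (hN₀ N hN)).mul_left C)
    fun lam => ?_
  rw [norm_mul, norm_mul, norm_pow, mul_pow, mul_pow]
  calc _ ≤ ‖frakq P N‖ ^ lam.card * K' ^ lam.card * (C * K ^ lam.card) :=
        mul_le_mul (mul_le_mul_of_nonneg_left (h' lam) (by positivity)) (h lam) (norm_nonneg _)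
          (by positivity)
    _ = _ := by ring

theorem isTEntry_of_hasSum (P : Params) (N : ℤ) {u v : ℂ} (hu : u ≠ 0) (hv : v ≠ 0)
    (y x : ℕ+ →₀ ℕ) {σ : ℂ}
    (h : HasSum (fun lam => frakq P N ^ lam.card * Z P lam * entry (YY P lam u) y x) σ) :
    IsTEntry P N u v y x (constC P * σ) := by
  refine ⟨fun lam => entry ((constC P * (frakq P N ^ lam.card * Z P lam)) • YY P lam u) y x,
    fun lam => isPhiStarPhi P N hu hv lam y x, ?_⟩
  refine (h.mul_left (constC P)).congr_fun fun lam => ?_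
  rw [entry_smul]
  ring

theorem entry_nexp_zero (P : Params) (d : ℤ → ℂ) : entry (nexp P d) 0 0 = 1 := by
  rw [nexp_eq_vop, entry_vop, Finset.HasAntidiagonal.antidiagonal_zero, Finset.sum_singleton,
    show MvPolynomial.monomial (0 : ℕ+ →₀ ℕ) (1 : ℂ) = 1 from rfl, map_one]
  simp [expCoeff]

theorem finsum_fiber_eq_sum {n : ℕ} (f : YoungDiagram → ℂ) :
    ∑ᶠ (lam : YoungDiagram) (_ : lam.card = n), f lam =
      ∑' lam : {lam : YoungDiagram // lam.card = n}, f lam := by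
  rw [tsum_eq_finsum (Set.toFinite _)]
  exact (finsum_subtype_eq_finsum_cond _).symm

theorem hasSum_fiber_card {f : YoungDiagram → ℂ} {s σ : ℂ}
    (h : HasSum (fun lam => s ^ lam.card * f lam) σ) :
    HasSum (fun n : ℕ => s ^ n * ∑ᶠ (lam : YoungDiagram) (_ : lam.card = n), f lam) σ := by
  rw [← (Equiv.sigmaFiberEquiv fun lam : YoungDiagram => lam.card).hasSum_iff] at h
  refine (h.sigma fun n => (Summable.of_finite).hasSum).congr_fun fun n => ?_
  rw [finsum_fiber_eq_sum, ← tsum_mul_left]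
  refine tsum_congr fun lam => ?_
  simp [lam.2]

/-! ## Comparison with the instanton partition function -/

/-- The shift `x ↦ xq/t` turns the exponents `(-a-1, -ℓ)` and `(a, ℓ+1)` of the Nekrasov function
into `(-a, -ℓ-1)` and `(a+1, ℓ)`, the two weights in `𝒵_λ`. -/
theorem nekrasov_div (P : Params) (lam : YoungDiagram) :
    nekrasov P lam lam (P.p * P.q / P.t) / nekrasov P lam lam (P.q / P.t) = Z P lam := by
  rw [nekrasov, nekrasov, ← Finset.prod_mul_distrib, ← Finset.prod_mul_distrib,
    ← Finset.prod_div_distrib, Z]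
  have hq := P.q_ne
  have ht := P.t_ne
  refine Finset.prod_congr rfl fun c _ => ?_
  have e1 : ∀ x : ℂ, x * P.q / P.t * P.q ^ (-arm lam c - 1) * P.t ^ (-leg lam c) =
      x * P.q ^ (-arm lam c) * P.t ^ (-leg lam c - 1) := fun x => by
    rw [zpow_sub_one₀ hq, zpow_sub_one₀ ht]
    field_simp
  have e2 : ∀ x : ℂ, x * P.q / P.t * P.q ^ arm lam c * P.t ^ (leg lam c + 1) =
      x * P.q ^ (arm lam c + 1) * P.t ^ leg lam c := fun x => by
    rw [zpow_add_one₀ hq, zpow_add_one₀ ht]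
    field_simp
  have e3 := e1 1
  have e4 := e2 1
  simp only [one_mul] at e3 e4
  rw [e1, e2, e3, e4]
  ring

theorem finsum_Z (P : Params) (n : ℕ) :
    ∑ᶠ (lam : YoungDiagram) (_ : lam.card = n), Z P lam = instantonCoeff P n := by
  simp only [instantonCoeff, nekrasov_div]

/-! ## Comparison with the affine quiver W-algebra -/

theorem p_mul_ps_inv (P : Params) : P.p * P.ps⁻¹ = P.t / P.q := by
  have := P.p_ne
  have := P.q_ne
  rw [Params.ps]
  field_simp

theorem kpBase_eq (P : Params) : P.q⁻¹⁻¹ * P.p * P.ps⁻¹ = P.t := by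
  have := P.q_ne
  rw [inv_inv, mul_assoc, p_mul_ps_inv]
  field_simp

theorem kpBox_eq (P : Params) (c : ℕ × ℕ) : kpBox P.p P.ps⁻¹ P.q⁻¹ c = qBox P c := by
  rw [kpBox, qBox, kpBase_eq, inv_pow]

theorem kpZ_eq (P : Params) (lam : YoungDiagram) : kpZ P.p P.ps⁻¹ P.q⁻¹ lam = Z P lam := by
  rw [kpZ, Z]
  refine Finset.prod_congr rfl fun c _ => ?_
  have e1 : P.q⁻¹ ^ (-arm lam c - 1) = P.q ^ (arm lam c + 1) := by
    rw [inv_zpow', neg_sub, sub_neg_eq_add, add_comm]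
  have e2 : P.q⁻¹ ^ arm lam c = P.q ^ (-arm lam c) := inv_zpow' _ _
  rw [kpBase_eq, e1, e2]
  ring

/-- With `q₁q₂ = t/q` and `μ = q⁻¹` one has `μ⁻¹q₁q₂ = t`, so the box weights are the `q^□` and the
shift at removable boxes is `q/t`. -/
theorem smul_YY_eq_kpTerm (P : Params) (N : ℤ) (u : ℂ) (lam : YoungDiagram) :
    (constC P * (frakq P N ^ lam.card * Z P lam)) • YY P lam u =
      constC P • kpTerm P (yCoeff P) P.p P.ps⁻¹ P.q⁻¹ (frakq P N) u lam := by
  have h1 : ∀ c, u / (P.p * P.ps⁻¹ * qBox P c) = P.q / P.t * u / qBox P c := by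
    intro c
    rw [p_mul_ps_inv, ← div_div, div_div_eq_mul_div]
    ring
  rw [kpTerm, kpZ_eq, mul_smul, YY]
  simp only [kpBox_eq, h1]

/-! ## The screening currents -/

theorem xPlus_eq (P : Params) (N : ℤ) (u z : ℂ) :
    xPlus P N u (P.g * z) =
      (P.γ ^ N * u / z ^ N) • nexp P (fun m => sCoeff P m * z ^ (-m)) := by
  have hg : ∀ m : ℤ, P.g ^ (3 * m) * P.g ^ (-m) = P.γ ^ m := fun m => by
    rw [← P.g_zpow_mul_self, ← zpow_add₀ P.g_ne, ← zpow_add₀ P.g_ne]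
    congr 1
    ring
  rw [xPlus, nexp_congr P (d' := fun m => sCoeff P m * z ^ (-m)) fun m hm => ?_]
  · congr 1
    rw [mul_zpow, ← hg, zpow_neg z]
    ring
  · rw [xPlusCoeff_eq P _ hm, mul_zpow, sCoeff, ← hg]
    ring

theorem xMinus_eq (P : Params) (N : ℤ) (u z : ℂ) :
    xMinus P N u (P.g * z) =
      (P.γ ^ N * u / z ^ N)⁻¹ • nexp' P (fun m => -(sCoeff P m * z ^ (-m))) := by
  have hg : ∀ m : ℤ, P.g ^ (3 * m) * P.g ^ (-m) = P.γ ^ m := fun m => by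
    rw [← P.g_zpow_mul_self, ← zpow_add₀ P.g_ne, ← zpow_add₀ P.g_ne]
    congr 1
    ring
  rw [xMinus, nexp'_congr P (d' := fun m => -(sCoeff P m * z ^ (-m))) fun m hm => ?_]
  · congr 1
    rw [mul_zpow, ← hg, div_eq_mul_inv, mul_inv, mul_inv, mul_inv, inv_inv, zpow_neg P.g N, inv_inv,
      zpow_neg P.g]
    ring
  · rw [xMinusCoeff_eq P _ hm, mul_zpow, sCoeff, ← hg]
    ring

/-! ## The Heisenberg relations -/

theorem alpha_natCast (P : Params) (k : ℕ+) : alpha P (k : ℕ) =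
    heis P (k : ℕ) • (MvPolynomial.pderiv (R := ℂ) k).toLinearMap := by
  obtain ⟨k, rfl⟩ : ∃ j : ℕ, k = j.succPNat := ⟨k.natPred, (PNat.succPNat_natPred k).symm⟩
  rfl

theorem alpha_neg_natCast (P : Params) (k : ℕ+) : alpha P (-((k : ℕ) : ℤ)) =
    LinearMap.mulLeft ℂ (MvPolynomial.X k) := by
  obtain ⟨k, rfl⟩ : ∃ j : ℕ, k = j.succPNat := ⟨k.natPred, (PNat.succPNat_natPred k).symm⟩
  rfl

/-- Oddness makes the commutator `[α_{-k}, α_k] = -[α_k, α_{-k}]` follow the same formula as for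
positive index. -/
theorem heis_neg (P : Params) {m : ℤ} (hm : m ≠ 0) : heis P (-m) = -heis P m := by
  have h1 := P.one_sub_p hm
  have h2 := P.one_sub_ps hm
  have h1' := P.one_sub_p (neg_ne_zero.mpr hm)
  have h2' := P.one_sub_ps (neg_ne_zero.mpr hm)
  have hm' : (m : ℂ) ≠ 0 := by exact_mod_cast hm
  have hq := zpow_ne_zero m P.q_ne
  have ht := zpow_ne_zero m P.t_ne
  have hp := zpow_ne_zero m P.p_ne
  have e1 : 1 - (P.q / P.t) ^ (-m) = -(P.t ^ m / P.q ^ m) * (1 - (P.q / P.t) ^ m) := by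
    rw [zpow_neg, div_zpow]
    field_simp
    ring
  have e2 : (1 - P.p ^ (-m)) / (1 - P.ps ^ (-m)) =
      (P.q ^ m / P.t ^ m) * ((1 - P.p ^ m) / (1 - P.ps ^ m)) := by
    rw [← mul_div_assoc, div_eq_div_iff h2' h2, zpow_neg, zpow_neg, P.ps_zpow]
    field_simp
    ring
  rw [heis, heis, P.kappa_neg, e1, e2]
  push_cast
  generalize (1 - P.p ^ m) / (1 - P.ps ^ m) = s
  field_simp

theorem smul_lie_smul (a b : ℂ) (A B : Module.End ℂ Fock) : ⁅a • A, b • B⁆ = (a * b) • ⁅A, B⁆ := by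
  refine LinearMap.ext fun f => ?_
  simp only [Ring.lie_def, LinearMap.sub_apply, LinearMap.smul_apply, Module.End.mul_apply,
    map_smul, smul_sub, smul_smul, mul_comm a b]

theorem neg_smul_end (a : ℂ) (A : Module.End ℂ Fock) : -(a • A) = (-a) • A := by
  refine LinearMap.ext fun f => ?_
  rw [LinearMap.neg_apply, LinearMap.smul_apply, LinearMap.smul_apply, neg_smul]

theorem lie_pderiv (k l : ℕ+) : ⁅(MvPolynomial.pderiv (R := ℂ) k).toLinearMap,
    (MvPolynomial.pderiv (R := ℂ) l).toLinearMap⁆ = (0 : Module.End ℂ Fock) := by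
  classical
  have h : ⁅MvPolynomial.pderiv (R := ℂ) k, MvPolynomial.pderiv (R := ℂ) l⁆ = 0 := by
    refine MvPolynomial.derivation_ext fun i => ?_
    simp only [Derivation.commutator_apply, MvPolynomial.pderiv_X, Derivation.coe_zero,
      Pi.zero_apply, Pi.single_apply]
    split_ifs <;> simp
  exact (Derivation.commutator_coe_linear_map
    (D1 := MvPolynomial.pderiv (R := ℂ) k) (D2 := MvPolynomial.pderiv (R := ℂ) l)).symm.trans
    (by rw [h]; rfl)

theorem lie_alpha (P : Params) {m n : ℤ} (hm : m ≠ 0) (hn : n ≠ 0) :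
    ⁅alpha P m, alpha P n⁆ = (if m + n = 0 then heis P m else 0) • 1 := by
  classical
  have hder : ∀ k l : ℕ+, ⁅(MvPolynomial.pderiv (R := ℂ) k).toLinearMap,
      LinearMap.mulLeft ℂ (MvPolynomial.X l : Fock)⁆ =
      (if (l : ℕ) = k then (1 : ℂ) else 0) • 1 := by
    intro k l
    simp only [PNat.coe_inj]
    refine LinearMap.ext fun f => ?_
    rw [Ring.lie_def, LinearMap.sub_apply, Module.End.mul_apply, Module.End.mul_apply]
    simp only [LinearMap.mulLeft_apply, Derivation.coeFn_coe, Derivation.leibniz,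
      MvPolynomial.pderiv_X, LinearMap.smul_apply, Module.End.one_apply, smul_eq_mul,
      add_sub_cancel_left, Pi.single_apply]
    split_ifs <;> simp
  obtain ⟨k, hk⟩ : ∃ k : ℕ+, (k : ℕ) = m.natAbs := ⟨⟨m.natAbs, Int.natAbs_pos.mpr hm⟩, rfl⟩
  obtain ⟨l, hl⟩ : ∃ l : ℕ+, (l : ℕ) = n.natAbs := ⟨⟨n.natAbs, Int.natAbs_pos.mpr hn⟩, rfl⟩
  have hder' : ⁅LinearMap.mulLeft ℂ (MvPolynomial.X k : Fock),
      (MvPolynomial.pderiv (R := ℂ) l).toLinearMap⁆ = -((if (k : ℕ) = l then (1 : ℂ) else 0) • 1) := by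
    rw [← hder, Ring.lie_def, Ring.lie_def, neg_sub]
  rcases m.natAbs_eq with h1 | h1 <;> rcases n.natAbs_eq with h2 | h2 <;> rw [← hk] at h1 <;>
    rw [← hl] at h2 <;> subst h1 <;> subst h2
  · rw [if_neg (by have := k.pos; omega), zero_smul, alpha_natCast, alpha_natCast, smul_lie_smul,
      lie_pderiv, smul_zero]
  · rw [alpha_natCast, alpha_neg_natCast, ← one_smul ℂ (LinearMap.mulLeft ℂ _), smul_lie_smul, hder,
      smul_smul, mul_one]
    congr 1
    by_cases h : (l : ℕ) = k
    · rw [if_pos h, if_pos (by omega), mul_one]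
    · rw [if_neg h, if_neg (by omega), mul_zero]
  · rw [alpha_natCast, alpha_neg_natCast, ← one_smul ℂ (LinearMap.mulLeft ℂ _), smul_lie_smul,
      hder', neg_smul_end, smul_smul, one_mul]
    congr 1
    by_cases h : (k : ℕ) = l
    · rw [if_pos h, if_pos (by omega), h, heis_neg P (by simp)]
      ring
    · rw [if_neg h, if_neg (by omega), neg_zero, mul_zero]
  · rw [if_neg (by have := k.pos; omega), zero_smul, alpha_neg_natCast, alpha_neg_natCast,
      Ring.lie_def]
    refine LinearMap.ext fun f => ?_
    simp only [LinearMap.sub_apply, Module.End.mul_apply, LinearMap.mulLeft_apply,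
      LinearMap.zero_apply]
    ring

theorem lie_smul_alpha (P : Params) (a b : ℤ → ℂ) {m n : ℤ} (hm : m ≠ 0) (hn : n ≠ 0) :
    ⁅a m • alpha P m, b n • alpha P n⁆ =
      (if m + n = 0 then a m * b (-m) * heis P m else 0) • 1 := by
  rw [smul_lie_smul, lie_alpha P hm hn, smul_smul]
  congr 1
  split_ifs with h
  · rw [eq_neg_of_add_eq_zero_right h]
  · rw [mul_zero]

/-- The parameters which occur in the Heisenberg relations. -/
theorem heisenberg_data (P : Params) {m : ℤ} (hm : m ≠ 0) :
    P.p ^ m = P.ps ^ m * (P.t / P.q) ^ m ∧ P.p ^ m ≠ 0 ∧ P.ps ^ m ≠ 0 ∧ (P.t / P.q) ^ m ≠ 0 ∧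
      1 - P.p ^ m ≠ 0 ∧ 1 - P.ps ^ m ≠ 0 ∧ 1 - (P.t / P.q) ^ m ≠ 0 ∧ P.γ ^ m ≠ 0 ∧ (m : ℂ) ≠ 0 := by
  refine ⟨?_, zpow_ne_zero _ P.p_ne, zpow_ne_zero _ P.ps_ne, zpow_ne_zero _ P.tq_ne,
    P.one_sub_p hm, P.one_sub_ps hm, P.one_sub_tq hm, zpow_ne_zero _ P.γ_ne, by exact_mod_cast hm⟩
  rw [← mul_zpow]
  congr 1
  have := P.t_ne
  have := P.q_ne
  rw [Params.ps]
  field_simp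

theorem heis_eq (P : Params) {m : ℤ} :
    heis P m = -(P.kappa m / m) * (1 - ((P.t / P.q) ^ m)⁻¹) * ((1 - P.p ^ m) / (1 - P.ps ^ m)) := by
  rw [heis, ← inv_zpow, inv_div]

theorem one_sub_inv_eq {z : ℂ} (hz : z ≠ 0) : 1 - z⁻¹ = -(1 - z) / z := by
  field_simp
  ring

theorem sCoeff_mul_sCoeff_mul_heis (P : Params) {m : ℤ} (hm : m ≠ 0) :
    sCoeff P m * sCoeff P (-m) * heis P m =
      -(1 / (m : ℂ)) * ((1 - P.p ^ m) / (1 - P.ps ^ m)) * (1 - P.q ^ m) * (1 - P.t ^ (-m)) := by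
  obtain ⟨-, -, -, h2, -, -, h3, h4, h5⟩ := heisenberg_data P hm
  rw [heis_eq, sCoeff, sCoeff, Params.kappa, zpow_neg P.γ, zpow_neg (P.t / P.q), one_sub_inv_eq h2]
  generalize (1 - P.p ^ m) / (1 - P.ps ^ m) = s
  generalize 1 - P.t ^ (-m) = s'
  generalize 1 - P.q ^ m = s''
  generalize 1 - (P.t / P.q) ^ m = s3 at *
  generalize (P.t / P.q) ^ m = s4 at *
  field_simp

theorem sCoeff_rho_mul (P : Params) {m : ℤ} (hm : m ≠ 0) :
    sCoeff P m * rho P m * (sCoeff P (-m) * rho P (-m)) * heis P m =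
      -(1 / (m : ℂ)) * ((1 - P.ps ^ (-m)) / (1 - P.p ^ (-m))) * (1 - P.q ^ m) *
          (1 - P.t ^ (-m)) := by
  obtain ⟨h1, h1', h1'', h2, h6, h7, h3, h4, h5⟩ := heisenberg_data P hm
  have e := rho_mul_rho_mul_heis P hm
  rw [show sCoeff P m * rho P m * (sCoeff P (-m) * rho P (-m)) * heis P m =
    sCoeff P m * sCoeff P (-m) * (rho P (-m) * (rho P m * heis P m)) by ring, e, sCoeff, sCoeff,
    Params.kappa, zpow_neg P.γ, zpow_neg (P.t / P.q), zpow_neg P.ps, zpow_neg P.p,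
    one_sub_inv_eq h2, one_sub_inv_eq h1', one_sub_inv_eq h1'']
  generalize 1 - P.t ^ (-m) = s'
  generalize 1 - P.q ^ m = s''
  generalize 1 - (P.t / P.q) ^ m = s3 at *
  generalize (P.t / P.q) ^ m = s4 at *
  generalize 1 - P.p ^ m = s5 at *
  generalize 1 - P.ps ^ m = s6 at *
  rw [h1] at h1' ⊢
  field_simp

theorem yCoeff_rho_mul (P : Params) {m : ℤ} (hm : m ≠ 0) :
    yCoeff P m * rho P m * (yCoeff P (-m) * rho P (-m)) * heis P m = -(1 / (m : ℂ)) *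
      ((1 - P.p ^ m) * (1 - P.ps ^ (-m)) / ((1 - P.q ^ (-m)) * (1 - P.t ^ m))) := by
  obtain ⟨h1, h1', h1'', h2, h6, h7, h3, h4, h5⟩ := heisenberg_data P hm
  have e := rho_mul_rho_mul_heis P hm
  have hq := P.one_sub_q hm
  have ht := P.one_sub_t hm
  have hq' := zpow_ne_zero m P.q_ne
  have ht' := zpow_ne_zero m P.t_ne
  have hk : P.kappa m = (1 - P.q ^ m) * (-(1 - P.t ^ m) / P.t ^ m) * (1 - (P.t / P.q) ^ m) := by
    rw [Params.kappa, zpow_neg, one_sub_inv_eq ht']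
  have hx : (P.t / P.q) ^ m = P.t ^ m / P.q ^ m := div_zpow _ _ _
  rw [show yCoeff P m * rho P m * (yCoeff P (-m) * rho P (-m)) * heis P m =
    yCoeff P m * yCoeff P (-m) * (rho P (-m) * (rho P m * heis P m)) by ring, e, yCoeff, yCoeff,
    P.kappa_neg, hk, neg_neg, zpow_neg P.γ, zpow_neg P.ps, zpow_neg P.p, zpow_neg P.q,
    one_sub_inv_eq h1', one_sub_inv_eq h1'', one_sub_inv_eq hq']
  generalize 1 - P.p ^ m = s5 at *
  generalize 1 - P.ps ^ m = s6 at *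
  generalize 1 - P.t ^ m = s' at *
  generalize 1 - P.q ^ m = s'' at *
  rw [h1]
  generalize 1 - (P.t / P.q) ^ m = s3 at *
  rw [hx]
  field_simp

theorem yCoeff_rho_mul_sCoeff (P : Params) {m : ℤ} (hm : m ≠ 0) :
    yCoeff P m * rho P m * (P.γ ^ (-(-m)) * sCoeff P (-m)) * heis P m =
      -(1 / (m : ℂ)) * (1 - P.p ^ m) := by
  obtain ⟨-, -, -, h2, h6, h7, h3, h4, h5⟩ := heisenberg_data P hm
  have hk := P.kappa_ne hm
  rw [heis_eq, yCoeff, rho, sCoeff, neg_neg, zpow_neg P.γ, zpow_neg (P.t / P.q), one_sub_inv_eq h2]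
  generalize P.kappa m = k at *
  generalize 1 - P.p ^ m = s5 at *
  generalize 1 - P.ps ^ m = s6 at *
  generalize 1 - (P.t / P.q) ^ m = s3 at *
  generalize (P.t / P.q) ^ m = s4 at *
  field_simp

theorem yCoeff_rho_mul_sCoeff_rho (P : Params) {m : ℤ} (hm : m ≠ 0) :
    yCoeff P m * rho P m * (-(P.ps ^ (-m) * (sCoeff P (-m) * rho P (-m)))) * heis P m =
      -(1 / (m : ℂ)) * (1 - P.ps⁻¹ ^ m) := by
  obtain ⟨-, h1', h1'', h2, h6, h7, h3, h4, h5⟩ := heisenberg_data P hm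
  have hk := P.kappa_ne hm
  have e := rho_mul_rho_mul_heis P hm
  have hg : P.γ ^ m * P.γ ^ m = (P.t / P.q) ^ m := by rw [P.γ_zpow_mul_self, div_zpow]
  rw [show yCoeff P m * rho P m * (-(P.ps ^ (-m) * (sCoeff P (-m) * rho P (-m)))) * heis P m =
    -(yCoeff P m * P.ps ^ (-m) * sCoeff P (-m) * (rho P (-m) * (rho P m * heis P m))) by ring, e,
    yCoeff, sCoeff, zpow_neg P.γ, zpow_neg (P.t / P.q), zpow_neg P.ps, inv_zpow,
    one_sub_inv_eq h2, one_sub_inv_eq h1'']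
  generalize P.kappa m = k at *
  generalize 1 - P.p ^ m = s5 at *
  generalize 1 - P.ps ^ m = s6 at *
  generalize 1 - (P.t / P.q) ^ m = s3 at *
  rw [← hg]
  field_simp

/-- With `μ = q⁻¹` the four terms are `1 + (q/t)^n - q^n - t^{-n}`, which factors. Only the product
`q₁q₂` enters, so both screening currents share the same Cartan matrix. -/
theorem kpCartan_eq (P : Params) {q₁ q₂ : ℂ} (h : q₁ * q₂ = P.t / P.q) (n : ℤ) :
    kpCartan q₁ q₂ P.q⁻¹ n = (1 - P.q ^ n) * (1 - P.t ^ (-n)) := by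
  have hq := zpow_ne_zero n P.q_ne
  have ht := zpow_ne_zero n P.t_ne
  rw [kpCartan, h, inv_zpow, inv_zpow, zpow_neg, zpow_neg, zpow_neg, div_zpow]
  field_simp
  ring

theorem yOsc_eq (P : Params) (m : ℤ) : yOsc P m = (yCoeff P m * rho P m) • alpha P m := by
  rw [yOsc, alphaPrime, smul_smul]

theorem sMinus_eq (P : Params) (m : ℤ) : sMinus P m = (sCoeff P m * rho P m) • alpha P m := by
  rw [sMinus, alphaPrime, smul_smul]

theorem lie_sPlus (P : Params) {m n : ℤ} (hm : m ≠ 0) (hn : n ≠ 0) :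
    ⁅sPlus P m, sPlus P n⁆ = (if m + n = 0 then
      -(1 / (m : ℂ)) * ((1 - P.p ^ m) / (1 - P.ps ^ m)) * (1 - P.q ^ m) * (1 - P.t ^ (-m))
      else 0) • 1 := by
  rw [sPlus, sPlus, lie_smul_alpha P (sCoeff P) (sCoeff P) hm hn, sCoeff_mul_sCoeff_mul_heis P hm]

theorem lie_sMinus (P : Params) {m n : ℤ} (hm : m ≠ 0) (hn : n ≠ 0) :
    ⁅sMinus P m, sMinus P n⁆ = (if m + n = 0 then
      -(1 / (m : ℂ)) * ((1 - P.ps ^ (-m)) / (1 - P.p ^ (-m))) * (1 - P.q ^ m) *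
          (1 - P.t ^ (-m)) else 0) • 1 := by
  rw [sMinus_eq, sMinus_eq, lie_smul_alpha P (fun m => sCoeff P m * rho P m)
    (fun m => sCoeff P m * rho P m) hm hn]
  simp only [sCoeff_rho_mul P hm]

theorem lie_yOsc (P : Params) {m n : ℤ} (hm : m ≠ 0) (hn : n ≠ 0) :
    ⁅yOsc P m, yOsc P n⁆ = (if m + n = 0 then -(1 / (m : ℂ)) *
      ((1 - P.p ^ m) * (1 - P.ps ^ (-m)) / ((1 - P.q ^ (-m)) * (1 - P.t ^ m))) else 0) • 1 := by
  rw [yOsc_eq, yOsc_eq, lie_smul_alpha P (fun m => yCoeff P m * rho P m)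
    (fun m => yCoeff P m * rho P m) hm hn]
  simp only [yCoeff_rho_mul P hm]

theorem isKPHeisenberg_sPlus (P : Params) :
    IsKPHeisenberg P.p P.ps⁻¹ P.q⁻¹ (yOsc P) fun m => P.γ ^ (-m) • sPlus P m := by
  intro m n hm hn
  have hc := kpCartan_eq P (p_mul_ps_inv P)
  refine ⟨?_, ?_, ?_⟩
  · rw [lie_yOsc P hm hn, hc, neg_neg, inv_zpow, zpow_neg P.ps]
  · rw [yOsc_eq]
    simp only [sPlus, smul_smul]
    rw [lie_smul_alpha P (fun m => yCoeff P m * rho P m) (fun m => P.γ ^ (-m) * sCoeff P m) hm hn]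
    simp only [yCoeff_rho_mul_sCoeff P hm]
  · rw [smul_lie_smul, lie_sPlus P hm hn, smul_smul, hc, inv_zpow, zpow_neg P.ps, inv_inv]
    congr 1
    split_ifs with h
    · rw [eq_neg_of_add_eq_zero_right h, neg_neg, ← zpow_add₀ P.γ_ne, neg_add_cancel, zpow_zero]
      ring
    · rw [mul_zero]

/-- Exchanging `q₁` and `q₂` leaves the relation of the `y_m` unchanged. The factor `-p^{*m}` is
fixed by the required commutator with `y_m`, and it cancels in `[s_m, s_{-m}]`. -/
theorem isKPHeisenberg_sMinus (P : Params) :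
    IsKPHeisenberg P.ps⁻¹ P.p P.q⁻¹ (yOsc P) fun m => -(P.ps ^ m • sMinus P m) := by
  intro m n hm hn
  have hc := kpCartan_eq P ((mul_comm _ _).trans (p_mul_ps_inv P))
  refine ⟨?_, ?_, ?_⟩
  · rw [lie_yOsc P hm hn, hc, neg_neg, inv_zpow, zpow_neg P.ps, mul_comm (1 - P.p ^ m)]
  · rw [yOsc_eq]
    simp only [sMinus_eq, smul_smul, ← neg_smul]
    rw [lie_smul_alpha P (fun m => yCoeff P m * rho P m)
      (fun m => -(P.ps ^ m * (sCoeff P m * rho P m))) hm hn]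
    simp only [yCoeff_rho_mul_sCoeff_rho P hm]
  · dsimp only
    rw [neg_smul_end, neg_smul_end, smul_lie_smul, lie_sMinus P hm hn, smul_smul, hc, inv_zpow, zpow_neg P.ps]
    congr 1
    split_ifs with h
    · rw [eq_neg_of_add_eq_zero_right h, neg_mul_neg, ← zpow_add₀ P.ps_ne, add_neg_cancel,
        zpow_zero]
      ring
    · rw [mul_zero]

/-! ## Homogeneous homomorphisms from a monomial ideal to its quotient ring -/

/-- The boxes `b` outside of `λ` for which `b + w` belongs to `λ`. -/
def IsShiftBox (lam : YoungDiagram) (w : ℤ × ℤ) (b : ℕ × ℕ) : Prop :=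
  b ∉ lam ∧ ∃ a ∈ lam, (a.1 : ℤ) = b.1 + w.1 ∧ (a.2 : ℤ) = b.2 + w.2

/-- The coefficients of the homomorphisms of degree `w` from the monomial ideal of `λ` to its quotient
ring. -/
def shiftSpace (lam : YoungDiagram) (w : ℤ × ℤ) : Submodule ℂ (ℕ × ℕ → ℂ) where
  carrier := {F | (∀ b, ¬ IsShiftBox lam w b → F b = 0) ∧
    (∀ i j, (i, j) ∉ lam → IsShiftBox lam w (i + 1, j) → F (i + 1, j) = F (i, j)) ∧
    (∀ i j, (i, j) ∉ lam → IsShiftBox lam w (i, j + 1) → F (i, j + 1) = F (i, j))}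
  zero_mem' := by simp
  add_mem' := by
    rintro F G ⟨h1, h2, h3⟩ ⟨k1, k2, k3⟩
    refine ⟨fun b hb => ?_, fun i j hn hs => ?_, fun i j hn hs => ?_⟩
    · rw [Pi.add_apply, h1 b hb, k1 b hb, add_zero]
    · rw [Pi.add_apply, Pi.add_apply, h2 i j hn hs, k2 i j hn hs]
    · rw [Pi.add_apply, Pi.add_apply, h3 i j hn hs, k3 i j hn hs]
  smul_mem' := by
    rintro a F ⟨h1, h2, h3⟩
    refine ⟨fun b hb => ?_, fun i j hn hs => ?_, fun i j hn hs => ?_⟩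
    · rw [Pi.smul_apply, h1 b hb, smul_zero]
    · rw [Pi.smul_apply, Pi.smul_apply, h2 i j hn hs]
    · rw [Pi.smul_apply, Pi.smul_apply, h3 i j hn hs]

theorem shiftSpace_eq_bot_of_nonneg (lam : YoungDiagram) {w : ℤ × ℤ} (h1 : 0 ≤ w.1)
    (h2 : 0 ≤ w.2) : shiftSpace lam w = ⊥ := by
  refine (Submodule.eq_bot_iff _).mpr fun F hF => funext fun b => hF.1 b ?_
  rintro ⟨hb, a, ha, e1, e2⟩
  exact hb (lam.isLowerSet (Prod.mk_le_mk.mpr ⟨by omega, by omega⟩ : b ≤ a) ha)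

/-- Every chain of neighbours can be followed to a box where the function must vanish: first to the
right, until the row above is outside `λ`, then one row up. No box of row `0` can be shifted into
`λ`, so an induction on the row applies. -/
theorem shiftSpace_eq_bot_of_neg (lam : YoungDiagram) {w : ℤ × ℤ} (h1 : w.1 < 0)
    (h2 : w.2 < 0) : shiftSpace lam w = ⊥ := by
  refine (Submodule.eq_bot_iff _).mpr fun F hF => ?_
  obtain ⟨hF1, hF2, hF3⟩ := hF
  suffices h : ∀ i j, F (i, j) = 0 from funext fun b => h b.1 b.2
  intro i
  induction i with
  | zero =>
    intro j
    refine hF1 _ ?_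
    rintro ⟨-, a, -, e1, -⟩
    simp only at e1
    omega
  | succ i ih =>
    have hbig : ∀ j, lam.rowLen i ≤ j → F (i + 1, j) = 0 := fun j hj => by
      by_cases hs : IsShiftBox lam w (i + 1, j)
      · rw [hF2 i j (by rw [YoungDiagram.mem_iff_lt_rowLen]; omega) hs, ih]
      · exact hF1 _ hs
    intro j
    rcases le_total (lam.rowLen i) j with hj | hj
    · exact hbig j hj
    -- The box `(i + 1, j + 1)` is again a shift box: both shifts are negative, so its image is at
    -- most `(i, j)`, which belongs to `λ`.
    · induction hj using Nat.decreasingInduction with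
      | self => exact hbig _ le_rfl
      | of_succ j hj ih' =>
        by_cases hs : IsShiftBox lam w (i + 1, j)
        · rw [← hF3 (i + 1) j hs.1, ih']
          obtain ⟨hn, a, ha, e1, e2⟩ := hs
          refine ⟨fun h => hn (lam.isLowerSet (Prod.mk_le_mk.mpr ⟨le_rfl, Nat.le_succ j⟩) h),
            (a.1, a.2 + 1), ?_, e1, ?_⟩
          · have : (i, j) ∈ lam := by rw [YoungDiagram.mem_iff_lt_rowLen]; exact hj
            simp only at e1 e2
            exact lam.isLowerSet (Prod.mk_le_mk.mpr ⟨by omega, by omega⟩) this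
          · push_cast at e2 ⊢
            omega
        · exact hF1 _ hs

/-- In each row the shift boxes form one interval, so a function in `shiftSpace` has one value per
row. -/
theorem isShiftBox_iff (lam : YoungDiagram) (e d i j : ℕ) :
    IsShiftBox lam (e, -(d : ℤ)) (i, j) ↔
      lam.rowLen i ≤ j ∧ d ≤ j ∧ j < lam.rowLen (i + e) + d := by
  rw [IsShiftBox, YoungDiagram.mem_iff_lt_rowLen, not_lt]
  constructor
  · rintro ⟨h1, a, ha, e1, e2⟩
    simp only at e1 e2
    rw [YoungDiagram.mem_iff_lt_rowLen, show a.1 = i + e by omega] at ha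
    exact ⟨h1, by omega, by omega⟩
  · rintro ⟨h1, h2, h3⟩
    refine ⟨h1, (i + e, j - d), ?_, by push_cast; rfl, by push_cast [h2]; ring⟩
    rw [YoungDiagram.mem_iff_lt_rowLen]
    omega

/-- The boxes with leg length `e` and arm length `d - 1`. -/
def hookBoxes (lam : YoungDiagram) (e d : ℤ) : Finset (ℕ × ℕ) :=
  lam.cells.filter fun c => leg lam c = e ∧ arm lam c + 1 = d

theorem mem_hookBoxes_iff (lam : YoungDiagram) {e d : ℕ} (_ : 0 < d) (c : ℕ × ℕ) :
    c ∈ hookBoxes lam e d ↔ lam.rowLen c.1 = c.2 + d ∧ lam.rowLen (c.1 + 1 + e) ≤ c.2 ∧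
      c.2 < lam.rowLen (c.1 + e) := by
  have h1 : ∀ i, c.2 < lam.rowLen i ↔ i < lam.colLen c.2 := fun i => by
    rw [← YoungDiagram.mem_iff_lt_rowLen, ← YoungDiagram.mem_iff_lt_colLen]
  rw [hookBoxes, Finset.mem_filter, mem_cells_iff, ← not_lt, h1, h1, h1, arm, leg]
  have h2 := h1 c.1
  omega

/-- The rows `i ≤ k` which are linked with the row `k`. -/
def IsLinkedRow (lam : YoungDiagram) (e d k i : ℕ) : Prop :=
  i ≤ k ∧ ∀ i', i ≤ i' → i' < k → lam.rowLen i' < lam.rowLen (i' + 1 + e) + d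

theorem isLinkedRow_iff_succ {lam : YoungDiagram} {e d k i : ℕ}
    (hk : lam.rowLen (k + 1 + e) + d ≤ lam.rowLen k)
    (hi : lam.rowLen i < lam.rowLen (i + 1 + e) + d) :
    IsLinkedRow lam e d k (i + 1) ↔ IsLinkedRow lam e d k i := by
  constructor
  · rintro ⟨h1, h2⟩
    refine ⟨by omega, fun i' h3 h4 => ?_⟩
    rcases h3.eq_or_lt with rfl | h3
    · exact hi
    · exact h2 i' h3 h4
  · rintro ⟨h1, h2⟩
    refine ⟨?_, fun i' h3 h4 => h2 i' (by omega) h4⟩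
    rcases h1.eq_or_lt with rfl | h1
    · omega
    · exact h1

-- The indicator function of one connected chain of rows ending at row `k`. The hypothesis says that
-- the chain is broken between the rows `k` and `k + 1`, so extending by zero below `k` violates no
-- relation.
open Classical in
theorem linkedRow_mem_shiftSpace (lam : YoungDiagram) {e d k : ℕ}
    (hk : lam.rowLen (k + 1 + e) + d ≤ lam.rowLen k) :
    (fun b : ℕ × ℕ => if IsShiftBox lam (e, -(d : ℤ)) b ∧ IsLinkedRow lam e d k b.1 then (1 : ℂ)
      else 0) ∈ shiftSpace lam (e, -(d : ℤ)) := by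
  have hanti : ∀ {i i' : ℕ}, i ≤ i' → lam.rowLen i' ≤ lam.rowLen i := fun h => lam.rowLen_anti _ _ h
  refine ⟨fun b hb => if_neg fun h => hb h.1, fun i j hn hs => ?_, fun i j hn hs => ?_⟩
  · have h1 := (isShiftBox_iff lam e d (i + 1) j).mp hs
    rw [YoungDiagram.mem_iff_lt_rowLen, not_lt] at hn
    have h2 : IsShiftBox lam (e, -(d : ℤ)) (i, j) := by
      rw [isShiftBox_iff]
      have := hanti (show i + e ≤ i + 1 + e by omega)
      omega
    simp only [hs, h2, true_and, isLinkedRow_iff_succ hk (show lam.rowLen i < _ by omega)]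
  · have h1 := (isShiftBox_iff lam e d i (j + 1)).mp hs
    rw [YoungDiagram.mem_iff_lt_rowLen, not_lt] at hn
    simp only [hs, true_and]
    refine if_congr ⟨fun h => ⟨?_, h⟩, fun h => h.2⟩ rfl rfl
    have := hanti h.1
    rw [isShiftBox_iff]
    omega

/-- A function is determined by its value in each row, read off at the first box `(i, λ_i)` outside
`λ`. Adjacent rows `i` and `i + 1` are linked when `λ_i < λ_{i+1+e} + d`, and rows without a shift
box at `(i, λ_i)` carry the value zero. The free values therefore sit at the rows where the link
downwards is broken, and there `(i, λ_i - d)` is a box of leg `e` and arm `d - 1`. -/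
theorem finrank_shiftSpace_aux (lam : YoungDiagram) (e : ℕ) {d : ℕ} (hd : 0 < d) :
    Module.finrank ℂ (shiftSpace lam (e, -(d : ℤ))) = (hookBoxes lam e d).card := by
  classical
  let ev : shiftSpace lam (e, -(d : ℤ)) →ₗ[ℂ] (hookBoxes lam e d → ℂ) :=
    { toFun := fun F c => F.1 (c.1.1, lam.rowLen c.1.1)
      map_add' := fun _ _ => rfl
      map_smul' := fun _ _ => rfl }
  have hinj : Function.Injective ev := by
    rw [injective_iff_map_eq_zero]
    rintro ⟨F, hF1, hF2, hF3⟩ h0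
    have h0' : ∀ c ∈ hookBoxes lam e d, F (c.1, lam.rowLen c.1) = 0 := fun c hc =>
      congrFun h0 ⟨c, hc⟩
    have hrow : ∀ i, F (i, lam.rowLen i) = 0 → ∀ j, F (i, j) = 0 := by
      intro i hi j
      by_cases hs : IsShiftBox lam (e, -(d : ℤ)) (i, j)
      · have h1 := ((isShiftBox_iff lam e d i j).mp hs).1
        induction j, h1 using Nat.le_induction with
        | base => exact hi
        | succ j hj ih =>
          rw [hF3 i j (by rw [YoungDiagram.mem_iff_lt_rowLen]; omega) hs]
          by_cases hs' : IsShiftBox lam (e, -(d : ℤ)) (i, j)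
          · exact ih hs'
          · exact hF1 _ hs'
      · exact hF1 _ hs
    have hlarge : ∀ i, lam.colLen 0 ≤ i → F (i, lam.rowLen i) = 0 := by
      intro i hi
      refine hF1 _ fun hs => ?_
      have h1 := (isShiftBox_iff lam e d i _).mp hs
      have h2 : lam.rowLen i = 0 := by
        by_contra h
        exact absurd (lt_colLen_zero_iff.mpr (Nat.pos_of_ne_zero h)) (not_lt.mpr hi)
      omega
    have hall : ∀ i, F (i, lam.rowLen i) = 0 := by
      intro i
      rcases le_total (lam.colLen 0) i with hi | hi
      · exact hlarge i hi
      · induction hi using Nat.decreasingInduction with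
        | self => exact hlarge _ le_rfl
        | of_succ i hi ih =>
          by_cases hs : IsShiftBox lam (e, -(d : ℤ)) (i, lam.rowLen i)
          · have h1 := (isShiftBox_iff lam e d i _).mp hs
            -- Either row `i` is linked to row `i + 1`, whose value is already zero, or the link is
            -- broken and the row belongs to a hook box, where the value vanishes by assumption.
            by_cases hl : lam.rowLen i < lam.rowLen (i + 1 + e) + d
            · rw [← hF2 i _ (by rw [YoungDiagram.mem_iff_lt_rowLen]; omega) ?_, hrow _ ih]
              rw [isShiftBox_iff]
              have := lam.rowLen_anti i (i + 1) (Nat.le_succ i)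
              omega
            · refine h0' (i, lam.rowLen i - d) ((mem_hookBoxes_iff lam hd _).mpr ?_)
              simp only
              omega
          · exact hF1 _ hs
    exact Subtype.ext (funext fun b => hrow _ (hall b.1) b.2)
  have hsurj : Function.Surjective ev := by
    intro g
    have hE : ∀ c ∈ hookBoxes lam e d, lam.rowLen (c.1 + 1 + e) + d ≤ lam.rowLen c.1 ∧
        lam.rowLen c.1 < lam.rowLen (c.1 + e) + d ∧ d ≤ lam.rowLen c.1 := fun c hc => by
      have := (mem_hookBoxes_iff lam hd c).mp hc
      omega
    -- The chain indicators are dual to the evaluations: a chain ending at row `k` cannot pass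
    -- through another hook row, since the link below that row is broken.
    refine ⟨∑ k, g k • ⟨_, linkedRow_mem_shiftSpace lam (hE k.1 k.2).1⟩, funext fun c => ?_⟩
    rw [map_sum, Finset.sum_apply, Finset.sum_eq_single c]
    · rw [map_smul, Pi.smul_apply, smul_eq_mul]
      have h1 : IsShiftBox lam (e, -(d : ℤ)) (c.1.1, lam.rowLen c.1.1) := by
        rw [isShiftBox_iff]
        have := hE c.1 c.2
        omega
      have h2 : IsLinkedRow lam e d c.1.1 c.1.1 := ⟨le_rfl, fun i' _ _ => by omega⟩
      change g c * (if _ then (1 : ℂ) else 0) = g c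
      rw [if_pos ⟨h1, h2⟩, mul_one]
    · intro k _ hkc
      rw [map_smul, Pi.smul_apply, smul_eq_mul]
      change g k * (if _ then (1 : ℂ) else 0) = 0
      rw [if_neg, mul_zero]
      rintro ⟨-, h1, h2⟩
      apply hkc
      have h3 : c.1.1 = k.1.1 := by
        by_contra hne
        have := h2 c.1.1 le_rfl (by omega)
        have := (hE c.1 c.2).1
        simp only at *
        omega
      have h4 := ((mem_hookBoxes_iff lam hd c.1).mp c.2).1
      have h5 := ((mem_hookBoxes_iff lam hd k.1).mp k.2).1
      rw [h3] at h4
      exact Subtype.ext (Prod.ext h3.symm (by omega))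
    · simp
  rw [(LinearEquiv.ofBijective ev ⟨hinj, hsurj⟩).finrank_eq, Module.finrank_fintype_fun_eq_card,
    Fintype.card_coe]

theorem isShiftBox_transpose (lam : YoungDiagram) (w : ℤ × ℤ) (b : ℕ × ℕ) :
    IsShiftBox lam.transpose w.swap b.swap ↔ IsShiftBox lam w b := by
  simp only [IsShiftBox, YoungDiagram.mem_transpose, Prod.swap_swap, Prod.fst_swap, Prod.snd_swap]
  refine and_congr_right fun _ => ⟨?_, ?_⟩
  · rintro ⟨a, ha, h1, h2⟩
    exact ⟨a.swap, ha, h2, h1⟩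
  · rintro ⟨a, ha, h1, h2⟩
    exact ⟨a.swap, by rwa [Prod.swap_swap], h2, h1⟩

theorem comp_swap_mem_shiftSpace {lam : YoungDiagram} {w : ℤ × ℤ} {F : ℕ × ℕ → ℂ}
    (hF : F ∈ shiftSpace lam w) : F ∘ Prod.swap ∈ shiftSpace lam.transpose w.swap := by
  obtain ⟨h1, h2, h3⟩ := hF
  refine ⟨fun b hb => h1 _ fun h => hb ?_, fun i j hn hs => h3 j i ?_ ?_,
    fun i j hn hs => h2 j i ?_ ?_⟩
  · rw [← isShiftBox_transpose, Prod.swap_swap] at h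
    exact h
  · simpa using hn
  · rw [← isShiftBox_transpose]
    exact hs
  · simpa using hn
  · rw [← isShiftBox_transpose]
    exact hs

theorem finrank_shiftSpace_transpose (lam : YoungDiagram) (w : ℤ × ℤ) :
    Module.finrank ℂ (shiftSpace lam.transpose w.swap) = Module.finrank ℂ (shiftSpace lam w) := by
  refine LinearEquiv.finrank_eq
    { toFun := fun F => ⟨F.1 ∘ Prod.swap, ?_⟩
      invFun := fun F => ⟨F.1 ∘ Prod.swap, comp_swap_mem_shiftSpace F.2⟩
      map_add' := fun _ _ => rfl
      map_smul' := fun _ _ => rfl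
      left_inv := fun _ => rfl
      right_inv := fun _ => rfl }
  have := comp_swap_mem_shiftSpace F.2
  rwa [YoungDiagram.transpose_transpose, Prod.swap_swap] at this

theorem card_hookBoxes_transpose (lam : YoungDiagram) (e d : ℤ) :
    (hookBoxes lam.transpose e d).card =
      (lam.cells.filter fun c => arm lam c = e ∧ leg lam c + 1 = d).card := by
  refine Finset.card_bij (fun c _ => c.swap) ?_ (fun _ _ _ _ h => Prod.swap_injective h) ?_
  · intro c hc
    rw [hookBoxes, Finset.mem_filter, leg_transpose, arm_transpose, YoungDiagram.mem_cells,
      YoungDiagram.mem_transpose] at hc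
    exact Finset.mem_filter.mpr hc
  · intro c hc
    refine ⟨c.swap, ?_, Prod.swap_swap c⟩
    rw [hookBoxes, Finset.mem_filter, leg_transpose, arm_transpose, YoungDiagram.mem_cells,
      YoungDiagram.mem_transpose, Prod.swap_swap]
    exact Finset.mem_filter.mp hc

/-- The sign quadrants of `w` are treated separately. For both components negative or both
nonnegative nothing occurs on either side; the two mixed quadrants correspond to the two families of
weights and are exchanged by transposition. -/
theorem finrank_shiftSpace (lam : YoungDiagram) (w : ℤ × ℤ) :
    Module.finrank ℂ (shiftSpace lam w) =
      (lam.cells.filter fun c => (leg lam c, -arm lam c - 1) = w).card +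
      (lam.cells.filter fun c => (-leg lam c - 1, arm lam c) = w).card := by
  have h1 : (lam.cells.filter fun c => (leg lam c, -arm lam c - 1) = w) =
      hookBoxes lam w.1 (-w.2) := by
    refine Finset.filter_congr fun c _ => ?_
    rw [Prod.ext_iff]
    simp only
    omega
  have h2 : (lam.cells.filter fun c => (-leg lam c - 1, arm lam c) = w) =
      lam.cells.filter fun c => arm lam c = w.2 ∧ leg lam c + 1 = -w.1 := by
    refine Finset.filter_congr fun c _ => ?_
    rw [Prod.ext_iff]
    simp only
    omega
  rw [h1, h2]
  have e1 : w.1 < 0 ∨ 0 ≤ w.2 → (hookBoxes lam w.1 (-w.2)).card = 0 := fun h => by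
    rw [Finset.card_eq_zero, hookBoxes, Finset.filter_eq_empty_iff]
    intro c hc
    have := arm_nonneg hc
    have := leg_nonneg hc
    omega
  have e2 : w.2 < 0 ∨ 0 ≤ w.1 →
      (lam.cells.filter fun c => arm lam c = w.2 ∧ leg lam c + 1 = -w.1).card = 0 := fun h => by
    rw [Finset.card_eq_zero, Finset.filter_eq_empty_iff]
    intro c hc
    have := arm_nonneg hc
    have := leg_nonneg hc
    omega
  obtain ⟨w1, w2⟩ := w
  simp only at e1 e2 ⊢
  rcases lt_or_ge w1 0 with k1 | k1 <;> rcases lt_or_ge w2 0 with k2 | k2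
  · rw [e1 (Or.inl k1), e2 (Or.inl k2), shiftSpace_eq_bot_of_neg lam k1 k2, finrank_bot]
  · obtain ⟨e, rfl⟩ := Int.eq_ofNat_of_zero_le k2
    obtain ⟨d, hd⟩ := Int.eq_ofNat_of_zero_le (show 0 ≤ -w1 by omega)
    obtain rfl : w1 = -(d : ℤ) := by omega
    rw [e1 (Or.inl k1), zero_add, ← finrank_shiftSpace_transpose, ← card_hookBoxes_transpose,
      neg_neg]
    exact finrank_shiftSpace_aux _ e (by omega)
  · obtain ⟨e, rfl⟩ := Int.eq_ofNat_of_zero_le k1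
    obtain ⟨d, hd⟩ := Int.eq_ofNat_of_zero_le (show 0 ≤ -w2 by omega)
    obtain rfl : w2 = -(d : ℤ) := by omega
    rw [e2 (Or.inr k1), add_zero, neg_neg]
    exact finrank_shiftSpace_aux _ e (by omega)
  · rw [e1 (Or.inr k2), e2 (Or.inr k1), shiftSpace_eq_bot_of_nonneg lam k1 k2, finrank_bot]

/-! ## Monomial ideals -/

/-- The exponent of `x^i y^j`. -/
def boxExp (c : ℕ × ℕ) : Fin 2 →₀ ℕ := Finsupp.single 0 c.1 + Finsupp.single 1 c.2

/-- The box with the coordinates of an exponent. -/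
def expBox (a : Fin 2 →₀ ℕ) : ℕ × ℕ := (a 0, a 1)

@[simp]
theorem expBox_boxExp (c : ℕ × ℕ) : expBox (boxExp c) = c := by
  simp [expBox, boxExp]

@[simp]
theorem boxExp_expBox (a : Fin 2 →₀ ℕ) : boxExp (expBox a) = a := by
  ext i
  fin_cases i <;> simp [expBox, boxExp]

theorem boxExp_injective : Function.Injective boxExp :=
  Function.LeftInverse.injective expBox_boxExp

theorem boxExp_succ_left (i j : ℕ) : boxExp (i + 1, j) = boxExp (i, j) + Finsupp.single 0 1 := by
  simp only [boxExp, Finsupp.single_add]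
  abel

theorem boxExp_succ_right (i j : ℕ) : boxExp (i, j + 1) = boxExp (i, j) + Finsupp.single 1 1 := by
  simp only [boxExp, Finsupp.single_add]
  abel

theorem torusScale_monomial (s : Fin 2 → ℂˣ) (a : Fin 2 →₀ ℕ) (c : ℂ) :
    torusScale s (MvPolynomial.monomial a c) =
      MvPolynomial.monomial a (((s 0 : ℂ) ^ a 0 * (s 1 : ℂ) ^ a 1) * c) := by
  rw [torusScale, MvPolynomial.aeval_monomial, Finsupp.prod_fintype _ _ (by simp),
    Fin.prod_univ_two, MvPolynomial.monomial_eq, Finsupp.prod_fintype _ _ (by simp),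
    Fin.prod_univ_two]
  simp only [mul_pow, map_mul, map_pow, MvPolynomial.algebraMap_eq]
  ring

theorem coeff_torusScale (s : Fin 2 → ℂˣ) (a : Fin 2 →₀ ℕ) (f : Poly2) :
    (torusScale s f).coeff a = ((s 0 : ℂ) ^ a 0 * (s 1 : ℂ) ^ a 1) * f.coeff a := by
  classical
  induction f using MvPolynomial.induction_on' with
  | monomial b c =>
    rw [torusScale_monomial, MvPolynomial.coeff_monomial, MvPolynomial.coeff_monomial]
    split_ifs with h
    · rw [h]
    · rw [mul_zero]
  | add f g hf hg => rw [map_add, MvPolynomial.coeff_add, hf, hg, MvPolynomial.coeff_add, mul_add]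

/-- The ideal spanned by the monomials `x^i y^j` with `(i, j) ∉ λ`. -/
def monomialIdeal (lam : YoungDiagram) : Ideal Poly2 :=
  MvPolynomial.restrictSupportIdeal ℂ {a | expBox a ∉ lam} fun _ _ hab ha hb =>
    ha (lam.isLowerSet (Prod.mk_le_mk.mpr ⟨hab 0, hab 1⟩) hb)

theorem mem_monomialIdeal {lam : YoungDiagram} {f : Poly2} :
    f ∈ monomialIdeal lam ↔ ∀ c ∈ lam, f.coeff (boxExp c) = 0 := by
  have h : f ∈ monomialIdeal lam ↔ ∀ a ∈ f.support, expBox a ∉ lam := Iff.rfl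
  rw [h]
  constructor
  · intro h c hc
    by_contra h1
    exact h _ (MvPolynomial.mem_support_iff.mpr h1) (by rwa [expBox_boxExp])
  · intro h a ha hc
    apply MvPolynomial.mem_support_iff.mp ha
    rw [← boxExp_expBox a]
    exact h _ hc

theorem monomial_mem_monomialIdeal {lam : YoungDiagram} {c : ℕ × ℕ} (hc : c ∉ lam) (z : ℂ) :
    MvPolynomial.monomial (boxExp c) z ∈ monomialIdeal lam := by
  classical
  rw [mem_monomialIdeal]
  intro c' hc'
  rw [MvPolynomial.coeff_monomial, if_neg]
  intro h
  exact hc (boxExp_injective h ▸ hc')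

theorem torusScale_mem_monomialIdeal {lam : YoungDiagram} (s : Fin 2 → ℂˣ) {f : Poly2}
    (hf : f ∈ monomialIdeal lam) : torusScale s f ∈ monomialIdeal lam := by
  rw [mem_monomialIdeal] at hf ⊢
  intro c hc
  rw [coeff_torusScale, hf c hc, mul_zero]

theorem torusScale_torusScale_inv (s : Fin 2 → ℂˣ) (f : Poly2) :
    torusScale s (torusScale s⁻¹ f) = f := by
  ext a
  rw [coeff_torusScale, coeff_torusScale]
  simp only [Pi.inv_apply, Units.val_inv_eq_inv_val, inv_pow]
  field_simp

theorem map_torusScale_monomialIdeal (lam : YoungDiagram) (s : Fin 2 → ℂˣ) :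
    (monomialIdeal lam).map (torusScale s) = monomialIdeal lam := by
  refine le_antisymm (Ideal.map_le_iff_le_comap.mpr fun f hf => torusScale_mem_monomialIdeal s hf)
    fun f hf => ?_
  rw [← torusScale_torusScale_inv s f]
  exact Ideal.mem_map_of_mem _ (torusScale_mem_monomialIdeal _ hf)

open Classical in
/-- The coefficients of the normal form of an element of the quotient ring of a monomial ideal. -/
def normalForm (lam : YoungDiagram) : (Poly2 ⧸ monomialIdeal lam) →ₗ[ℂ] (ℕ × ℕ → ℂ) :=
  have h : ∀ (g : Poly2) (c : ℕ × ℕ), c ∈ lam →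
      (Quotient.out (Ideal.Quotient.mk (monomialIdeal lam) g)).coeff (boxExp c) =
        g.coeff (boxExp c) := fun g c hc => by
    have h1 := Ideal.Quotient.eq.mp (Ideal.Quotient.mk_out (Ideal.Quotient.mk (monomialIdeal lam) g))
    have h2 := mem_monomialIdeal.mp h1 c hc
    rwa [MvPolynomial.coeff_sub, sub_eq_zero] at h2
  { toFun := fun x c => if c ∈ lam then (Quotient.out x).coeff (boxExp c) else 0
    map_add' := fun x y => by
      obtain ⟨f, rfl⟩ := Ideal.Quotient.mk_surjective x
      obtain ⟨g, rfl⟩ := Ideal.Quotient.mk_surjective y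
      funext c
      by_cases hc : c ∈ lam
      · rw [Pi.add_apply, ← map_add]
        simp only [if_pos hc, h _ c hc, MvPolynomial.coeff_add]
      · simp only [Pi.add_apply, if_neg hc, add_zero]
    map_smul' := fun a x => by
      obtain ⟨f, rfl⟩ := Ideal.Quotient.mk_surjective x
      funext c
      by_cases hc : c ∈ lam
      · have h1 : a • Ideal.Quotient.mk (monomialIdeal lam) f = Ideal.Quotient.mk _ (a • f) := rfl
        rw [h1]
        simp only [Pi.smul_apply, if_pos hc, h _ c hc, MvPolynomial.coeff_smul, RingHom.id_apply]
      · simp only [Pi.smul_apply, if_neg hc, smul_zero] }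

theorem normalForm_mk {lam : YoungDiagram} (g : Poly2) {c : ℕ × ℕ} (hc : c ∈ lam) :
    normalForm lam (Ideal.Quotient.mk _ g) c = g.coeff (boxExp c) := by
  have h1 := Ideal.Quotient.eq.mp (Ideal.Quotient.mk_out (Ideal.Quotient.mk (monomialIdeal lam) g))
  have h2 := mem_monomialIdeal.mp h1 c hc
  rw [MvPolynomial.coeff_sub, sub_eq_zero] at h2
  rw [← h2]
  exact if_pos hc

theorem normalForm_of_notMem {lam : YoungDiagram} (x : Poly2 ⧸ monomialIdeal lam) {c : ℕ × ℕ}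
    (hc : c ∉ lam) : normalForm lam x c = 0 := if_neg hc

theorem normalForm_injective (lam : YoungDiagram) : Function.Injective (normalForm lam) := by
  rw [injective_iff_map_eq_zero]
  intro x hx
  obtain ⟨f, rfl⟩ := Ideal.Quotient.mk_surjective x
  rw [Ideal.Quotient.eq_zero_iff_mem, mem_monomialIdeal]
  intro c hc
  rw [← normalForm_mk f hc, hx, Pi.zero_apply]

theorem normalForm_X_smul {lam : YoungDiagram} (k : Fin 2) (x : Poly2 ⧸ monomialIdeal lam)
    {c c' : ℕ × ℕ} (hc : c ∈ lam) (h : boxExp c = boxExp c' + Finsupp.single k 1) (hc' : c' ∈ lam) :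
    normalForm lam ((MvPolynomial.X k : Poly2) • x) c = normalForm lam x c' := by
  obtain ⟨f, rfl⟩ := Ideal.Quotient.mk_surjective x
  have h1 : (MvPolynomial.X k : Poly2) • Ideal.Quotient.mk (monomialIdeal lam) f =
    Ideal.Quotient.mk _ (MvPolynomial.X k * f) := rfl
  rw [h1, normalForm_mk _ hc, normalForm_mk _ hc', h, add_comm, MvPolynomial.coeff_X_mul]

theorem normalForm_X_smul_eq_zero {lam : YoungDiagram} (k : Fin 2) (x : Poly2 ⧸ monomialIdeal lam)
    {c : ℕ × ℕ} (h : boxExp c k = 0) :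
    normalForm lam ((MvPolynomial.X k : Poly2) • x) c = 0 := by
  classical
  by_cases hc : c ∈ lam
  · obtain ⟨f, rfl⟩ := Ideal.Quotient.mk_surjective x
    have h1 : (MvPolynomial.X k : Poly2) • Ideal.Quotient.mk (monomialIdeal lam) f =
      Ideal.Quotient.mk _ (MvPolynomial.X k * f) := rfl
    rw [h1, normalForm_mk _ hc, MvPolynomial.coeff_X_mul', if_neg]
    rwa [Finsupp.mem_support_iff, not_not]
  · exact normalForm_of_notMem _ hc

/-- A basis of the quotient ring of a monomial ideal. -/
def quotientEquiv (lam : YoungDiagram) : (Poly2 ⧸ monomialIdeal lam) ≃ₗ[ℂ] (lam.cells → ℂ) :=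
  LinearEquiv.ofBijective
    ((LinearMap.funLeft ℂ ℂ (Subtype.val : lam.cells → ℕ × ℕ)) ∘ₗ normalForm lam) (by
    classical
    constructor
    · rw [injective_iff_map_eq_zero]
      intro x hx
      refine normalForm_injective lam ?_
      rw [map_zero]
      funext c
      by_cases hc : c ∈ lam
      · exact congrFun hx ⟨c, hc⟩
      · exact normalForm_of_notMem _ hc
    · intro v
      refine ⟨Ideal.Quotient.mk _ (∑ c, MvPolynomial.monomial (boxExp c.1) (v c)),
        funext fun c => ?_⟩
      rw [LinearMap.comp_apply, LinearMap.funLeft_apply,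
        normalForm_mk _ ((YoungDiagram.mem_cells (μ := lam) _).mp c.2), MvPolynomial.coeff_sum,
        Finset.sum_eq_single c]
      · rw [MvPolynomial.coeff_monomial, if_pos rfl]
      · intro d _ hd
        rw [MvPolynomial.coeff_monomial, if_neg]
        intro h
        exact hd (Subtype.ext (boxExp_injective h))
      · simp)

theorem monomialIdeal_mem_hilbFixed (lam : YoungDiagram) :
    monomialIdeal lam ∈ hilbFixed lam.card := by
  refine ⟨Module.Finite.equiv (quotientEquiv lam).symm, ?_, map_torusScale_monomialIdeal lam⟩
  rw [(quotientEquiv lam).finrank_eq, Module.finrank_fintype_fun_eq_card, Fintype.card_coe]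

theorem monomial_mem_monomialIdeal_iff {lam : YoungDiagram} {c : ℕ × ℕ} :
    MvPolynomial.monomial (boxExp c) (1 : ℂ) ∈ monomialIdeal lam ↔ c ∉ lam := by
  classical
  refine ⟨fun h hc => ?_, fun h => monomial_mem_monomialIdeal h 1⟩
  have h1 := mem_monomialIdeal.mp h c hc
  rw [MvPolynomial.coeff_monomial, if_pos rfl] at h1
  exact one_ne_zero h1

theorem monomialIdeal_injective : Function.Injective monomialIdeal := by
  intro lam mu h
  refine SetLike.ext fun c => not_iff_not.mp ?_
  rw [← monomial_mem_monomialIdeal_iff, h, monomial_mem_monomialIdeal_iff]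

/-- A torus invariant ideal contains the monomials of its elements. -/
theorem monomial_mem_of_torus_invariant {I : Ideal Poly2}
    (hI : ∀ s : Fin 2 → ℂˣ, I.map (torusScale s) = I) {f : Poly2} (hf : f ∈ I) {a : Fin 2 →₀ ℕ}
    (ha : a ∈ f.support) : MvPolynomial.monomial a (1 : ℂ) ∈ I := by
  classical
  have hT : ∀ s, ∀ g ∈ I, torusScale s g ∈ I := fun s g hg => by
    have := Ideal.mem_map_of_mem (torusScale s) hg
    rwa [hI s] at this
  induction hn : f.support.card using Nat.strong_induction_on generalizing f with
  | _ n ih =>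
    by_cases hsub : ∃ b ∈ f.support, b ≠ a
    · obtain ⟨b, hb, hba⟩ := hsub
      obtain ⟨k, hk⟩ : ∃ k, b k ≠ a k := by
        by_contra h
        push Not at h
        exact hba (Finsupp.ext h)
      -- A torus element that separates the exponents `a` and `b`: it scales the coordinate in which
      -- they differ by `2`. The combination `g` below loses the monomial `b`, keeps `a` and gains
      -- nothing, so the support shrinks.
      set s : Fin 2 → ℂˣ := Pi.mulSingle k (Units.mk0 2 two_ne_zero)
      set z : (Fin 2 →₀ ℕ) → ℂ := fun e => (s 0 : ℂ) ^ e 0 * (s 1 : ℂ) ^ e 1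
      have hz : ∀ e, z e = ((2 ^ e k : ℕ) : ℂ) := by
        intro e
        fin_cases k <;> simp [z, s]
      have hzab : z a ≠ z b := by
        rw [hz, hz]
        intro h
        exact hk (Nat.pow_right_injective le_rfl (Nat.cast_injective h)).symm
      set g := torusScale s f - MvPolynomial.C (z b) * f
      have hg : g ∈ I := I.sub_mem (hT s f hf) (I.mul_mem_left _ hf)
      have hcoef : ∀ e, g.coeff e = (z e - z b) * f.coeff e := fun e => by
        rw [MvPolynomial.coeff_sub, coeff_torusScale, MvPolynomial.coeff_C_mul]
        ring
      have hga : a ∈ g.support := by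
        rw [MvPolynomial.mem_support_iff, hcoef]
        exact mul_ne_zero (sub_ne_zero.mpr hzab) (MvPolynomial.mem_support_iff.mp ha)
      have hlt : g.support.card < f.support.card := by
        refine Finset.card_lt_card ((Finset.ssubset_iff_of_subset fun e he => ?_).mpr ⟨b, hb, ?_⟩)
        · rw [MvPolynomial.mem_support_iff, hcoef] at he
          exact MvPolynomial.mem_support_iff.mpr (right_ne_zero_of_mul he)
        · rw [MvPolynomial.mem_support_iff, hcoef, sub_self, zero_mul]
          exact fun h => h rfl
      exact ih _ (hn ▸ hlt) hg hga rfl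
    · push Not at hsub
      have h1 : f = MvPolynomial.monomial a (f.coeff a) := by
        ext e
        rw [MvPolynomial.coeff_monomial]
        split_ifs with h
        · rw [h]
        · by_contra hne
          exact h (hsub e (MvPolynomial.mem_support_iff.mpr hne)).symm
      have h2 := I.mul_mem_left (MvPolynomial.C (f.coeff a)⁻¹) hf
      rwa [h1, MvPolynomial.coeff_monomial, if_pos rfl, MvPolynomial.C_mul_monomial,
        inv_mul_cancel₀ (MvPolynomial.mem_support_iff.mp ha)] at h2

/-- An invariant ideal is spanned by its monomials. The monomials it misses are linearly independent
in the quotient, hence finite in number, and they form a lower set because an ideal absorbs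
multiplication; this is the diagram. -/
theorem exists_eq_monomialIdeal {I : Ideal Poly2} [Module.Finite ℂ (Poly2 ⧸ I)]
    (hI : ∀ s : Fin 2 → ℂˣ, I.map (torusScale s) = I) : ∃ lam, I = monomialIdeal lam := by
  classical
  have hmem : ∀ f : Poly2, f ∈ I ↔ ∀ a ∈ f.support, MvPolynomial.monomial a (1 : ℂ) ∈ I := by
    refine fun f => ⟨fun hf a ha => monomial_mem_of_torus_invariant hI hf ha, fun h => ?_⟩
    rw [f.as_sum]
    refine I.sum_mem fun a ha => ?_
    have := I.mul_mem_left (MvPolynomial.C (f.coeff a)) (h a ha)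
    rwa [MvPolynomial.C_mul_monomial, mul_one] at this
  set S : Set (ℕ × ℕ) := {c | MvPolynomial.monomial (boxExp c) (1 : ℂ) ∉ I}
  have hli : LinearIndependent ℂ fun c : S =>
      Ideal.Quotient.mk I (MvPolynomial.monomial (boxExp c.1) (1 : ℂ)) := by
    rw [linearIndependent_iff']
    intro s g hg c hc
    have h1 : ∑ d ∈ s, g d • Ideal.Quotient.mk I (MvPolynomial.monomial (boxExp d.1) (1 : ℂ)) =
        Ideal.Quotient.mk I (∑ d ∈ s, MvPolynomial.monomial (boxExp d.1) (g d)) := by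
      rw [map_sum]
      refine Finset.sum_congr rfl fun d _ => ?_
      rw [← mul_one (g d), ← smul_eq_mul, ← MvPolynomial.smul_monomial, smul_eq_mul, mul_one]
      rfl
    rw [h1, Ideal.Quotient.eq_zero_iff_mem, hmem] at hg
    by_contra hne
    refine c.2 (hg _ (MvPolynomial.mem_support_iff.mpr ?_))
    rw [MvPolynomial.coeff_sum, Finset.sum_eq_single c]
    · rwa [MvPolynomial.coeff_monomial, if_pos rfl]
    · intro d _ hd
      rw [MvPolynomial.coeff_monomial, if_neg]
      intro h
      exact hd (Subtype.ext (boxExp_injective h))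
    · exact fun h => absurd hc h
  have hfin : S.Finite := Set.finite_coe_iff.mp hli.finite_of_isNoetherian
  have hlow : IsLowerSet S := by
    intro c d hdc hc hd
    refine hc ?_
    have := I.mul_mem_left (MvPolynomial.monomial (boxExp (c - d)) (1 : ℂ)) hd
    rw [MvPolynomial.monomial_mul, mul_one] at this
    have h1 : boxExp (c - d) + boxExp d = boxExp c := by
      obtain ⟨h1, h2⟩ := hdc
      simp only [boxExp, Prod.fst_sub, Prod.snd_sub]
      rw [add_add_add_comm, ← Finsupp.single_add, ← Finsupp.single_add, Nat.sub_add_cancel h1,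
        Nat.sub_add_cancel h2]
    rwa [h1] at this
  refine ⟨⟨hfin.toFinset, by simpa using hlow⟩, Ideal.ext fun f => ?_⟩
  have h3 : f ∈ monomialIdeal ⟨hfin.toFinset, by simpa using hlow⟩ ↔
    ∀ a ∈ f.support, expBox a ∉ hfin.toFinset := Iff.rfl
  rw [h3, hmem]
  refine forall₂_congr fun a _ => ?_
  rw [Set.Finite.mem_toFinset, Set.mem_ofPred_eq, not_not, boxExp_expBox]

theorem bijOn_monomialIdeal (n : ℕ) :
    Set.BijOn monomialIdeal {lam | lam.card = n} (hilbFixed n) := by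
  refine ⟨?_, monomialIdeal_injective.injOn, ?_⟩
  · rintro lam rfl
    exact monomialIdeal_mem_hilbFixed lam
  · rintro I ⟨h1, h2, h3⟩
    obtain ⟨lam, rfl⟩ := exists_eq_monomialIdeal h3
    exact ⟨lam, (monomialIdeal_mem_hilbFixed lam).2.1.symm.trans h2, rfl⟩

/-! ## The tangent spaces of the Hilbert scheme at the fixed points -/

/-- The box `b + w`, for `b + w ≥ 0`. -/
def shiftBy (w : ℤ × ℤ) (b : ℕ × ℕ) : ℕ × ℕ := ((b.1 + w.1).toNat, (b.2 + w.2).toNat)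

theorem isShiftBox_iff_shiftBy {lam : YoungDiagram} {w : ℤ × ℤ} {b : ℕ × ℕ} :
    IsShiftBox lam w b ↔ b ∉ lam ∧ 0 ≤ b.1 + w.1 ∧ 0 ≤ b.2 + w.2 ∧ shiftBy w b ∈ lam := by
  refine and_congr_right fun _ => ⟨?_, ?_⟩
  · rintro ⟨a, ha, h1, h2⟩
    refine ⟨by omega, by omega, ?_⟩
    rwa [show shiftBy w b = a from Prod.ext (by simp only [shiftBy]; omega)
      (by simp only [shiftBy]; omega)]
  · rintro ⟨h1, h2, h3⟩
    exact ⟨_, h3, by simp only [shiftBy]; omega, by simp only [shiftBy]; omega⟩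

open Classical in
/-- The monomial generators of a monomial ideal. -/
def gen (lam : YoungDiagram) (b : ℕ × ℕ) : monomialIdeal lam :=
  if h : b ∉ lam then ⟨MvPolynomial.monomial (boxExp b) 1, monomial_mem_monomialIdeal h 1⟩ else 0

theorem coe_gen {lam : YoungDiagram} {b : ℕ × ℕ} (h : b ∉ lam) :
    (gen lam b : Poly2) = MvPolynomial.monomial (boxExp b) 1 := by
  rw [gen, dif_pos h]

theorem eq_sum_gen {lam : YoungDiagram} (f : monomialIdeal lam) :
    f = ∑ a ∈ (f : Poly2).support,
      (MvPolynomial.C ((f : Poly2).coeff a) : Poly2) • gen lam (expBox a) := by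
  refine Subtype.ext ?_
  rw [AddSubmonoidClass.coe_finsetSum]
  conv_lhs => rw [(f : Poly2).as_sum]
  refine Finset.sum_congr rfl fun a ha => ?_
  have h1 : expBox a ∉ lam := f.2 ha
  rw [Submodule.coe_smul, coe_gen h1, smul_eq_mul, MvPolynomial.C_mul_monomial, mul_one,
    boxExp_expBox]

theorem hom_eq_zero {lam : YoungDiagram} {M : Type*} [AddCommGroup M] [Module Poly2 M]
    (φ : monomialIdeal lam →ₗ[Poly2] M) (h : ∀ b, b ∉ lam → φ (gen lam b) = 0) : φ = 0 := by
  refine LinearMap.ext fun f => ?_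
  rw [eq_sum_gen f, map_sum, LinearMap.zero_apply]
  refine Finset.sum_eq_zero fun a ha => ?_
  rw [map_smul, h _ (f.2 ha), smul_zero]

/-- Comparing the torus action on `φ(x^b)` and on its coefficient at `x^c` gives `s^c = s^{w+b}` for
every `s` whenever that coefficient is nonzero. -/
theorem normalForm_eq_zero_of_mem_tangentWeight {lam : YoungDiagram} {w : ℤ × ℤ}
    {φ : monomialIdeal lam →ₗ[Poly2] Poly2 ⧸ monomialIdeal lam}
    (hφ : φ ∈ tangentWeight (monomialIdeal lam) w) {b c : ℕ × ℕ} (hb : b ∉ lam)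
    (hc : ¬ ((c.1 : ℤ) = b.1 + w.1 ∧ (c.2 : ℤ) = b.2 + w.2)) :
    normalForm lam (φ (gen lam b)) c = 0 := by
  by_cases hcl : c ∈ lam
  swap
  · exact normalForm_of_notMem _ hcl
  by_contra hne
  apply hc
  have key : ∀ s : Fin 2 → ℂˣ, (s 0 : ℂ) ^ c.1 * (s 1 : ℂ) ^ c.2 =
      ((s 0 : ℂ) ^ w.1 * (s 1 : ℂ) ^ w.2) * ((s 0 : ℂ) ^ b.1 * (s 1 : ℂ) ^ b.2) := by
    intro s
    set z : ℂ := (s 0 : ℂ) ^ b.1 * (s 1 : ℂ) ^ b.2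
    have h1 : (((MvPolynomial.C z : Poly2) • gen lam b : monomialIdeal lam) : Poly2) =
        torusScale s (gen lam b) := by
      rw [Submodule.coe_smul, coe_gen hb, torusScale_monomial, smul_eq_mul,
        MvPolynomial.C_mul_monomial, mul_one]
      simp [z, boxExp]
    obtain ⟨g, hg1, hg2⟩ := hφ s (gen lam b) _ h1
    rw [hg1, normalForm_mk _ hcl] at hne
    have h2 : ((MvPolynomial.C z : Poly2) • Ideal.Quotient.mk (monomialIdeal lam) g) =
      Ideal.Quotient.mk (monomialIdeal lam) (MvPolynomial.C z * g) := rfl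
    rw [map_smul, hg1, h2] at hg2
    have h3 := congrFun (congrArg (normalForm lam) hg2) c
    rw [map_smul, Pi.smul_apply, normalForm_mk _ hcl, normalForm_mk _ hcl, coeff_torusScale,
      MvPolynomial.coeff_C_mul, smul_eq_mul, ← mul_assoc] at h3
    have h4 := mul_right_cancel₀ hne h3
    simpa [boxExp] using h4
  have hinj : Function.Injective fun n : ℤ => (2 : ℂ) ^ n := by
    intro m n h
    have h' := congrArg norm h
    simp only [norm_zpow, Complex.norm_ofNat] at h'
    exact zpow_right_injective₀ (by norm_num) (by norm_num) h'
  have h2 : (2 : ℂ) ≠ 0 := two_ne_zero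
  constructor
  -- The torus element `(2, 1)` isolates the first exponent, and integer powers of `2` are distinct.
  · have h := key ![Units.mk0 2 h2, 1]
    apply hinj
    simp only [Matrix.cons_val_zero, Matrix.cons_val_one, Units.val_mk0, Units.val_one, one_pow,
      one_zpow, mul_one] at h ⊢
    rw [zpow_natCast, h, zpow_add₀ h2, zpow_natCast, mul_comm]
  · have h := key ![1, Units.mk0 2 h2]
    apply hinj
    simp only [Matrix.cons_val_zero, Matrix.cons_val_one, Units.val_mk0, Units.val_one, one_pow,
      one_zpow, one_mul] at h ⊢
    rw [zpow_natCast, h, zpow_add₀ h2, zpow_natCast, mul_comm]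

open Classical in
/-- The coefficients of a homogeneous homomorphism. -/
def homCoeff (lam : YoungDiagram) (w : ℤ × ℤ) :
    tangentWeight (monomialIdeal lam) w →ₗ[ℂ] (ℕ × ℕ → ℂ) where
  toFun φ b := if IsShiftBox lam w b then normalForm lam (φ.1 (gen lam b)) (shiftBy w b) else 0
  map_add' φ ψ := by
    funext b
    by_cases h : IsShiftBox lam w b
    · simp only [if_pos h, Submodule.coe_add, LinearMap.add_apply, map_add, Pi.add_apply]
    · simp only [if_neg h, Pi.add_apply, add_zero]
  map_smul' a φ := by
    funext b
    by_cases h : IsShiftBox lam w b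
    · simp only [if_pos h, Submodule.coe_smul, LinearMap.smul_apply, map_smul, Pi.smul_apply,
        RingHom.id_apply]
    · simp only [if_neg h, Pi.smul_apply, smul_zero]

theorem normalForm_gen {lam : YoungDiagram} {w : ℤ × ℤ} (φ : tangentWeight (monomialIdeal lam) w)
    {b c : ℕ × ℕ} (hb : b ∉ lam) (hc : c ∈ lam) (h1 : (c.1 : ℤ) = b.1 + w.1)
    (h2 : (c.2 : ℤ) = b.2 + w.2) :
    normalForm lam (φ.1 (gen lam b)) c = homCoeff lam w φ b := by
  have h3 : IsShiftBox lam w b := ⟨hb, c, hc, h1, h2⟩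
  have h4 : shiftBy w b = c := Prod.ext (by simp only [shiftBy]; omega)
    (by simp only [shiftBy]; omega)
  rw [← h4]
  exact (if_pos h3).symm

theorem homCoeff_of_not {lam : YoungDiagram} {w : ℤ × ℤ} (φ : tangentWeight (monomialIdeal lam) w)
    {b : ℕ × ℕ} (hb : ¬ IsShiftBox lam w b) : homCoeff lam w φ b = 0 := if_neg hb

theorem gen_eq_X_smul {lam : YoungDiagram} {b b' : ℕ × ℕ} {k : Fin 2} (hb : b ∉ lam)
    (hb' : b' ∉ lam) (h : boxExp b = boxExp b' + Finsupp.single k 1) :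
    gen lam b = (MvPolynomial.X k : Poly2) • gen lam b' := by
  refine Subtype.ext ?_
  rw [Submodule.coe_smul, coe_gen hb, coe_gen hb', h, smul_eq_mul, MvPolynomial.X,
    MvPolynomial.monomial_mul, mul_one, add_comm]

/-- Linearity over `ℂ[x, y]` relates the images of neighbouring monomial generators by
multiplication with `x` or `y`. If the target box has no predecessor, then both coefficients vanish.
-/
theorem homCoeff_mem_shiftSpace {lam : YoungDiagram} {w : ℤ × ℤ}
    (φ : tangentWeight (monomialIdeal lam) w) : homCoeff lam w φ ∈ shiftSpace lam w := by
  refine ⟨fun b hb => homCoeff_of_not φ hb, fun i j hn hs => ?_, fun i j hn hs => ?_⟩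
  · obtain ⟨hb, ⟨a1, a2⟩, ha, h1, h2⟩ := hs
    simp only at h1 h2
    rw [← normalForm_gen φ hb ha h1 h2, gen_eq_X_smul hb hn (boxExp_succ_left i j), map_smul]
    rcases a1 with _ | a1
    · rw [normalForm_X_smul_eq_zero _ _ (by simp [boxExp]), homCoeff_of_not φ]
      rintro ⟨-, a, -, h3, -⟩
      push_cast at h1 h3
      omega
    · have ha' : (a1, a2) ∈ lam := lam.isLowerSet (Prod.mk_le_mk.mpr ⟨Nat.le_succ _, le_rfl⟩) ha
      push_cast at h1
      rw [normalForm_X_smul _ _ ha (boxExp_succ_left a1 a2) ha',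
        normalForm_gen φ hn ha' (by simp only; omega) h2]
  · obtain ⟨hb, ⟨a1, a2⟩, ha, h1, h2⟩ := hs
    simp only at h1 h2
    rw [← normalForm_gen φ hb ha h1 h2, gen_eq_X_smul hb hn (boxExp_succ_right i j), map_smul]
    rcases a2 with _ | a2
    · rw [normalForm_X_smul_eq_zero _ _ (by simp [boxExp]), homCoeff_of_not φ]
      rintro ⟨-, a, -, -, h3⟩
      push_cast at h2 h3
      omega
    · have ha' : (a1, a2) ∈ lam := lam.isLowerSet (Prod.mk_le_mk.mpr ⟨le_rfl, Nat.le_succ _⟩) ha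
      push_cast at h2
      rw [normalForm_X_smul _ _ ha (boxExp_succ_right a1 a2) ha',
        normalForm_gen φ hn ha' h1 (by simp only; omega)]

theorem homCoeff_injective (lam : YoungDiagram) (w : ℤ × ℤ) :
    Function.Injective (homCoeff lam w) := by
  rw [injective_iff_map_eq_zero]
  intro φ hφ
  refine Subtype.ext (hom_eq_zero φ.1 fun b hb => normalForm_injective lam ?_)
  rw [map_zero]
  funext c
  by_cases hc : (c.1 : ℤ) = b.1 + w.1 ∧ (c.2 : ℤ) = b.2 + w.2
  · by_cases hcl : c ∈ lam
    · rw [normalForm_gen φ hb hcl hc.1 hc.2, hφ, Pi.zero_apply, Pi.zero_apply]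
    · exact normalForm_of_notMem _ hcl
  · exact normalForm_eq_zero_of_mem_tangentWeight φ.2 hb hc

/-- The linear map `x^b ↦ F(b) x^{b + w}`. -/
def shiftMap (w : ℤ × ℤ) (F : ℕ × ℕ → ℂ) : Poly2 →ₗ[ℂ] Poly2 :=
  (MvPolynomial.basisMonomials (Fin 2) ℂ).constr ℂ fun a =>
    MvPolynomial.monomial (boxExp (shiftBy w (expBox a))) (F (expBox a))

theorem shiftMap_monomial (w : ℤ × ℤ) (F : ℕ × ℕ → ℂ) (b : ℕ × ℕ) (z : ℂ) :
    shiftMap w F (MvPolynomial.monomial (boxExp b) z) =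
      MvPolynomial.monomial (boxExp (shiftBy w b)) (z * F b) := by
  have h1 : (MvPolynomial.monomial (boxExp b) z : Poly2) =
      z • MvPolynomial.basisMonomials (Fin 2) ℂ (boxExp b) := by
    rw [MvPolynomial.coe_basisMonomials, MvPolynomial.smul_monomial, smul_eq_mul, mul_one]
  rw [h1, map_smul, shiftMap, Module.Basis.constr_basis, expBox_boxExp, MvPolynomial.smul_monomial,
    smul_eq_mul]

theorem linearMap_ext_monomial {M : Type*} [AddCommGroup M] [Module ℂ M] {L L' : Poly2 →ₗ[ℂ] M}
    (s : Set (ℕ × ℕ)) (h : ∀ b ∈ s, ∀ z, L (MvPolynomial.monomial (boxExp b) z) =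
      L' (MvPolynomial.monomial (boxExp b) z)) {f : Poly2} (hf : ∀ a ∈ f.support, expBox a ∈ s) :
    L f = L' f := by
  rw [f.as_sum, map_sum, map_sum]
  refine Finset.sum_congr rfl fun a ha => ?_
  rw [← boxExp_expBox a]
  exact h _ (hf a ha) _

/-- On monomials the identity holds only modulo the ideal: when `b` is a shift box but its neighbour
`b'` is not, the shifted neighbour has left `λ` and its monomial vanishes in the quotient. -/
theorem mk_shiftMap_X_mul {lam : YoungDiagram} {w : ℤ × ℤ} {F : ℕ × ℕ → ℂ}
    (hF : F ∈ shiftSpace lam w) (k : Fin 2) {f : Poly2} (hf : f ∈ monomialIdeal lam) :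
    Ideal.Quotient.mk (monomialIdeal lam) (shiftMap w F (MvPolynomial.X k * f)) =
      Ideal.Quotient.mk (monomialIdeal lam) (MvPolynomial.X k * shiftMap w F f) := by
  obtain ⟨hF1, hF2, hF3⟩ := hF
  have hcase : ∀ b b' : ℕ × ℕ, b ∉ lam → boxExp b' = boxExp b + Finsupp.single k 1 →
      (IsShiftBox lam w b' → F b' = F b) → b' ∉ lam → (0 ≤ b.1 + w.1 → 0 ≤ b.2 + w.2 →
        boxExp (shiftBy w b') = boxExp (shiftBy w b) + Finsupp.single k 1) → ∀ z : ℂ,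
      Ideal.Quotient.mk (monomialIdeal lam)
        (shiftMap w F (MvPolynomial.X k * MvPolynomial.monomial (boxExp b) z)) =
      Ideal.Quotient.mk (monomialIdeal lam)
        (MvPolynomial.X k * shiftMap w F (MvPolynomial.monomial (boxExp b) z)) := by
    intro b b' hb h1 h2 hb' h3 z
    have h4 : ∀ (e : Fin 2 →₀ ℕ) (y : ℂ), (MvPolynomial.X k * MvPolynomial.monomial e y : Poly2) =
        MvPolynomial.monomial (e + Finsupp.single k 1) y := fun e y => by
      rw [MvPolynomial.X, MvPolynomial.monomial_mul, one_mul, add_comm]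
    rw [h4, ← h1, shiftMap_monomial, shiftMap_monomial, h4]
    by_cases hb0 : F b = 0
    · have h5 : F b' = 0 := by
        by_cases hs : IsShiftBox lam w b'
        · rw [h2 hs, hb0]
        · exact hF1 _ hs
      rw [hb0, h5, mul_zero, MvPolynomial.monomial_zero, MvPolynomial.monomial_zero]
    · have hs : IsShiftBox lam w b := by
        by_contra h
        exact hb0 (hF1 b h)
      obtain ⟨-, h5, h6, -⟩ := isShiftBox_iff_shiftBy.mp hs
      rw [← h3 h5 h6]
      by_cases hs' : IsShiftBox lam w b'
      · rw [h2 hs']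
      · rw [hF1 _ hs', mul_zero, MvPolynomial.monomial_zero, map_zero]
        refine (Ideal.Quotient.eq_zero_iff_mem.mpr (monomial_mem_monomialIdeal ?_ _)).symm
        intro h7
        refine hs' (isShiftBox_iff_shiftBy.mpr ⟨hb', ?_, ?_, h7⟩)
        · have h8 := DFunLike.congr_fun h1 0
          simp [boxExp] at h8
          omega
        · have h8 := DFunLike.congr_fun h1 1
          simp [boxExp] at h8
          omega
  have hup : ∀ b b' : ℕ × ℕ, b ≤ b' → b ∉ lam → b' ∉ lam := fun b b' h h1 h2 =>
    h1 (lam.isLowerSet h h2)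
  refine linearMap_ext_monomial (f := f)
    (L := (Ideal.Quotient.mkₐ ℂ (monomialIdeal lam)).toLinearMap ∘ₗ shiftMap w F ∘ₗ
      LinearMap.mulLeft ℂ (MvPolynomial.X k))
    (L' := (Ideal.Quotient.mkₐ ℂ (monomialIdeal lam)).toLinearMap ∘ₗ
      LinearMap.mulLeft ℂ (MvPolynomial.X k) ∘ₗ shiftMap w F) {b | b ∉ lam} ?_ fun a ha => hf ha
  rintro ⟨i, j⟩ hb z
  fin_cases k
  · refine hcase (i, j) (i + 1, j) hb (boxExp_succ_left i j) (hF2 i j hb)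
      (hup _ _ (Prod.mk_le_mk.mpr ⟨Nat.le_succ _, le_rfl⟩) hb) (fun h1 h2 => ?_) z
    simp only at h1
    refine Eq.trans (congrArg boxExp (Prod.ext ?_ ?_)) (boxExp_succ_left _ _) <;>
      simp only [shiftBy]
    push_cast
    omega
  · refine hcase (i, j) (i, j + 1) hb (boxExp_succ_right i j) (hF3 i j hb)
      (hup _ _ (Prod.mk_le_mk.mpr ⟨le_rfl, Nat.le_succ _⟩) hb) (fun h1 h2 => ?_) z
    simp only at h2
    refine Eq.trans (congrArg boxExp (Prod.ext ?_ ?_)) (boxExp_succ_right _ _) <;>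
      simp only [shiftBy]
    push_cast
    omega

theorem mk_shiftMap_mul {lam : YoungDiagram} {w : ℤ × ℤ} {F : ℕ × ℕ → ℂ}
    (hF : F ∈ shiftSpace lam w) (p : Poly2) {f : Poly2} (hf : f ∈ monomialIdeal lam) :
    Ideal.Quotient.mk (monomialIdeal lam) (shiftMap w F (p * f)) =
      Ideal.Quotient.mk (monomialIdeal lam) (p * shiftMap w F f) := by
  induction p using MvPolynomial.induction_on generalizing f with
  | C a => rw [← MvPolynomial.smul_eq_C_mul, ← MvPolynomial.smul_eq_C_mul, map_smul]
  | add p p' h h' => rw [add_mul, map_add, map_add, h hf, h' hf, add_mul, map_add]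
  | mul_X p k h =>
    rw [mul_assoc, h (Ideal.mul_mem_left _ _ hf), map_mul, mk_shiftMap_X_mul hF k hf, ← map_mul,
      mul_assoc]

/-- The homogeneous homomorphism with given coefficients. -/
def shiftHom {lam : YoungDiagram} {w : ℤ × ℤ} {F : ℕ × ℕ → ℂ} (hF : F ∈ shiftSpace lam w) :
    monomialIdeal lam →ₗ[Poly2] Poly2 ⧸ monomialIdeal lam where
  toFun f := Ideal.Quotient.mk _ (shiftMap w F f)
  map_add' f g := by rw [Submodule.coe_add, map_add, map_add]
  map_smul' p f := mk_shiftMap_mul hF p f.2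

theorem torusScale_shiftMap {lam : YoungDiagram} {w : ℤ × ℤ} {F : ℕ × ℕ → ℂ}
    (hF : F ∈ shiftSpace lam w) (s : Fin 2 → ℂˣ) (f : Poly2) :
    torusScale s (shiftMap w F f) =
      ((s 0 : ℂ) ^ w.1 * (s 1 : ℂ) ^ w.2) • shiftMap w F (torusScale s f) := by
  refine linearMap_ext_monomial (L := (torusScale s).toLinearMap ∘ₗ shiftMap w F)
    (L' := ((s 0 : ℂ) ^ w.1 * (s 1 : ℂ) ^ w.2) • (shiftMap w F ∘ₗ (torusScale s).toLinearMap))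
    Set.univ (fun b _ z => ?_) fun _ _ => Set.mem_univ _
  rw [LinearMap.comp_apply, LinearMap.smul_apply, LinearMap.comp_apply, AlgHom.toLinearMap_apply,
    AlgHom.toLinearMap_apply, torusScale_monomial, shiftMap_monomial, shiftMap_monomial,
    torusScale_monomial, MvPolynomial.smul_monomial, smul_eq_mul]
  congr 1
  by_cases hs : IsShiftBox lam w b
  · obtain ⟨-, h1, h2, -⟩ := isShiftBox_iff_shiftBy.mp hs
    have e : ∀ (k : ℂˣ) (n : ℕ) (m : ℤ), 0 ≤ n + m →
        (k : ℂ) ^ (n + m).toNat = (k : ℂ) ^ m * (k : ℂ) ^ n := fun k n m h => by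
      rw [← zpow_natCast, Int.toNat_of_nonneg h, zpow_add₀ k.ne_zero, zpow_natCast, mul_comm]
    have e0 : ∀ c, boxExp c 0 = c.1 := fun c => by simp [boxExp]
    have e1 : ∀ c, boxExp c 1 = c.2 := fun c => by simp [boxExp]
    rw [e0, e1, e0, e1, shiftBy, e _ _ _ h1, e _ _ _ h2]
    ring
  · rw [hF.1 b hs]
    ring

theorem shiftHom_mem_tangentWeight {lam : YoungDiagram} {w : ℤ × ℤ} {F : ℕ × ℕ → ℂ}
    (hF : F ∈ shiftSpace lam w) : shiftHom hF ∈ tangentWeight (monomialIdeal lam) w := by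
  intro s f f' h
  refine ⟨shiftMap w F f, rfl, ?_⟩
  rw [torusScale_shiftMap hF, ← h]
  rfl

theorem homCoeff_shiftHom {lam : YoungDiagram} {w : ℤ × ℤ} {F : ℕ × ℕ → ℂ}
    (hF : F ∈ shiftSpace lam w) :
    homCoeff lam w ⟨shiftHom hF, shiftHom_mem_tangentWeight hF⟩ = F := by
  classical
  funext b
  by_cases hs : IsShiftBox lam w b
  · obtain ⟨h0, h1, h2, h3⟩ := isShiftBox_iff_shiftBy.mp hs
    rw [← normalForm_gen _ h0 h3 (by simp only [shiftBy]; omega) (by simp only [shiftBy]; omega)]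
    change normalForm lam (Ideal.Quotient.mk _ (shiftMap w F (gen lam b : Poly2))) _ = _
    rw [normalForm_mk _ h3, coe_gen h0, shiftMap_monomial, MvPolynomial.coeff_monomial, if_pos rfl,
      one_mul]
  · rw [homCoeff_of_not _ hs, hF.1 b hs]

theorem finrank_tangentWeight (lam : YoungDiagram) (w : ℤ × ℤ) :
    Module.finrank ℂ (tangentWeight (monomialIdeal lam) w) =
      Module.finrank ℂ (shiftSpace lam w) :=
  (LinearEquiv.ofBijective
    ((homCoeff lam w).codRestrict (shiftSpace lam w) homCoeff_mem_shiftSpace)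
    ⟨fun _ _ h => homCoeff_injective lam w (congrArg Subtype.val h),
      fun F => ⟨⟨shiftHom F.2, shiftHom_mem_tangentWeight F.2⟩,
        Subtype.ext (homCoeff_shiftHom F.2)⟩⟩).finrank_eq

/-! ## The `χ_y`-genus -/

theorem finprod_pow_card_filter {ι κ M : Type*} [DecidableEq κ] [CommMonoid M] (s : Finset ι)
    (w w' : ι → κ) (G : κ → M) :
    ∏ᶠ k, G k ^ ((s.filter fun c => w c = k).card + (s.filter fun c => w' c = k).card) =
      ∏ c ∈ s, (G (w c) * G (w' c)) := by
  have h1 : (Function.mulSupport fun k =>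
      G k ^ ((s.filter fun c => w c = k).card + (s.filter fun c => w' c = k).card)) ⊆
      ((s.image w ∪ s.image w' : Finset κ) : Set κ) := by
    intro k hk
    by_contra hn
    apply hk
    rw [Finset.mem_coe, Finset.mem_union, Finset.mem_image, Finset.mem_image] at hn
    push Not at hn
    dsimp only
    rw [Finset.filter_eq_empty_iff.mpr fun c hc => hn.1 c hc,
      Finset.filter_eq_empty_iff.mpr fun c hc => hn.2 c hc, Finset.card_empty, pow_zero]
  rw [finprod_eq_prod_of_mulSupport_subset _ h1, Finset.prod_mul_distrib]
  simp only [pow_add]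
  rw [Finset.prod_mul_distrib]
  congr 1
  · rw [← Finset.prod_fiberwise_of_maps_to' (t := s.image w ∪ s.image w')
      fun c hc => Finset.mem_union_left _ (Finset.mem_image_of_mem w hc)]
    simp only [Finset.prod_const]
  · rw [← Finset.prod_fiberwise_of_maps_to' (t := s.image w ∪ s.image w')
      fun c hc => Finset.mem_union_right _ (Finset.mem_image_of_mem w' hc)]
    simp only [Finset.prod_const]

/-- At `(t₁, t₂) = (t, q⁻¹)` the degrees `(ℓ, -a-1)` and `(-ℓ-1, a)` become `t^ℓ q^{a+1}` and
`t^{-ℓ-1} q^{-a}`. The multiplicity of a degree counts the boxes producing it, so the product over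
degrees is a product over boxes. -/
theorem finprod_tangentWeight (P : Params) (lam : YoungDiagram) :
    ∏ᶠ w : ℤ × ℤ, ((1 - P.p * (P.t ^ w.1 * P.q⁻¹ ^ w.2)) / (1 - P.t ^ w.1 * P.q⁻¹ ^ w.2)) ^
      Module.finrank ℂ (tangentWeight (monomialIdeal lam) w) = Z P lam := by
  simp only [finrank_tangentWeight, finrank_shiftSpace]
  rw [finprod_pow_card_filter lam.cells (fun c => (leg lam c, -arm lam c - 1))
    (fun c => (-leg lam c - 1, arm lam c))
    fun w => (1 - P.p * (P.t ^ w.1 * P.q⁻¹ ^ w.2)) / (1 - P.t ^ w.1 * P.q⁻¹ ^ w.2), Z]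
  refine Finset.prod_congr rfl fun c _ => ?_
  dsimp only
  rw [inv_zpow', inv_zpow', show -(-arm lam c - 1) = arm lam c + 1 by ring, div_mul_div_comm]
  ring_nf

theorem instantonCoeff_eq_chiY (P : Params) (n : ℕ) :
    instantonCoeff P n = chiY n P.t P.q⁻¹ P.p := by
  rw [← finsum_Z, chiY]
  exact finsum_mem_eq_of_bijOn (s := {lam : YoungDiagram | lam.card = n}) monomialIdeal
    (bijOn_monomialIdeal n) fun lam _ => (finprod_tangentWeight P lam).symm

end EllipticToroidal

end

/-! ### The main theorem. -/

open EllipticToroidal in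
theorem mainTheorem1 (P : Params) :
    -- the operator `T(u) = ∑_λ Φ^*_λ(u) Φ_λ(u)`, term by term
    (∀ (N : ℤ) (u v : ℂ), u ≠ 0 → v ≠ 0 → ∀ lam : YoungDiagram,
      IsPhiStarPhi P N u v lam
        ((constC P * (frakq P N ^ lam.card * Z P lam)) • YY P lam u)) ∧
    -- its matrix elements, where the sum over partitions converges
    (∀ y x : ℕ+ →₀ ℕ, ∃ N₀ : ℤ, ∀ N : ℤ, N₀ ≤ N → ∀ u v : ℂ, u ≠ 0 → v ≠ 0 →
      ∃ σ : ℂ, HasSum (fun lam => frakq P N ^ lam.card * Z P lam * entry (YY P lam u) y x) σ ∧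
        IsTEntry P N u v y x (constC P * σ)) ∧
    -- the opposite order of composition
    (∀ (N : ℤ) (u v : ℂ), u ≠ 0 → v ≠ 0 → ∀ lam : YoungDiagram,
      IsPhiPhiStar P N u v lam
        ((constCOpp P * (frakqOpp P N ^ lam.card * Z P lam)) • YY P lam u)) ∧
    -- comparison with the Kimura-Pestun generating function
    (∀ (N : ℤ) (u : ℂ), u ≠ 0 → ∀ lam : YoungDiagram,
      (constC P * (frakq P N ^ lam.card * Z P lam)) • YY P lam u =
        constC P • kpTerm P (yCoeff P) P.p P.ps⁻¹ P.q⁻¹ (frakq P N) u lam) ∧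
    -- the vacuum expectation value
    (∀ (N : ℤ) (u v : ℂ), u ≠ 0 → v ≠ 0 → ∀ lam : YoungDiagram,
      IsPhiStarPhiEntry P N u v lam 0 0 (constC P * (frakq P N ^ lam.card * Z P lam))) ∧
    (∃ N₀ : ℤ, ∀ N : ℤ, N₀ ≤ N → ∀ u v : ℂ, u ≠ 0 → v ≠ 0 →
      ∃ σ : ℂ, HasSum (fun lam => frakq P N ^ lam.card * Z P lam) σ ∧
        HasSum (fun n : ℕ => frakq P N ^ n * instantonCoeff P n) σ ∧
        HasSum (fun n : ℕ => frakq P N ^ n * chiY n P.t P.q⁻¹ P.p) σ ∧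
        IsTEntry P N u v 0 0 (constC P * σ)) ∧
    (∀ n : ℕ, ∑ᶠ (lam : YoungDiagram) (_ : lam.card = n), Z P lam = instantonCoeff P n ∧
      instantonCoeff P n = chiY n P.t P.q⁻¹ P.p) ∧
    -- the screening currents
    (∀ (N : ℤ) (u z : ℂ), u ≠ 0 → z ≠ 0 →
      xPlus P N u (P.g * z) =
        (P.γ ^ N * u / z ^ N) • nexp P (fun m => sCoeff P m * z ^ (-m)) ∧
      xMinus P N u (P.g * z) =
        (P.γ ^ N * u / z ^ N)⁻¹ • nexp' P (fun m => -(sCoeff P m * z ^ (-m)))) ∧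
    (∀ m n : ℤ, m ≠ 0 → n ≠ 0 →
      ⁅sPlus P m, sPlus P n⁆ = (if m + n = 0 then
        -(1 / (m : ℂ)) * ((1 - P.p ^ m) / (1 - P.ps ^ m)) * (1 - P.q ^ m) * (1 - P.t ^ (-m))
        else 0) • 1 ∧
      ⁅sMinus P m, sMinus P n⁆ = (if m + n = 0 then
        -(1 / (m : ℂ)) * ((1 - P.ps ^ (-m)) / (1 - P.p ^ (-m))) * (1 - P.q ^ m) *
          (1 - P.t ^ (-m)) else 0) • 1) ∧
    IsKPHeisenberg P.p P.ps⁻¹ P.q⁻¹ (yOsc P) (fun m => P.γ ^ (-m) • sPlus P m) ∧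
    IsKPHeisenberg P.ps⁻¹ P.p P.q⁻¹ (yOsc P) (fun m => -(P.ps ^ m • sMinus P m)) := by
  have hchi := instantonCoeff_eq_chiY P
  refine ⟨fun N u v hu hv lam => isPhiStarPhi P N hu hv lam, fun y x => ?_,
    fun N u v hu hv lam => isPhiPhiStar P N hu hv lam,
    fun N u _ lam => smul_YY_eq_kpTerm P N u lam, fun N u v hu hv lam => ?_, ?_,
    fun n => ⟨finsum_Z P n, hchi n⟩, fun N u z _ _ => ⟨xPlus_eq P N u z, xMinus_eq P N u z⟩,
    fun m n hm hn => ⟨lie_sPlus P hm hn, lie_sMinus P hm hn⟩, isKPHeisenberg_sPlus P,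
    isKPHeisenberg_sMinus P⟩
  · obtain ⟨N₀, h⟩ := exists_summable_entry_YY P y x
    exact ⟨N₀, fun N hN u v hu hv => ⟨_, (h N hN u).hasSum,
      isTEntry_of_hasSum P N hu hv y x (h N hN u).hasSum⟩⟩
  · have h := isPhiStarPhi P N hu hv lam 0 0
    rwa [entry_smul, YY, nexp', entry_nexp_zero, mul_one] at h
  · obtain ⟨N₀, h⟩ := exists_summable_entry_YY P 0 0
    refine ⟨N₀, fun N hN u v hu hv => ⟨_, ?_, ?_, ?_,
      isTEntry_of_hasSum P N hu hv 0 0 (h N hN u).hasSum⟩⟩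
    all_goals
      have h1 := (h N hN u).hasSum
      simp only [YY, nexp', entry_nexp_zero, mul_one] at h1
    · simpa only [YY, nexp', entry_nexp_zero, mul_one] using h1
    · have h2 := hasSum_fiber_card h1
      simpa only [YY, nexp', entry_nexp_zero, mul_one, finsum_Z] using h2
    · have h2 := hasSum_fiber_card h1
      simpa only [YY, nexp', entry_nexp_zero, mul_one, finsum_Z, hchi] using h2
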